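/- Let $\mathbb{T}^2=(\mathbb{R}/\mathbb{Z})^2$, let $e_n$ $(n\in\mathbb{Z}^2)$ be the characters of $\mathbb{T}^2$ (written $e^{in\cdot x}$ with the factor $2\pi$ dropped), $\langle n\rangle=(1+|n|^2)^{1/2}$, and let $\langle\nabla\rangle=(1-\Delta)^{1/2}$ be the Fourier multiplier with symbol $\langle n\rangle$. For $s\in\mathbb{R}$ let $H^s(\mathbb{T}^2)$ be the Sobolev space of real-valued distributions with norm $\|f\|_{H^s}=\big(\sum_n\langle n\rangle^{2s}|\widehat f(n)|^2\big)^{1/2}$, put $\mathcal{H}^s=H^s(\mathbb{T}^2)\times H^{s-1}(\mathbb{T}^2)$, and let $$S(t)(f,g)=\cos(t\langle\nabla\rangle)f+\frac{\sin(t\langle\nabla\rangle)}{\langle\nabla\rangle}g .$$ Let $H_k(x;\sigma)$ be the Hermite polynomials, $e^{\tau x-\frac12\sigma\tau^2}=\sum_{k\ge0}\frac{\tau^k}{k!}H_k(x;\sigma)$. Let $\{g_{0,n},g_{1,n}\}_{n\in\mathbb{Z}^2}$ be independent standard complex-valued Gaussian random variables on a probability space $(\Omega,\mathcal{F},P)$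 conditioned that $g_{j,-n}=\overline{g_{j,n}}$. **Proposition.** Let $k\ge3$ be an odd integer and let $s\in\mathbb{R}$ satisfy $s>0$ if $k=3$ and $s\ge1$ if $k\ge5$. Let $(\phi_0,\phi_1)\in\mathcal{H}^s$ and $(r_0,r_1)\in\mathcal{H}^{s+1}$, and put $$\varphi_j^\omega=\sum_{n\in\mathbb{Z}^2}g_{j,n}(\omega)\,\widehat\phi_j(n)\,e_n+r_j\quad(j=0,1),\qquad \sigma(t)=\mathrm{Var}\big(S(t)(\varphi_0^\omega,\varphi_1^\omega)\big),$$ the variance being taken pointwise in $x\in\mathbb{T}^2$, as the limit as $N\to\infty$ of the variances of the truncations to the frequencies $|n|\le N$. Let $s_0=\min(s,1)$. Then, almost surely, the problem $$\partial_t^2v+(1-\Delta)v+H_k\big(S(t)(\varphi_0^\omega,\varphi_1^\omega)+v;\sigma(t)\big)=0,\qquad (v,\partial_tv)|_{t=0}=(0,0)$$ has a unique global solution $(v,\partial_tv)\in C(\mathbb{R};\mathcal{H}^{s_0})$. Here a solution is a pair $(v,\partial_tv)\in C(\mathbb{R};\mathcal{H}^{s_0})$ such that the nonlinear term is an integrable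 function of $x\in\mathbb{T}^2$ for almost every $t$, has Fourier coefficients locally integrable in $t$, and the equation holds in the sense of distributions. The solution found moreover lies in $L^k_{\mathrm{loc}}(\mathbb{R};L^{k+1}(\mathbb{T}^2))$. Uniqueness holds among all solutions if $s\ge\frac12$ (in particular whenever $k\ge5$); in the remaining case $k=3$, $0<s<\frac12$, it holds among all solutions with $v\in L^3_{\mathrm{loc}}(\mathbb{R};L^4(\mathbb{T}^2))$, a class that contains every solution in $C(\mathbb{R};\mathcal{H}^{1/2})$. -/

import Mathlib

open MeasureTheory ProbabilityTheory Filter Topology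
open scoped ENNReal NNReal ComplexConjugate

namespace RenormNLW

noncomputable section

/-! ### The torus, frequencies and Fourier series -/

/-- The torus `𝕋² = (ℝ/ℤ)²`. -/
abbrev Torus : Type := UnitAddTorus (Fin 2)

/-- The frequency lattice `ℤ²`. -/
abbrev Freq : Type := Fin 2 → ℤ

/-- The normalized Haar measure on `𝕋²`; this is the measure with respect to which Mathlib's
`UnitAddTorus.mFourierCoeff` and `UnitAddTorus.mFourierBasis` are defined. -/
def torusMeasure : Measure Torus := Measure.pi fun _ => AddCircle.haarAddCircle

/-- `|n|² = n₁² + n₂²`. -/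
def normSq (n : Freq) : ℝ := (n 0 : ℝ) ^ 2 + (n 1 : ℝ) ^ 2

/-- The Japanese bracket `⟨n⟩ = (1 + |n|²)^{1/2}`, the symbol of `⟨∇⟩ = (1 - Δ)^{1/2}`. -/
def bracket (n : Freq) : ℝ := Real.sqrt (1 + normSq n)

/-- A distribution on `𝕋²` is represented by the family of its Fourier coefficients. -/
abbrev Dist : Type := Freq → ℂ

/-- `a` is (the family of Fourier coefficients of) a real-valued element of `H^s(𝕋²)`. -/
def MemSobolev (s : ℝ) (a : Dist) : Prop :=
  (∀ n, a (-n) = conj (a n)) ∧ Summable fun n => bracket n ^ (2 * s) * ‖a n‖ ^ 2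

/-- The norm of `H^s(𝕋²)`, `‖a‖_{H^s} = (∑ₙ ⟨n⟩^{2s} |a(n)|²)^{1/2}`. -/
def sobolevNorm (s : ℝ) (a : Dist) : ℝ :=
  Real.sqrt (∑' n, bracket n ^ (2 * s) * ‖a n‖ ^ 2)

/-- `v ∈ C(ℝ; H^s(𝕋²))`. -/
def ContinuousInSobolev (s : ℝ) (v : ℝ → Dist) : Prop :=
  (∀ t, MemSobolev s (v t)) ∧
    ∀ t₀, Tendsto (fun t => sobolevNorm s (v t - v t₀)) (𝓝 t₀) (𝓝 0)

open Classical in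
/-- The function in `L²(𝕋²)` whose Fourier coefficients are `a` (and zero if `a ∉ ℓ²`). All
distributions to which this is applied satisfy `a(-n) = conj (a(n))`, so that the `L²` sum of the
Fourier series is real almost everywhere and taking the real part changes nothing. -/
def toFun (a : Dist) : Torus → ℝ := fun x =>
  if h : Memℓp a 2 then
    ((UnitAddTorus.mFourierBasis (d := Fin 2)).repr.symm ⟨a, h⟩ x).re
  else 0

/-- The Fourier coefficients of a real-valued function on `𝕋²`. -/
def coeff (f : Torus → ℝ) : Dist :=
  UnitAddTorus.mFourierCoeff fun x => (f x : ℂ)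

/-- The finite set of frequencies `{n ∈ ℤ² : |n| ≤ N}`. -/
def freqBall (N : ℕ) : Finset Freq :=
  (Finset.Icc (fun _ => -(N : ℤ)) (fun _ => (N : ℤ))).filter
    fun n => n 0 ^ 2 + n 1 ^ 2 ≤ (N : ℤ) ^ 2

/-- The value at `x` of the frequency truncation `P_N a = ∑_{|n| ≤ N} a(n) e_n`, for `a` with
`a(-n) = conj (a(n))` (in which case this sum is real). -/
def truncEval (N : ℕ) (a : Dist) (x : Torus) : ℝ :=
  (∑ n ∈ freqBall N, a n * UnitAddTorus.mFourier n x).re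

/-! ### The linear wave propagator, the Hermite polynomials and the randomization -/

/-- `S(t)(a, b) = cos(t⟨∇⟩) a + (sin(t⟨∇⟩)/⟨∇⟩) b`. -/
def propagator (t : ℝ) (a b : Dist) : Dist := fun n =>
  (Real.cos (t * bracket n) : ℂ) * a n + (Real.sin (t * bracket n) / bracket n : ℝ) * b n

/-- The Hermite polynomials `H_k(x; σ)`, with generating function
`exp(τ x - σ τ² / 2) = ∑ₖ (τ^k / k!) H_k(x; σ)`; see `iteratedDeriv_generating`. -/
def hermiteH : ℕ → ℝ → ℝ → ℝ
  | 0, _, _ => 1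
  | 1, x, _ => x
  | k + 2, x, σ => x * hermiteH (k + 1) x σ - (k + 1) * σ * hermiteH k x σ

theorem hasDerivAt_hermiteH (σ : ℝ) (k : ℕ) (x : ℝ) :
    HasDerivAt (fun y => hermiteH (k + 1) y σ) ((k + 1) * hermiteH k x σ) x := by
  induction k using Nat.twoStepInduction generalizing x with
  | zero => simpa [hermiteH] using hasDerivAt_id' x
  | one =>
    have h := ((hasDerivAt_id x).mul (hasDerivAt_id x)).sub_const (σ)
    refine (h.congr_deriv ?_).congr_of_eventuallyEq (Eventually.of_forall fun y => ?_)
    · simp [hermiteH]; ring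
    · simp [hermiteH]
  | more k ih1 ih2 =>
    have h := ((hasDerivAt_id x).mul (ih2 x)).sub ((ih1 x).const_mul (((k + 1 : ℕ) + 1) * σ))
    refine (h.congr_deriv ?_).congr_of_eventuallyEq (Eventually.of_forall fun y => ?_)
    · simp only [hermiteH, id]; push_cast; ring
    · simp [hermiteH]

/-- `H_k(x; σ)` is `k!` times the `k`-th Taylor coefficient at `0` of the generating function
`τ ↦ exp(τ x - σ τ² / 2)`. -/
theorem iteratedDeriv_generating (x σ : ℝ) (k : ℕ) :
    iteratedDeriv k (fun τ : ℝ => Real.exp (τ * x - σ * τ ^ 2 / 2)) 0 = hermiteH k x σ := by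
  suffices h : iteratedDeriv k (fun τ : ℝ => Real.exp (τ * x - σ * τ ^ 2 / 2)) =
      fun τ => hermiteH k (x - σ * τ) σ * Real.exp (τ * x - σ * τ ^ 2 / 2) by
    rw [h]; simp
  have hlin : ∀ τ : ℝ, HasDerivAt (fun τ : ℝ => x - σ * τ) (-σ) τ := fun τ => by
    simpa using ((hasDerivAt_id τ).const_mul σ).const_sub x
  have hexp : ∀ τ : ℝ, HasDerivAt (fun τ : ℝ => Real.exp (τ * x - σ * τ ^ 2 / 2))
      (Real.exp (τ * x - σ * τ ^ 2 / 2) * (x - σ * τ)) τ := fun τ => by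
    have h := (((hasDerivAt_id τ).mul_const x).sub
      ((((hasDerivAt_id τ).pow 2).const_mul σ).div_const 2)).exp
    refine h.congr_deriv ?_
    simp
    ring
  induction k with
  | zero => simp [hermiteH]
  | succ k ih =>
    rw [iteratedDeriv_succ, ih]
    funext τ
    cases k with
    | zero => simpa [hermiteH, mul_comm] using (hexp τ).deriv
    | succ k =>
      have h := ((hasDerivAt_hermiteH σ k (x - σ * τ)).comp τ (hlin τ)).mul (hexp τ)
      refine h.deriv.trans ?_
      simp only [hermiteH, Function.comp]
      ring

/-- A half lattice: `{n : n₂ > 0} ∪ {n : n₂ = 0, n₁ ≥ 0}`. It contains `0`, and exactly one of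
`n`, `-n` for each `n ≠ 0`. -/
def halfLattice : Set Freq := {n | 0 < n 1 ∨ (n 1 = 0 ∧ 0 ≤ n 0)}

/-- `{g_{0,n}, g_{1,n}}_{n ∈ ℤ²}` is a family of independent standard complex-valued Gaussian random
variables conditioned that `g_{j,-n} = conj g_{j,n}`: the variables with `n` in a half lattice are
independent, `g_{j,n}` is standard complex Gaussian for `n ≠ 0` (independent real and imaginary
parts of variance `1/2`), and `g_{j,0}`, which is real, is standard real Gaussian. -/
structure IsGaussianFamily {Ω : Type*} [MeasurableSpace Ω] (P : Measure Ω)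
    (g : Fin 2 → Freq → Ω → ℂ) : Prop where
  measurable : ∀ j n, Measurable (g j n)
  symm : ∀ j n ω, g j (-n) ω = conj (g j n ω)
  law_zero : ∀ j, HasLaw (fun ω => (g j 0 ω).re) (gaussianReal 0 1) P
  law_re : ∀ j n, n ≠ 0 → HasLaw (fun ω => (g j n ω).re) (gaussianReal 0 (1 / 2)) P
  law_im : ∀ j n, n ≠ 0 → HasLaw (fun ω => (g j n ω).im) (gaussianReal 0 (1 / 2)) P
  indep_re_im : ∀ j n, n ≠ 0 → IndepFun (fun ω => (g j n ω).re) (fun ω => (g j n ω).im) P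
  indep : iIndepFun (fun (p : Fin 2 × halfLattice) => g p.1 p.2) P

/-- The random data `φ^ω + r`, where `φ^ω = ∑ₙ g_n(ω) φ(n) e_n` is the randomization of `φ`. -/
def randomData {Ω : Type*} (g : Freq → Ω → ℂ) (φ r : Dist) (ω : Ω) : Dist :=
  fun n => g n ω * φ n + r n

/-! ### The renormalized nonlinearity and the equation -/

/-- `σ(t) = Var(S(t)(φ₀^ω, φ₁^ω))`, the variance of the random field `S(t)(φ₀^ω, φ₁^ω)` at the
point `x`, computed as the limit of the variances of its frequency truncations. -/
def waveVariance {Ω : Type*} [MeasurableSpace Ω] (P : Measure Ω) (φ₀ φ₁ : Ω → Dist)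
    (t : ℝ) (x : Torus) : ℝ :=
  limUnder atTop fun N : ℕ => Var[fun ω => truncEval N (propagator t (φ₀ ω) (φ₁ ω)) x; P]

/-- The renormalized nonlinearity `H_k(S(t)(φ₀^ω, φ₁^ω) + v; σ(t))`, as a function on `𝕋²`. -/
def nonlinearity {Ω : Type*} [MeasurableSpace Ω] (P : Measure Ω) (k : ℕ) (φ₀ φ₁ : Ω → Dist)
    (ω : Ω) (t : ℝ) (v : Dist) : Torus → ℝ := fun x =>
  hermiteH k (toFun (propagator t (φ₀ ω) (φ₁ ω)) x + toFun v x) (waveVariance P φ₀ φ₁ t x)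

/-- `(v, w) ∈ C(ℝ; H^{s₀}(𝕋²) × H^{s₀-1}(𝕋²))` with `w = ∂ₜv` is a global solution of
`∂ₜ²v + (1 - Δ)v + F(t, v) = 0`, `(v, ∂ₜv)|_{t=0} = (0, 0)`. Here `F(t, v(t))` is an integrable
function of `x` for almost every `t` whose Fourier coefficients are locally integrable in `t`, and
the equation, tested against the exponentials `e_n`, is integrated once in time. -/
structure IsGlobalSolution (s₀ : ℝ) (F : ℝ → Dist → Torus → ℝ) (v w : ℝ → Dist) : Prop where
  continuous_fst : ContinuousInSobolev s₀ v
  continuous_snd : ContinuousInSobolev (s₀ - 1) w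
  init_fst : v 0 = 0
  init_snd : w 0 = 0
  hasDerivAt : ∀ n t, HasDerivAt (fun τ => v τ n) (w t n) t
  integrable : ∀ᵐ t, Integrable (F t (v t)) torusMeasure
  locallyIntegrable : ∀ n, LocallyIntegrable fun t => coeff (F t (v t)) n
  equation : ∀ n t,
    w t n = -∫ τ in (0 : ℝ)..t, ((bracket n : ℂ) ^ 2 * v τ n + coeff (F τ (v τ)) n)

/-- `v ∈ L^k_loc(ℝ; L^{k+1}(𝕋²))`. By the Sobolev embedding this holds for every
`v ∈ C(ℝ; H^{1/2}(𝕋²))` if `k = 3`, and for every `v ∈ C(ℝ; H¹(𝕋²))` for any `k`. -/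
def LocallyLebesgue (k : ℕ) (v : ℝ → Dist) : Prop :=
  ∀ T : ℝ, ∫⁻ t in Set.Icc (-T) T, eLpNorm (toFun (v t)) ((k : ℝ≥0∞) + 1) torusMeasure ^ k < ∞

end

end RenormNLW

namespace RenormNLW

noncomputable section

/-! ### Primitives of locally integrable functions -/

section Primitive

set_option linter.unusedSectionVars false

variable {E F G : Type*} [NormedAddCommGroup E] [NormedSpace ℝ E] [CompleteSpace E]
  [NormedAddCommGroup F] [NormedSpace ℝ F] [CompleteSpace F]
  [NormedAddCommGroup G] [NormedSpace ℝ G] [CompleteSpace G]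

/-! The variance of the random linear wave at a point is the sum over n of cos²(t⟨n⟩)|φ̂₀(n)|² +
⟨n⟩⁻² sin²(t⟨n⟩)|φ̂₁(n)|². For s ≥ 0 this converges, independently of x, and is bounded and
continuous in t (`waveVariance_eq`, `continuous_fieldVariance`). So H_k(·; σ(t)) is a polynomial
with bounded coefficients, and for a fixed realisation of the data the problem is a deterministic
wave equation with a forcing.

Write the full field as z + u, with u in the energy space H¹ × L². Undoing the free flow of u turns
the equation into an ordinary differential equation Y' = `vfield` on ℓ² × ℓ². In dimension two H¹ ⊂
L^q for every finite q (`sobolev_embedding`), so the field is Lipschitz on balls with a constant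
locally integrable in time. A Carathéodory existence theorem (`exists_global_of_apriori`) then
reduces global existence to an a priori bound, which is allowed to be a self-improvement: a solution
bounded by R on [0, t] is strictly below R at t, for all large R.

For k ≥ 5 one has s ≥ 1. The data lie almost surely in the energy space and z = 0. The energy ½‖(u,
∂ₜu)‖² + (k+1)⁻¹ ∫ H_{k+1}(u; σ) changes only through σ', because ∂_σ H_{k+1} = -½k(k+1) H_{k-1}. As
k + 1 is even, the potential dominates ∫ |H_{k-1}|, and Grönwall closes
(`exists_global_of_smooth_variance`). The derivative σ' exists because s ≥ 1.

For k = 3 the field z = S(t)(random part) may be only in L², and u starts from (r₀, r₁) in H¹ × L².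
By Gaussianity and Tonelli, ∫ e^{c|z|} dx is almost surely locally integrable in time for every c.
The energy ½‖(u, ∂ₜu)‖² + ¼∫u⁴ has derivative ⟨∂ₜu, u³ - H₃(z + u; σ)⟩, whose worst term is z u²
∂ₜu. Cut |z| at a level K. Below K the term costs a factor K in Grönwall's rate. Above K the
exponential moment beats ∫u⁸, which is at most a power of the assumed bound R. Taking K proportional
to log R makes Grönwall's exponential linear in R, whereas the energy controls the square of the
norm: hence a bound strictly below R for R large (`exists_global_of_expMoment`).

For uniqueness, the difference of two solutions is estimated in H^{1/2} ⊂ L⁴. The difference of the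
nonlinear terms is (difference) × (polynomial of degree k - 1), a product of L⁴ and L² functions,
hence in L^{4/3} ⊂ H^{-1/2}; Duhamel's formula gains one derivative, and Grönwall applies
(`eq_zero_of_duhamel`). This requires the solutions in L^{2(k-1)}. For k = 3 that is L⁴, which
H^{1/2} supplies and which is otherwise assumed; for k ≥ 5 it follows from H¹. -/

theorem intervalIntegrable_of_locallyIntegrable {f : ℝ → E} (hf : LocallyIntegrable f) (a b : ℝ) :
    IntervalIntegrable f volume a b :=
  intervalIntegrable_iff.mpr
    ((hf.integrableOn_isCompact isCompact_uIcc).mono_set Set.uIoc_subset_uIcc)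

theorem locallyIntegrable_norm {f : ℝ → E} (hf : LocallyIntegrable f) :
    LocallyIntegrable fun t => ‖f t‖ :=
  locallyIntegrable_iff.mpr fun _ hK => (hf.integrableOn_isCompact hK).norm

/-- `f` is the primitive of the locally integrable function `g`. -/
structure IsPrimitive (f g : ℝ → E) : Prop where
  locallyIntegrable : LocallyIntegrable g
  eq_integral : ∀ t, f t = f 0 + ∫ τ in (0 : ℝ)..t, g τ

theorem isPrimitive_integral {g : ℝ → E} (hg : LocallyIntegrable g) (c : E) :
    IsPrimitive (fun t => c + ∫ τ in (0 : ℝ)..t, g τ) g :=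
  ⟨hg, fun t => by simp⟩

namespace IsPrimitive

variable {f g : ℝ → E}

theorem sub_eq (h : IsPrimitive f g) (s t : ℝ) : f t - f s = ∫ τ in s..t, g τ := by
  have hi := intervalIntegrable_of_locallyIntegrable h.locallyIntegrable
  rw [h.eq_integral t, h.eq_integral s, add_sub_add_left_eq_sub,
    intervalIntegral.integral_interval_sub_left (hi _ _) (hi _ _)]

theorem continuous (h : IsPrimitive f g) : Continuous f := by
  have : f = fun t => f 0 + ∫ τ in (0 : ℝ)..t, g τ := funext h.eq_integral
  rw [this]
  exact continuous_const.add (intervalIntegral.continuous_primitive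
    (fun a b => intervalIntegrable_of_locallyIntegrable h.locallyIntegrable a b) 0)

theorem ae_hasDerivAt (h : IsPrimitive f g) : ∀ᵐ t, HasDerivAt f (g t) t := by
  filter_upwards [LocallyIntegrable.ae_hasDerivAt_integral h.locallyIntegrable] with t ht
  have : f = fun t => f 0 + ∫ τ in (0 : ℝ)..t, g τ := funext h.eq_integral
  rw [this]
  exact (ht 0).const_add _

theorem hasDerivAt (h : IsPrimitive f g) (hg : Continuous g) (t : ℝ) : HasDerivAt f (g t) t := by
  have : f = fun t => f 0 + ∫ τ in (0 : ℝ)..t, g τ := funext h.eq_integral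
  rw [this]
  exact (intervalIntegral.integral_hasDerivAt_right (hg.intervalIntegrable _ _)
    (hg.stronglyMeasurableAtFilter _ _) hg.continuousAt).const_add _

theorem norm_sub_le (h : IsPrimitive f g) (s t : ℝ) :
    ‖f t - f s‖ ≤ |∫ τ in s..t, ‖g τ‖| := by
  rw [h.sub_eq]
  exact intervalIntegral.norm_integral_le_abs_integral_norm

end IsPrimitive

/-- A function whose increments are controlled by a locally integrable density is absolutely
continuous, hence the primitive of its almost everywhere derivative. -/
theorem isPrimitive_of_ae_hasDerivAt {f g : ℝ → E} (hg : LocallyIntegrable g)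
    (hd : ∀ T : ℝ, ∃ h : ℝ → ℝ, LocallyIntegrable h ∧ ∀ s t, |s| ≤ T → |t| ≤ T →
      ‖f t - f s‖ ≤ |∫ τ in s..t, h τ|)
    (hf : ∀ᵐ t, HasDerivAt f (g t) t) : IsPrimitive f g := by
  refine ⟨hg, fun t => ?_⟩
  obtain ⟨h, hh, hle⟩ := hd |t|
  set p : ℝ → E := fun t => f t - ∫ τ in (0 : ℝ)..t, g τ with hp
  have hi := intervalIntegrable_of_locallyIntegrable hg
  have hih := intervalIntegrable_of_locallyIntegrable hh
  have hmem : ∀ {s}, s ∈ Set.uIcc 0 t → |s| ≤ |t| := by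
    intro s hs
    simpa using Set.abs_sub_left_of_mem_uIcc hs
  have hH : LocallyIntegrable fun τ => ‖h τ‖ + ‖g τ‖ := (locallyIntegrable_norm hh).add (locallyIntegrable_norm hg)
  have hac : AbsolutelyContinuousOnInterval p 0 t := by
    have hac' := (intervalIntegrable_of_locallyIntegrable hH 0
      t).absolutelyContinuousOnInterval_intervalIntegral (c := 0) Set.left_mem_uIcc
    have hiH := intervalIntegrable_of_locallyIntegrable hH
    rw [AbsolutelyContinuousOnInterval] at hac' ⊢
    -- Sums of increments of p are dominated by those of the primitive of ‖h‖ + ‖g‖, which is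
    -- absolutely continuous. A vanishing derivative almost everywhere then makes p constant.
    refine squeeze_zero' (Eventually.of_forall fun _ => Finset.sum_nonneg fun _ _ => dist_nonneg)
      ?_ hac'
    refine eventually_inf_principal.mpr (Eventually.of_forall fun I hI => ?_)
    refine Finset.sum_le_sum fun i hi' => ?_
    obtain ⟨h1, h2⟩ := hI.1 i (by simpa using hi')
    have hdiff : p (I.2 i).1 - p (I.2 i).2 =
        (f (I.2 i).1 - f (I.2 i).2) - ∫ τ in (I.2 i).2..(I.2 i).1, g τ := by
      rw [← intervalIntegral.integral_interval_sub_left (hi 0 _) (hi 0 _)]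
      simp only [hp]; abel
    rw [dist_eq_norm, hdiff, Real.dist_eq,
      intervalIntegral.integral_interval_sub_left (hiH 0 _) (hiH 0 _)]
    refine (_root_.norm_sub_le _ _).trans ?_
    refine (add_le_add (hle _ _ (hmem h2) (hmem h1))
      intervalIntegral.norm_integral_le_abs_integral_norm).trans ?_
    have e1 : |∫ τ in (I.2 i).2..(I.2 i).1, h τ| ≤ |∫ τ in (I.2 i).2..(I.2 i).1, ‖h τ‖| := by
      rw [← Real.norm_eq_abs]; exact intervalIntegral.norm_integral_le_abs_integral_norm
    refine (add_le_add e1 le_rfl).trans (le_of_eq ?_)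
    rw [intervalIntegral.integral_add (hih _ _).norm (hi _ _).norm]
    rcases le_total (I.2 i).2 (I.2 i).1 with hle' | hle'
    · rw [abs_of_nonneg, abs_of_nonneg, abs_of_nonneg] <;>
        first
        | exact add_nonneg (intervalIntegral.integral_nonneg hle' fun _ _ => norm_nonneg _)
            (intervalIntegral.integral_nonneg hle' fun _ _ => norm_nonneg _)
        | exact intervalIntegral.integral_nonneg hle' fun _ _ => norm_nonneg _
    · have n1 : ∫ τ in (I.2 i).2..(I.2 i).1, ‖h τ‖ ≤ 0 := by
        rw [intervalIntegral.integral_symm]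
        exact neg_nonpos.mpr (intervalIntegral.integral_nonneg hle' fun _ _ => norm_nonneg _)
      have n2 : ∫ τ in (I.2 i).2..(I.2 i).1, ‖g τ‖ ≤ 0 := by
        rw [intervalIntegral.integral_symm]
        exact neg_nonpos.mpr (intervalIntegral.integral_nonneg hle' fun _ _ => norm_nonneg _)
      rw [abs_of_nonpos n1, abs_of_nonpos n2, abs_of_nonpos (add_nonpos n1 n2)]
      ring
  obtain ⟨C, hC⟩ := hac.const_of_ae_hasDerivAt_zero (by
    filter_upwards [hf, LocallyIntegrable.ae_hasDerivAt_integral hg] with s hs hs' _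
    have := hs.sub (hs' 0)
    rwa [sub_self] at this)
  have h0 := hC 0 Set.left_mem_uIcc
  have h1 := hC t Set.right_mem_uIcc
  simp only [hp, intervalIntegral.integral_same, sub_zero] at h0 h1
  rw [h0, ← h1]; abel

theorem locallyIntegrable_bilin {f : ℝ → E} {g : ℝ → F} (L : E →L[ℝ] F →L[ℝ] G)
    (hf : Continuous f) (hg : LocallyIntegrable g) : LocallyIntegrable fun t => L (f t) (g t) := by
  rw [locallyIntegrable_iff] at hg ⊢
  intro K hK
  obtain ⟨C, hC⟩ := hK.exists_bound_of_continuousOn hf.continuousOn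
  refine ((hg _ hK).norm.const_mul (‖L‖ * C)).mono' ?_ ?_
  · exact L.aestronglyMeasurable_comp₂ hf.aestronglyMeasurable (hg _ hK).1
  · filter_upwards [ae_restrict_mem hK.measurableSet] with t ht
    refine (L.le_opNorm₂ _ _).trans ?_
    gcongr
    exact hC t ht

/-- The product rule for absolutely continuous functions: both factors are bounded on [-T, T], so
the increments of the product are those of a primitive of A‖g'‖ + B‖f'‖ up to ‖L‖. -/
theorem IsPrimitive.bilin {f f' : ℝ → E} {g g' : ℝ → F} (L : E →L[ℝ] F →L[ℝ] G)
    (hf : IsPrimitive f f') (hg : IsPrimitive g g') :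
    IsPrimitive (fun t => L (f t) (g t)) fun t => L (f t) (g' t) + L (f' t) (g t) := by
  refine isPrimitive_of_ae_hasDerivAt ?_ ?_ ?_
  · exact (locallyIntegrable_bilin L hf.continuous hg.locallyIntegrable).add
      (locallyIntegrable_bilin L.flip hg.continuous hf.locallyIntegrable)
  · intro T
    obtain ⟨A, hA⟩ := (isCompact_Icc (a := -T) (b := T)).exists_bound_of_continuousOn
      hf.continuous.continuousOn
    obtain ⟨B, hB⟩ := (isCompact_Icc (a := -T) (b := T)).exists_bound_of_continuousOn
      hg.continuous.continuousOn
    have hif := intervalIntegrable_of_locallyIntegrable (locallyIntegrable_norm hf.locallyIntegrable)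
    have hig := intervalIntegrable_of_locallyIntegrable (locallyIntegrable_norm hg.locallyIntegrable)
    refine ⟨fun τ => ‖L‖ * A * ‖g' τ‖ + ‖L‖ * B * ‖f' τ‖,
      ((locallyIntegrable_norm hg.locallyIntegrable).smul (‖L‖ * A)).add ((locallyIntegrable_norm hf.locallyIntegrable).smul (‖L‖ * B)),
      fun s t hs ht => ?_⟩
    have hs := abs_le.mp hs
    have ht := abs_le.mp ht
    have hA0 : 0 ≤ A := (norm_nonneg _).trans (hA s hs)
    have hB0 : 0 ≤ B := (norm_nonneg _).trans (hB s hs)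
    have e : L (f t) (g t) - L (f s) (g s) = L (f t) (g t - g s) + L (f t - f s) (g s) := by
      simp only [map_sub, _root_.sub_apply]; abel
    rw [e, intervalIntegral.integral_add ((hig s t).const_mul _) ((hif s t).const_mul _),
      intervalIntegral.integral_const_mul, intervalIntegral.integral_const_mul]
    have e1 : ‖L (f t) (g t - g s)‖ ≤ ‖L‖ * A * |∫ τ in s..t, ‖g' τ‖| :=
      (L.le_opNorm₂ _ _).trans (by gcongr; exacts [hA t ht, hg.norm_sub_le s t])
    have e2 : ‖L (f t - f s) (g s)‖ ≤ ‖L‖ * B * |∫ τ in s..t, ‖f' τ‖| := by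
      refine (L.le_opNorm₂ _ _).trans ?_
      rw [mul_right_comm]
      gcongr
      exacts [hB s hs, hf.norm_sub_le s t]
    refine (norm_add_le _ _).trans ((add_le_add e1 e2).trans (le_of_eq ?_))
    rcases le_total s t with hst | hst
    · have n1 := intervalIntegral.integral_nonneg (μ := volume) hst fun τ _ => norm_nonneg (g' τ)
      have n2 := intervalIntegral.integral_nonneg (μ := volume) hst fun τ _ => norm_nonneg (f' τ)
      rw [abs_of_nonneg n1, abs_of_nonneg n2, abs_of_nonneg (by positivity)]
    · have n1 := intervalIntegral.integral_nonneg (μ := volume) hst fun τ _ => norm_nonneg (g' τ)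
      have n2 := intervalIntegral.integral_nonneg (μ := volume) hst fun τ _ => norm_nonneg (f' τ)
      rw [intervalIntegral.integral_symm t s, intervalIntegral.integral_symm t s, abs_neg, abs_neg,
        mul_neg, mul_neg, ← neg_add, abs_neg, abs_of_nonneg n1, abs_of_nonneg n2,
        abs_of_nonneg (by positivity)]
  · filter_upwards [hf.ae_hasDerivAt, hg.ae_hasDerivAt] with t h1 h2
    exact L.hasDerivAt_of_bilinear (fun _ => h1) fun _ => h2

theorem IsPrimitive.smul {f f' : ℝ → ℝ} {g g' : ℝ → E}
    (hf : IsPrimitive f f') (hg : IsPrimitive g g') :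
    IsPrimitive (fun t => f t • g t) fun t => f t • g' t + f' t • g t :=
  hf.bilin (ContinuousLinearMap.lsmul ℝ ℝ) hg

theorem isPrimitive_of_hasDerivAt {f f' : ℝ → E} (hf : ∀ t, HasDerivAt f (f' t) t)
    (hc : Continuous f') : IsPrimitive f f' :=
  ⟨hc.locallyIntegrable, fun t => by
    rw [intervalIntegral.integral_eq_sub_of_hasDerivAt (fun x _ => hf x)
      (hc.intervalIntegrable _ _)]; abel⟩

theorem IsPrimitive.add {f f' g g' : ℝ → E} (hf : IsPrimitive f f') (hg : IsPrimitive g g') :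
    IsPrimitive (fun t => f t + g t) fun t => f' t + g' t := by
  refine ⟨hf.locallyIntegrable.add hg.locallyIntegrable, fun t => ?_⟩
  rw [intervalIntegral.integral_add (intervalIntegrable_of_locallyIntegrable hf.1 _ _)
    (intervalIntegrable_of_locallyIntegrable hg.1 _ _), hf.eq_integral t, hg.eq_integral t]
  abel

theorem IsPrimitive.clm {f f' : ℝ → E} (L : E →L[ℝ] F) (hf : IsPrimitive f f') :
    IsPrimitive (fun t => L (f t)) fun t => L (f' t) := by
  refine ⟨?_, fun t => ?_⟩
  · have := hf.locallyIntegrable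
    rw [locallyIntegrable_iff] at this ⊢
    exact fun K hK => L.integrable_comp (this _ hK)
  · rw [hf.eq_integral t, map_add, ← L.intervalIntegral_comp_comm
      (intervalIntegrable_of_locallyIntegrable hf.1 _ _)]

theorem IsPrimitive.congr {f g g' : ℝ → E} (hf : IsPrimitive f g) (h : g = g') :
    IsPrimitive f g' := h ▸ hf

/-- Chain rule: on a compact time interval Λ has bounded range, where x ↦ e^{cx} is Lipschitz. -/
theorem IsPrimitive.exp {Λ l : ℝ → ℝ} (h : IsPrimitive Λ l) (c : ℝ) :
    IsPrimitive (fun t => Real.exp (c * Λ t)) fun t => c * l t * Real.exp (c * Λ t) := by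
  have hc : Continuous fun t => Real.exp (c * Λ t) :=
    Real.continuous_exp.comp (continuous_const.mul h.continuous)
  refine isPrimitive_of_ae_hasDerivAt ?_ ?_ ?_
  · have := (locallyIntegrable_bilin (ContinuousLinearMap.lsmul ℝ ℝ) hc h.locallyIntegrable).smul c
    convert this using 2 with t
    simp; ring
  · intro T
    obtain ⟨A, hA⟩ := (isCompact_Icc (a := -T) (b := T)).exists_bound_of_continuousOn
      h.continuous.continuousOn
    have hlip : LipschitzOnWith (Real.toNNReal (|c| * Real.exp (|c| * A)))
        (fun x => Real.exp (c * x)) (Set.Icc (-A) A) := by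
      refine (convex_Icc _ _).lipschitzOnWith_of_nnnorm_hasDerivWithin_le
        (f' := fun x => c * Real.exp (c * x)) (fun x _ => ?_) fun x hx => ?_
      · exact (((hasDerivAt_id x).const_mul c).exp.congr_deriv
          (by simp [mul_comm])).hasDerivWithinAt
      · rw [← NNReal.coe_le_coe, coe_nnnorm, Real.coe_toNNReal _ (by positivity), norm_mul,
          Real.norm_eq_abs, Real.norm_eq_abs, Real.abs_exp]
        refine mul_le_mul_of_nonneg_left (Real.exp_le_exp.mpr ((le_abs_self _).trans ?_))
          (abs_nonneg _)
        rw [abs_mul]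
        exact mul_le_mul_of_nonneg_left (abs_le.mpr hx) (abs_nonneg _)
    refine ⟨fun τ => |c| * Real.exp (|c| * A) * ‖l τ‖, (locallyIntegrable_norm h.locallyIntegrable).smul (|c| * Real.exp (|c| * A)),
      fun s t hs ht => ?_⟩
    have := hlip.norm_sub_le (abs_le.mp (hA t (abs_le.mp ht))) (abs_le.mp (hA s (abs_le.mp hs)))
    rw [Real.coe_toNNReal _ (by positivity)] at this
    refine this.trans ?_
    rw [intervalIntegral.integral_const_mul, abs_mul,
      abs_of_nonneg (a := |c| * Real.exp (|c| * A)) (by positivity)]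
    gcongr
    exact h.norm_sub_le s t
  · filter_upwards [h.ae_hasDerivAt] with t ht
    exact ((ht.const_mul c).exp).congr_deriv (by ring)

/-- Grönwall's inequality with an integrable kernel, forward in time. -/
theorem gronwall_forward {f l : ℝ → ℝ} {a T : ℝ} (hf : Continuous f) (hl : LocallyIntegrable l)
    (hl0 : ∀ᵐ t, 0 ≤ l t) (hT : 0 ≤ T)
    (h : ∀ t ∈ Set.Icc 0 T, f t ≤ a + ∫ τ in (0 : ℝ)..t, l τ * f τ) :
    f T ≤ a * Real.exp (∫ τ in (0 : ℝ)..T, l τ) := by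
  have hΛ := (isPrimitive_integral hl 0)
  have hlf : LocallyIntegrable fun t => l t * f t := by
    have := locallyIntegrable_bilin (ContinuousLinearMap.lsmul ℝ ℝ) hf hl
    convert this using 2 with t
    simp [mul_comm]
  have hΦ := isPrimitive_integral hlf 0
  simp only [zero_add] at hΦ hΛ
  set Λ := fun t => ∫ τ in (0 : ℝ)..t, l τ with hΛd
  set Φ := fun t => ∫ τ in (0 : ℝ)..t, l τ * f τ with hΦd
  -- Integrating factor: (e^{-Λ}Φ)' = l e^{-Λ}(f - Φ) ≤ a l e^{-Λ} = -a (e^{-Λ})'.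
  have he := hΛ.exp (-1)
  have hp := he.smul hΦ
  have e := hp.eq_integral T
  have e2 := he.eq_integral T
  have hΛ0 : Λ 0 = 0 := by simp [hΛd]
  have hΦ0 : Φ 0 = 0 := by simp [hΦd]
  simp only [smul_eq_mul, hΛ0, hΦ0, mul_zero, zero_add, Real.exp_zero] at e e2
  have hle : Real.exp (-1 * Λ T) * Φ T ≤ a * (1 - Real.exp (-1 * Λ T)) := by
    rw [e]
    have : a * (1 - Real.exp (-1 * Λ T)) =
        ∫ τ in (0 : ℝ)..T, (-a) * (-1 * l τ * Real.exp (-1 * Λ τ)) := by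
      rw [intervalIntegral.integral_const_mul]; linear_combination (-a) * e2
    rw [this]
    refine intervalIntegral.integral_mono_ae_restrict hT
      (intervalIntegrable_of_locallyIntegrable hp.locallyIntegrable _ _)
      ((intervalIntegrable_of_locallyIntegrable he.locallyIntegrable _ _).const_mul _) ?_
    filter_upwards [ae_restrict_mem measurableSet_Icc, ae_restrict_of_ae hl0] with t ht ht0
    have := mul_le_mul_of_nonneg_left (h t ht) (mul_nonneg ht0 (Real.exp_pos (-1 * Λ t)).le)
    change Real.exp (-1 * Λ t) * (l t * f t) + -1 * l t * Real.exp (-1 * Λ t) * Φ t ≤ _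
    change _ ≤ (l t * Real.exp (-1 * Λ t)) * (a + Φ t) at this
    linarith
  have h1 := h T (Set.right_mem_Icc.mpr hT)
  have h2 : Φ T ≤ a * (Real.exp (Λ T) - 1) := by
    have := mul_le_mul_of_nonneg_left hle (Real.exp_pos (Λ T)).le
    have hee : Real.exp (Λ T) * Real.exp (-1 * Λ T) = 1 := by rw [← Real.exp_add]; simp
    calc Φ T = Real.exp (Λ T) * Real.exp (-1 * Λ T) * Φ T := by rw [hee, one_mul]
      _ = Real.exp (Λ T) * (Real.exp (-1 * Λ T) * Φ T) := by ring
      _ ≤ _ := this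
      _ = a * (Real.exp (Λ T) - Real.exp (Λ T) * Real.exp (-1 * Λ T)) := by ring
      _ = _ := by rw [hee]
  calc f T ≤ a + Φ T := h1
    _ ≤ a * Real.exp (Λ T) := by linarith

theorem locallyIntegrable_comp_neg {f : ℝ → E} (hf : LocallyIntegrable f) :
    LocallyIntegrable fun t => f (-t) := by
  rw [locallyIntegrable_iff] at hf ⊢
  intro K hK
  have h := hf _ (hK.image continuous_neg)
  have := (Measure.measurePreserving_neg (volume : Measure ℝ)).integrableOn_comp_preimage
    (MeasurableEquiv.neg ℝ).measurableEmbedding (f := f) (s := (fun x => -x) '' K)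
  have hpre : Neg.neg ⁻¹' ((fun x : ℝ => -x) '' K) = K := by
    ext x; simp
  rw [hpre] at this
  exact this.mpr h

/-- Grönwall's inequality with an integrable kernel, in both directions of time. -/
theorem gronwall {f l : ℝ → ℝ} {a T : ℝ} (hf : Continuous f) (hf0 : ∀ t, 0 ≤ f t)
    (hl : LocallyIntegrable l) (hl0 : ∀ᵐ t, 0 ≤ l t)
    (h : ∀ t ∈ Set.uIcc 0 T, f t ≤ a + |∫ τ in (0 : ℝ)..t, l τ * f τ|) :
    f T ≤ a * Real.exp |∫ τ in (0 : ℝ)..T, l τ| := by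
  rcases le_total 0 T with hT | hT
  · rw [abs_of_nonneg (intervalIntegral.integral_nonneg_of_ae hT hl0)]
    refine gronwall_forward hf hl hl0 hT fun t ht => ?_
    have := h t (by rwa [Set.uIcc_of_le hT])
    rwa [abs_of_nonneg (intervalIntegral.integral_nonneg_of_ae ht.1
      (hl0.mono fun τ hτ => mul_nonneg hτ (hf0 τ)))] at this
  -- Negative times are reduced to positive ones by the reflection t ↦ -t.
  · have key : ∀ p : ℝ → ℝ, ∀ t, ∫ τ in (0 : ℝ)..t, p τ = -∫ τ in (0 : ℝ)..(-t), p (-τ) := by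
      intro p t
      rw [intervalIntegral.integral_comp_neg, neg_zero, neg_neg, intervalIntegral.integral_symm]
    have hl0' : ∀ᵐ t, 0 ≤ l (-t) :=
      (Measure.measurePreserving_neg (volume : Measure ℝ)).quasiMeasurePreserving.ae hl0
    have := gronwall_forward (f := fun t => f (-t)) (l := fun t => l (-t)) (a := a) (T := -T)
      (hf.comp continuous_neg) (locallyIntegrable_comp_neg hl) hl0' (by linarith) fun t ht => by
        have := h (-t) (by rw [Set.uIcc_of_ge hT]; constructor <;> linarith [ht.1, ht.2])
        rw [key, neg_neg, abs_neg] at this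
        rwa [abs_of_nonneg (intervalIntegral.integral_nonneg_of_ae ht.1
          (hl0'.mono fun τ hτ => mul_nonneg hτ (hf0 _)))] at this
    rw [key l T, abs_neg,
      abs_of_nonneg (intervalIntegral.integral_nonneg_of_ae (by linarith) hl0')]
    simpa using this

end Primitive

end

end RenormNLW

namespace RenormNLW

noncomputable section

/-! ### Carathéodory differential equations -/

section ODE

/-- With m = e^{2|Λ|}, the function l·m is, up to sign, half the derivative of m on either side of
0. The factor ½ gained here is the contraction constant of the fixed-point argument. -/
theorem abs_integral_mul_exp_le {l : ℝ → ℝ} (hl : LocallyIntegrable l) (hl0 : ∀ᵐ t, 0 ≤ l t)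
    (t : ℝ) :
    |∫ τ in (0 : ℝ)..t, l τ * Real.exp (2 * |∫ r in (0 : ℝ)..τ, l r|)| ≤
      2⁻¹ * Real.exp (2 * |∫ r in (0 : ℝ)..t, l r|) := by
  have hΛ := isPrimitive_integral hl 0
  simp only [zero_add] at hΛ
  have hpos : ∀ x : ℝ, 0 < Real.exp x := Real.exp_pos
  rcases le_total 0 t with ht | ht
  · have e := (hΛ.exp 2).eq_integral t
    simp only [intervalIntegral.integral_same, mul_zero, Real.exp_zero] at e
    have h1 : ∫ τ in (0 : ℝ)..t, l τ * Real.exp (2 * |∫ r in (0 : ℝ)..τ, l r|) =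
        2⁻¹ * ∫ τ in (0 : ℝ)..t, 2 * l τ * Real.exp (2 * ∫ r in (0 : ℝ)..τ, l r) := by
      rw [← intervalIntegral.integral_const_mul]
      refine intervalIntegral.integral_congr fun τ hτ => ?_
      rw [Set.uIcc_of_le ht] at hτ
      have : 0 ≤ ∫ r in (0 : ℝ)..τ, l r := intervalIntegral.integral_nonneg_of_ae hτ.1 hl0
      simp only [abs_of_nonneg this]; ring
    have h2 : 0 ≤ ∫ r in (0 : ℝ)..t, l r := intervalIntegral.integral_nonneg_of_ae ht hl0
    rw [h1, abs_of_nonneg h2, abs_of_nonneg]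
    · nlinarith
    · refine mul_nonneg (by norm_num) (intervalIntegral.integral_nonneg_of_ae ht ?_)
      filter_upwards [hl0] with τ hτ
      have := hpos (2 * ∫ r in (0 : ℝ)..τ, l r)
      simp only [Pi.zero_apply]
      positivity
  · have e := (hΛ.exp (-2)).eq_integral t
    simp only [intervalIntegral.integral_same, mul_zero, Real.exp_zero] at e
    have hneg : ∀ τ ≤ 0, ∫ r in (0 : ℝ)..τ, l r ≤ 0 := fun τ hτ => by
      rw [intervalIntegral.integral_symm]
      exact neg_nonpos.mpr (intervalIntegral.integral_nonneg_of_ae hτ hl0)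
    have h1 : ∫ τ in (0 : ℝ)..t, l τ * Real.exp (2 * |∫ r in (0 : ℝ)..τ, l r|) =
        -2⁻¹ * ∫ τ in (0 : ℝ)..t, -2 * l τ * Real.exp (-2 * ∫ r in (0 : ℝ)..τ, l r) := by
      rw [← intervalIntegral.integral_const_mul]
      refine intervalIntegral.integral_congr fun τ hτ => ?_
      rw [Set.uIcc_of_ge ht] at hτ
      simp only [abs_of_nonpos (hneg τ hτ.2)]; ring_nf
    have hle : 1 ≤ Real.exp (-2 * ∫ r in (0 : ℝ)..t, l r) :=
      Real.one_le_exp (by linarith [hneg t ht])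
    rw [h1, abs_of_nonpos (hneg t ht), abs_of_nonpos]
    · rw [mul_neg, ← neg_mul 2]
      linarith
    · linarith

variable {X : Type*} [NormedAddCommGroup X] [NormedSpace ℝ X] [CompleteSpace X]

theorem locallyIntegrable_field {G : ℝ → X → X} {l : ℝ → ℝ} (hl : LocallyIntegrable l)
    (hmeas : ∀ Y : ℝ → X, StronglyMeasurable Y → AEStronglyMeasurable (fun t => G t (Y t)))
    (hlip : ∀ᵐ t, ∀ y y', ‖G t y - G t y'‖ ≤ l t * ‖y - y'‖) (h0 : ∀ᵐ t, ‖G t 0‖ ≤ l t)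
    {Y : ℝ → X} (hY : Continuous Y) : LocallyIntegrable fun t => G t (Y t) := by
  have h1 := locallyIntegrable_bilin (ContinuousLinearMap.lsmul ℝ ℝ)
    (continuous_const.add hY.norm : Continuous fun t => 1 + ‖Y t‖) hl
  refine h1.mono (hmeas Y hY.stronglyMeasurable) ?_
  filter_upwards [hlip, h0] with t h2 h3
  have h4 := h2 (Y t) 0
  rw [sub_zero] at h4
  have h5 : ‖G t (Y t)‖ ≤ l t * (1 + ‖Y t‖) := by
    calc ‖G t (Y t)‖ = ‖(G t (Y t) - G t 0) + G t 0‖ := by rw [sub_add_cancel]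
      _ ≤ l t * ‖Y t‖ + l t := (norm_add_le _ _).trans (add_le_add h4 h3)
      _ = _ := by ring
  refine h5.trans ((le_abs_self _).trans (le_of_eq ?_))
  rw [Real.norm_eq_abs, mul_comm]
  rfl

-- Picard iteration in Bielecki's weighted norm: with Y = m·b, m = e^{2|∫l|} and b bounded
-- continuous, the integral operator is a ½-contraction on the whole line at once, so no gluing of
-- local solutions is needed.
open BoundedContinuousFunction in
theorem exists_global_of_lipschitz {G : ℝ → X → X} {l : ℝ → ℝ} (hl : LocallyIntegrable l)
    (hmeas : ∀ Y : ℝ → X, StronglyMeasurable Y → AEStronglyMeasurable (fun t => G t (Y t)))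
    (hlip : ∀ᵐ t, ∀ y y', ‖G t y - G t y'‖ ≤ l t * ‖y - y'‖) (h0 : ∀ᵐ t, ‖G t 0‖ ≤ l t)
    (Y₀ : X) : ∃ Y : ℝ → X, Continuous Y ∧ ∀ t, Y t = Y₀ + ∫ τ in (0 : ℝ)..t, G τ (Y τ) := by
  have hl0 : ∀ᵐ t, 0 ≤ l t := h0.mono fun t ht => (norm_nonneg _).trans ht
  have hΛ := (isPrimitive_integral hl 0).continuous
  simp only [zero_add] at hΛ
  set m : ℝ → ℝ := fun t => Real.exp (2 * |∫ r in (0 : ℝ)..t, l r|) with hm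
  have hmc : Continuous m := Real.continuous_exp.comp (continuous_const.mul hΛ.abs)
  have hm0 : ∀ t, 0 < m t := fun t => Real.exp_pos _
  have hm1 : ∀ t, 1 ≤ m t := fun t => Real.one_le_exp (by positivity)
  have hlm : LocallyIntegrable fun t => l t * m t := by
    have := locallyIntegrable_bilin (ContinuousLinearMap.lsmul ℝ ℝ) hmc hl
    convert this using 2 with t
    simp [mul_comm]
  have hkey : ∀ t, |∫ τ in (0 : ℝ)..t, l τ * m τ| ≤ 2⁻¹ * m t := abs_integral_mul_exp_le hl hl0
  have hcont : ∀ b : ℝ →ᵇ X, Continuous fun t => m t • b t := fun b => hmc.smul b.continuous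
  have hG : ∀ b : ℝ →ᵇ X, LocallyIntegrable fun t => G t (m t • b t) := fun b =>
    locallyIntegrable_field hl hmeas hlip h0 (hcont b)
  have hbound : ∀ (p : ℝ → X) (C : ℝ), 0 ≤ C → (∀ᵐ t, ‖p t‖ ≤ C * (l t * m t)) → ∀ t,
      ‖∫ τ in (0 : ℝ)..t, p τ‖ ≤ C * (2⁻¹ * m t) := by
    intro p C hC hp t
    have h1 := intervalIntegral.norm_integral_le_abs_of_norm_le (a := 0) (b := t)
      (ae_restrict_of_ae hp)
      ((intervalIntegrable_of_locallyIntegrable hlm _ _).const_mul C)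
    rw [intervalIntegral.integral_const_mul, abs_mul, abs_of_nonneg hC] at h1
    exact h1.trans (mul_le_mul_of_nonneg_left (hkey t) hC)
  let Φ : (ℝ →ᵇ X) → (ℝ →ᵇ X) := fun b =>
    BoundedContinuousFunction.ofNormedAddCommGroup
      (fun t => (m t)⁻¹ • (Y₀ + ∫ τ in (0 : ℝ)..t, G τ (m τ • b τ)))
      ((hmc.inv₀ fun t => (hm0 t).ne').smul (isPrimitive_integral (hG b) Y₀).continuous)
      (‖Y₀‖ + (1 + ‖b‖) * 2⁻¹) (by
        intro t
        rw [norm_smul, norm_inv, Real.norm_of_nonneg (hm0 t).le, inv_mul_le_iff₀ (hm0 t)]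
        have h1 := hbound (fun τ => G τ (m τ • b τ)) (1 + ‖b‖) (by positivity) (by
          filter_upwards [hlip, h0, hl0] with τ h2 h3 h4
          have h5 := h2 (m τ • b τ) 0
          rw [sub_zero, norm_smul, Real.norm_of_nonneg (hm0 τ).le] at h5
          calc ‖G τ (m τ • b τ)‖ = ‖(G τ (m τ • b τ) - G τ 0) + G τ 0‖ := by rw [sub_add_cancel]
            _ ≤ l τ * (m τ * ‖b τ‖) + l τ := (norm_add_le _ _).trans (add_le_add h5 h3)
            _ ≤ l τ * (m τ * ‖b‖) + l τ * m τ := by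
                gcongr
                · exact b.norm_coe_le_norm τ
                · exact le_mul_of_one_le_right h4 (hm1 τ)
            _ = _ := by ring) t
        refine (norm_add_le _ _).trans ((add_le_add_right h1 _).trans ?_)
        have := mul_le_mul_of_nonneg_right (hm1 t) (norm_nonneg Y₀)
        nlinarith)
  have hΦ : ContractingWith 2⁻¹ Φ := by
    refine ⟨by rw [← NNReal.coe_lt_coe]; norm_num, LipschitzWith.of_dist_le_mul fun b b' => ?_⟩
    rw [BoundedContinuousFunction.dist_le (by positivity)]
    intro t
    have e : Φ b t - Φ b' t =
        (m t)⁻¹ • ∫ τ in (0 : ℝ)..t, (G τ (m τ • b τ) - G τ (m τ • b' τ)) := by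
      rw [intervalIntegral.integral_sub (intervalIntegrable_of_locallyIntegrable (hG b) _ _)
        (intervalIntegrable_of_locallyIntegrable (hG b') _ _)]
      change (m t)⁻¹ • (Y₀ + _) - (m t)⁻¹ • (Y₀ + _) = _
      rw [← smul_sub, add_sub_add_left_eq_sub]
    rw [dist_eq_norm, e, norm_smul, norm_inv, Real.norm_of_nonneg (hm0 t).le,
      inv_mul_le_iff₀ (hm0 t)]
    refine (hbound _ (dist b b') dist_nonneg ?_ t).trans (le_of_eq ?_)
    · filter_upwards [hlip, hl0] with τ h2 h4
      refine (h2 _ _).trans ?_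
      rw [← smul_sub, norm_smul, Real.norm_of_nonneg (hm0 τ).le, ← dist_eq_norm]
      have := mul_le_mul_of_nonneg_left (BoundedContinuousFunction.dist_coe_le_dist (f := b)
        (g := b') τ) (mul_nonneg h4 (hm0 τ).le)
      linarith
    · simp; ring
  set b := ContractingWith.fixedPoint Φ hΦ with hb
  have hfix : Φ b = b := ContractingWith.fixedPoint_isFixedPt hΦ
  refine ⟨fun t => m t • b t, hcont b, fun t => ?_⟩
  have h1 : b t = (m t)⁻¹ • (Y₀ + ∫ τ in (0 : ℝ)..t, G τ (m τ • b τ)) := by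
    conv_lhs => rw [← hfix]
    rfl
  beta_reduce
  conv_lhs => rw [h1]
  rw [smul_smul, mul_inv_cancel₀ (hm0 t).ne', one_smul]

/-- The radial retraction onto the closed ball of radius `R`. -/
def radial (R : ℝ) (y : X) : X := min 1 (R / ‖y‖) • y

omit [CompleteSpace X] in
theorem radial_of_norm_le {R : ℝ} {y : X} (h : ‖y‖ ≤ R) : radial R y = y := by
  rcases eq_or_ne y 0 with rfl | hy
  · simp [radial]
  · have : 1 ≤ R / ‖y‖ := (one_le_div (norm_pos_iff.mpr hy)).mpr h
    rw [radial, min_eq_left this, one_smul]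

omit [CompleteSpace X] in
theorem norm_radial_le {R : ℝ} (hR : 0 ≤ R) (y : X) : ‖radial R y‖ ≤ R := by
  rcases eq_or_ne y 0 with rfl | hy
  · simpa [radial] using hR
  · have hy' := norm_pos_iff.mpr hy
    rw [radial, norm_smul, Real.norm_of_nonneg (by positivity)]
    calc min 1 (R / ‖y‖) * ‖y‖ ≤ R / ‖y‖ * ‖y‖ := by gcongr; exact min_le_right _ _
      _ = R := by field_simp

-- In a normed space without inner product the radial retraction is only 2-Lipschitz. With c ≤ c'
-- the two scaling factors, the difference is c(y - y') + (c - c')y', and each term is at most ‖y -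
-- y'‖.
omit [CompleteSpace X] in
theorem norm_radial_sub_le {R : ℝ} (hR : 0 ≤ R) (y y' : X) :
    ‖radial R y - radial R y'‖ ≤ 2 * ‖y - y'‖ := by
  wlog h : ‖y'‖ ≤ ‖y‖ generalizing y y'
  · rw [norm_sub_rev, norm_sub_rev y]
    exact this y' y (le_of_not_ge h)
  have hyy : ‖y‖ - ‖y'‖ ≤ ‖y - y'‖ := norm_sub_norm_le _ _
  rcases le_or_gt ‖y‖ R with h1 | h1
  · rw [radial_of_norm_le h1, radial_of_norm_le (h.trans h1)]
    linarith [norm_nonneg (y - y')]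
  have hy : 0 < ‖y‖ := hR.trans_lt h1
  have e1 : min 1 (R / ‖y‖) = R / ‖y‖ := min_eq_right ((div_le_one hy).mpr h1.le)
  have hc : R / ‖y‖ ≤ 1 := (div_le_one hy).mpr h1.le
  set c' := min 1 (R / ‖y'‖) with hc'
  have e2 : radial R y - radial R y' = (R / ‖y‖) • (y - y') + (R / ‖y‖ - c') • y' := by
    rw [radial, radial, e1, ← hc', smul_sub, sub_smul]; abel
  rw [e2]
  have h2 : |R / ‖y‖ - c'| * ‖y'‖ ≤ ‖y - y'‖ := by
    rcases eq_or_ne y' 0 with rfl | hy'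
    · simp
    have hy' := norm_pos_iff.mpr hy'
    have h3 : R / ‖y‖ ≤ c' := le_min hc (by gcongr)
    rw [abs_of_nonpos (by linarith)]
    rcases le_or_gt ‖y'‖ R with h4 | h4
    · have : c' = 1 := min_eq_left ((one_le_div hy').mpr h4)
      rw [this]
      have h5 : ‖y‖ * (1 - R / ‖y‖) = ‖y‖ - R := by field_simp
      have h6 : ‖y'‖ * (1 - R / ‖y‖) ≤ R * (1 - R / ‖y‖) := by
        apply mul_le_mul_of_nonneg_right h4; linarith
      have h7 : R * (1 - R / ‖y‖) ≤ ‖y‖ * (1 - R / ‖y‖) := by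
        apply mul_le_mul_of_nonneg_right h1.le; linarith
      have h8 : ‖y'‖ * (1 - R / ‖y‖) ≤ ‖y‖ * (1 - R / ‖y‖) :=
        mul_le_mul_of_nonneg_right h (by linarith)
      have h9 : ‖y'‖ - ‖y'‖ * (R / ‖y‖) ≤ ‖y‖ - ‖y'‖ := by
        have : ‖y'‖ * (R / ‖y‖) ≥ ‖y'‖ * (‖y'‖ / ‖y‖) := by gcongr
        have h10 : ‖y'‖ * (‖y'‖ / ‖y‖) ≥ 2 * ‖y'‖ - ‖y‖ := by
          rw [ge_iff_le, ← sub_nonneg]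
          have : ‖y'‖ * (‖y'‖ / ‖y‖) - (2 * ‖y'‖ - ‖y‖) = (‖y‖ - ‖y'‖) ^ 2 / ‖y‖ := by
            field_simp; ring
          rw [this]; positivity
        linarith
      nlinarith
    · have : c' = R / ‖y'‖ := min_eq_right ((div_le_one hy').mpr h4.le)
      rw [this]
      have h5 : -(R / ‖y‖ - R / ‖y'‖) * ‖y'‖ = R / ‖y‖ * (‖y‖ - ‖y'‖) := by field_simp; ring
      rw [h5]
      exact (mul_le_of_le_one_left (by linarith) hc).trans hyy
  calc _ ≤ ‖(R / ‖y‖) • (y - y')‖ + ‖(R / ‖y‖ - c') • y'‖ := norm_add_le _ _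
    _ ≤ 1 * ‖y - y'‖ + ‖y - y'‖ := by
        rw [norm_smul, norm_smul, Real.norm_of_nonneg (by positivity), Real.norm_eq_abs]
        gcongr
    _ = _ := by ring

omit [CompleteSpace X] in
theorem StronglyMeasurable.radial {R : ℝ → ℝ} (hR : Measurable R) {Y : ℝ → X}
    (hY : StronglyMeasurable Y) : StronglyMeasurable fun t => radial (R t) (Y t) :=
  ((measurable_const.min (hR.div hY.norm.measurable)).stronglyMeasurable).smul hY

/-- Global existence for a Carathéodory equation whose right-hand side is Lipschitz on balls, under
an a priori bound. -/
theorem exists_global_of_apriori {G : ℝ → X → X} {m : ℝ → ℝ} {C : ℝ → ℝ}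
    (hm : LocallyIntegrable m) (hm0 : ∀ᵐ t, 0 ≤ m t)
    (hmeas : ∀ Y : ℝ → X, StronglyMeasurable Y → AEStronglyMeasurable (fun t => G t (Y t)))
    (hC : ∀ R, 0 ≤ C R)
    (hlip : ∀ᵐ t, ∀ R, 0 ≤ R → ∀ y y', ‖y‖ ≤ R → ‖y'‖ ≤ R →
      ‖G t y - G t y'‖ ≤ C R * m t * ‖y - y'‖)
    (h0 : ∀ᵐ t, ‖G t 0‖ ≤ C 0 * m t) (Y₀ : X)
    (hap : ∀ T : ℕ, ∃ R₀ : ℝ, ∀ R ≥ R₀, ∀ (Y : ℝ → X) (t : ℝ), Continuous Y → |t| ≤ T →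
      (∀ r ∈ Set.uIcc 0 t, ‖Y r‖ ≤ R) →
      (∀ r ∈ Set.uIcc 0 t, Y r = Y₀ + ∫ τ in (0 : ℝ)..r, G τ (Y τ)) → ‖Y t‖ < R) :
    ∃ Y : ℝ → X, Continuous Y ∧ ∀ t, Y t = Y₀ + ∫ τ in (0 : ℝ)..t, G τ (Y τ) := by
  choose R₀ hR₀ using hap
  -- Partial sums make the radii nondecreasing while still at least R₀ j; the first-exit argument
  -- needs both.
  set ρ : ℕ → ℝ := fun j => ∑ i ∈ Finset.range (j + 1), |R₀ i| with hρ
  have hρmono : Monotone ρ := monotone_nat_of_le_succ fun j => by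
    simp only [hρ]
    rw [Finset.sum_range_succ _ (j + 1)]
    linarith [abs_nonneg (R₀ (j + 1))]
  have hρR : ∀ j, R₀ j ≤ ρ j := fun j => (le_abs_self _).trans
    (Finset.single_le_sum (f := fun i => |R₀ i|) (fun i _ => abs_nonneg _) (by simp))
  have hρ0 : ∀ j, 0 ≤ ρ j := fun j => Finset.sum_nonneg fun i _ => abs_nonneg _
  -- The truncation radius depends on time, so that one globally Lipschitz equation covers all of ℝ
  -- although the a priori bound depends on the time horizon.
  set R : ℝ → ℝ := fun t => ρ ⌈|t|⌉₊ with hR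
  have hceil : Measurable fun t : ℝ => ⌈|t|⌉₊ := Nat.measurable_ceil.comp measurable_abs
  have hRm : Measurable R := (measurable_from_nat (f := ρ)).comp hceil
  -- 2·C(ρ j) comes from the 2-Lipschitz retraction, C 0 from the size of the field at 0.
  set K : ℕ → ℝ := fun j => 2 * C (ρ j) + C 0 with hK
  have hK0 : ∀ j, 0 ≤ K j := fun j => by
    have := hC (ρ j); have := hC 0; simp only [hK]; positivity
  set l : ℝ → ℝ := fun t => K ⌈|t|⌉₊ * m t with hl
  have hlint : LocallyIntegrable l := by
    rw [locallyIntegrable_iff]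
    intro S hS
    obtain ⟨T, hT⟩ := hS.isBounded.exists_norm_le
    refine ((hm.integrableOn_isCompact hS).norm.const_mul
      (∑ j ∈ Finset.range (⌈T⌉₊ + 1), K j)).mono' ?_ ?_
    · exact (((measurable_from_nat (f := K)).comp hceil).aestronglyMeasurable).mul
        (hm.integrableOn_isCompact hS).1
    · filter_upwards [ae_restrict_mem hS.measurableSet] with t ht
      rw [hl, norm_mul, Real.norm_of_nonneg (hK0 _)]
      gcongr
      refine Finset.single_le_sum (f := K) (fun i _ => hK0 i) ?_
      rw [Finset.mem_range]
      exact Nat.lt_succ_of_le (Nat.ceil_le_ceil (hT t ht))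
  obtain ⟨Y, hYc, hY⟩ := exists_global_of_lipschitz (G := fun t y => G t (radial (R t) y)) hlint
    (fun Y hY => hmeas _ (StronglyMeasurable.radial hRm hY)) (by
      filter_upwards [hlip, hm0] with t ht hmt y y'
      refine (ht (R t) (hρ0 _) _ _ (norm_radial_le (hρ0 _) y) (norm_radial_le (hρ0 _) y')).trans ?_
      have h1 := norm_radial_sub_le (hρ0 ⌈|t|⌉₊) y y'
      have h2 : 0 ≤ C (R t) * m t := mul_nonneg (hC _) hmt
      have h3 := mul_le_mul_of_nonneg_left h1 h2
      have h4 : 0 ≤ C 0 * m t * ‖y - y'‖ :=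
        mul_nonneg (mul_nonneg (hC _) hmt) (norm_nonneg _)
      calc _ ≤ C (R t) * m t * (2 * ‖y - y'‖) := h3
        _ ≤ C (R t) * m t * (2 * ‖y - y'‖) + C 0 * m t * ‖y - y'‖ := by linarith
        _ = _ := by simp only [hl, hK, hR]; ring) (by
      filter_upwards [h0, hm0] with t ht hmt
      have : radial (R t) (0 : X) = 0 := by simp [radial]
      simp only [this]
      refine ht.trans ?_
      have := mul_nonneg (hC (ρ ⌈|t|⌉₊)) hmt
      simp only [hl, hK]; nlinarith) Y₀
  have hlt : ∀ t, ‖Y t‖ < R t := by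
    intro t
    by_contra! hcon
    have hsgn : ∃ ε : ℝ, |ε| = 1 ∧ t = ε * |t| := by
      rcases le_total 0 t with h | h
      · exact ⟨1, by simp, by simp [abs_of_nonneg h]⟩
      · exact ⟨-1, by simp, by simp [abs_of_nonpos h]⟩
    obtain ⟨ε, hε, hεt⟩ := hsgn
    -- First exit time r₀ in the direction ε. Before r₀ the truncation is inactive, at r₀ the norm
    -- has reached ρ ⌈r₀⌉₊ by closedness, and the a priori bound with R = ρ ⌈r₀⌉₊ forbids this.
    set S : Set ℝ := {r | 0 ≤ r ∧ ρ ⌈r⌉₊ ≤ ‖Y (ε * r)‖} with hS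
    have hne : S.Nonempty := ⟨|t|, abs_nonneg t, by rw [← hεt]; exact hcon⟩
    have hbdd : BddBelow S := ⟨0, fun r hr => hr.1⟩
    set r₀ := sInf S with hr₀
    have hr₀0 : 0 ≤ r₀ := le_csInf hne fun r hr => hr.1
    have hlow : ∀ r, 0 ≤ r → r < r₀ → ‖Y (ε * r)‖ < ρ ⌈r⌉₊ := by
      intro r h1 h2
      by_contra! h3
      exact absurd (csInf_le hbdd (show r ∈ S from ⟨h1, h3⟩)) (not_le.mpr h2)
    have hYε : Continuous fun r => ‖Y (ε * r)‖ := (hYc.comp (continuous_const.mul continuous_id)).norm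
    have hmem : ρ ⌈r₀⌉₊ ≤ ‖Y (ε * r₀)‖ := by
      have hcl : r₀ ∈ closure {r | ρ ⌈r₀⌉₊ ≤ ‖Y (ε * r)‖} := by
        refine closure_mono ?_ (csInf_mem_closure hne hbdd)
        intro r hr
        exact (hρmono (Nat.ceil_le_ceil (csInf_le hbdd hr))).trans hr.2
      rwa [(isClosed_le continuous_const hYε).closure_eq] at hcl
    have hle : ∀ r, 0 ≤ r → r < r₀ → ‖Y (ε * r)‖ ≤ ρ ⌈r₀⌉₊ := fun r h1 h2 =>
      (hlow r h1 h2).le.trans (hρmono (Nat.ceil_le_ceil h2.le))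
    have hparam : ∀ r ∈ Set.uIcc 0 (ε * r₀), ∃ q, 0 ≤ q ∧ q ≤ r₀ ∧ r = ε * q ∧ |r| = q := by
      intro r hr
      have hεε : ε * ε = 1 := by rw [← abs_mul_abs_self, hε]; norm_num
      rcases le_or_gt 0 ε with h | h
      · rw [abs_of_nonneg h] at hε
        subst hε
        rw [one_mul, Set.uIcc_of_le hr₀0] at hr
        exact ⟨r, hr.1, hr.2, by simp, abs_of_nonneg hr.1⟩
      · have : ε = -1 := by rw [abs_of_neg h] at hε; linarith
        subst this
        rw [Set.uIcc_of_ge (by linarith)] at hr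
        exact ⟨-r, by linarith [hr.2], by linarith [hr.1], by ring, abs_of_nonpos hr.2⟩
    have habs : |ε * r₀| = r₀ := by rw [abs_mul, hε, one_mul, abs_of_nonneg hr₀0]
    have hball : ∀ r ∈ Set.uIcc 0 (ε * r₀), r ≠ ε * r₀ → ‖Y r‖ ≤ ρ ⌈r₀⌉₊ ∧ ‖Y r‖ ≤ R r := by
      intro r hr hrne
      obtain ⟨q, h1, h2, rfl, h4⟩ := hparam r hr
      have h2' : q < r₀ := lt_of_le_of_ne h2 (by rintro rfl; exact hrne rfl)
      refine ⟨hle q h1 h2', ?_⟩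
      simp only [hR, h4]
      exact (hlow q h1 h2').le
    have hend : ‖Y (ε * r₀)‖ ≤ ρ ⌈r₀⌉₊ := by
      rcases hr₀0.eq_or_lt with h | h
      -- With no earlier times to take a limit of, the bound at time 0 comes from the hypothesis
      -- with R = ‖Y 0‖: it would give ‖Y 0‖ < ‖Y 0‖.
      · have hz : ε * r₀ = 0 := by rw [← h, mul_zero]
        have hY0 : Y 0 = Y₀ := by rw [hY 0]; simp
        rw [hz, ← h, Nat.ceil_zero]
        rw [hz, ← h, Nat.ceil_zero] at hmem
        by_contra! hcon'
        have hlt' := hR₀ 0 (‖Y 0‖) ((hρR 0).trans hcon'.le) Y 0 hYc (by simp)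
          (by simp) (by simp [hY0])
        exact lt_irrefl _ hlt'
      · have : r₀ ∈ closure (Set.Ico 0 r₀) := by
          rw [closure_Ico h.ne]; exact Set.right_mem_Icc.mpr hr₀0
        have hsub : closure (Set.Ico 0 r₀) ⊆ {r | ‖Y (ε * r)‖ ≤ ρ ⌈r₀⌉₊} :=
          closure_minimal (fun r hr => hle r hr.1 hr.2) (isClosed_le hYε continuous_const)
        exact hsub this
    refine absurd (hR₀ ⌈r₀⌉₊ (ρ ⌈r₀⌉₊) (hρR _) Y (ε * r₀) hYc ?_ ?_ ?_) (not_lt.mpr hmem)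
    · rw [habs]; exact Nat.le_ceil _
    · intro r hr
      rcases eq_or_ne r (ε * r₀) with rfl | h
      · exact hend
      · exact (hball r hr h).1
    · intro r hr
      rw [hY r]
      congr 1
      refine intervalIntegral.integral_congr_ae ?_
      -- At the endpoint itself the truncation may act, but a single time does not affect the
      -- integral.
      have : ∀ᵐ τ : ℝ, τ ≠ ε * r₀ := by simp [ae_iff, measure_singleton]
      filter_upwards [this] with τ hτ hτr
      have hτ' : τ ∈ Set.uIcc 0 (ε * r₀) :=
        Set.uIcc_subset_uIcc_left hr (Set.uIoc_subset_uIcc hτr)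
      rw [radial_of_norm_le (hball τ hτ' hτ).2]
  refine ⟨Y, hYc, fun t => ?_⟩
  conv_lhs => rw [hY t]
  simp only [radial_of_norm_le (hlt _).le]

end ODE

end

end RenormNLW

namespace RenormNLW

noncomputable section

/-! ### Fourier series on the torus -/

section Fourier

instance : IsProbabilityMeasure torusMeasure := by unfold torusMeasure; infer_instance

/-- The space `ℓ²(ℤ²)`. -/
abbrev Ell2 : Type := lp (fun _ : Freq => ℂ) 2

/-- The complex Fourier synthesis `ℓ²(ℤ²) ≃ L²(𝕋²)`. -/
def synthC : Ell2 ≃ₗᵢ[ℂ] Lp ℂ 2 torusMeasure :=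
  (UnitAddTorus.mFourierBasis (d := Fin 2)).repr.symm

/-- The real part of the Fourier synthesis. -/
def synth : Ell2 →L[ℝ] Lp ℝ 2 torusMeasure :=
  (Complex.reCLM.compLpL 2 torusMeasure).comp
    (synthC.toContinuousLinearEquiv.toContinuousLinearMap.restrictScalars ℝ)

/-- The inclusion of the real functions in the complex ones. -/
def complexify : Lp ℝ 2 torusMeasure →L[ℝ] Lp ℂ 2 torusMeasure :=
  Complex.ofRealCLM.compLpL 2 torusMeasure

theorem complexify_ae (f : Lp ℝ 2 torusMeasure) :
    complexify f =ᵐ[torusMeasure] fun x => (f x : ℂ) :=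
  Complex.ofRealCLM.coeFn_compLpL (p := 2) (𝕜 := ℝ) f

/-- The Fourier coefficients of a real square-integrable function. -/
def analysis : Lp ℝ 2 torusMeasure →L[ℝ] Ell2 :=
  (synthC.symm.toContinuousLinearEquiv.toContinuousLinearMap.restrictScalars ℝ).comp complexify

theorem synth_ae (a : Ell2) : synth a =ᵐ[torusMeasure] fun x => (synthC a x).re :=
  Complex.reCLM.coeFn_compLpL (p := 2) (𝕜 := ℝ) (synthC a)

theorem toFun_ae {a : Dist} (h : Memℓp a 2) : toFun a =ᵐ[torusMeasure] synth ⟨a, h⟩ := by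
  filter_upwards [synth_ae ⟨a, h⟩] with x hx
  rw [hx, toFun, dif_pos h]
  rfl

theorem norm_synth_le (a : Ell2) : ‖synth a‖ ≤ ‖a‖ := by
  rw [← synthC.norm_map a]
  refine Lp.norm_le_norm_of_ae_le ?_
  filter_upwards [synth_ae a] with x hx
  rw [hx]
  exact Complex.abs_re_le_norm _

theorem analysis_apply (f : Lp ℝ 2 torusMeasure) (n : Freq) :
    analysis f n = ∫ x, UnitAddTorus.mFourier (-n) x * (f x : ℂ) ∂torusMeasure := by
  refine (UnitAddTorus.mFourierBasis_repr (d := Fin 2)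
    (complexify f) n).trans ?_
  refine integral_congr_ae ?_
  filter_upwards [complexify_ae f] with x hx
  exact congrArg (fun z => UnitAddTorus.mFourier (-n) x * z) hx

theorem coeff_eq {f : Torus → ℝ} (hf : MemLp f 2 torusMeasure) (n : Freq) :
    coeff f n = analysis (hf.toLp f) n := by
  rw [analysis_apply]
  refine integral_congr_ae ?_
  filter_upwards [hf.coeFn_toLp] with x hx
  rw [hx]
  rfl

theorem coeff_congr {f g : Torus → ℝ} (h : f =ᵐ[torusMeasure] g) : coeff f = coeff g := by
  funext n
  refine integral_congr_ae ?_
  filter_upwards [h] with x hx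
  rw [hx]

theorem coeff_neg (f : Torus → ℝ) (n : Freq) : coeff f (-n) = conj (coeff f n) := by
  rw [coeff, UnitAddTorus.mFourierCoeff, UnitAddTorus.mFourierCoeff, ← integral_conj]
  refine integral_congr_ae (Eventually.of_forall fun x => ?_)
  simp [← UnitAddTorus.mFourier_neg]

theorem norm_analysis (f : Lp ℝ 2 torusMeasure) : ‖analysis f‖ = ‖f‖ := by
  refine (synthC.symm.norm_map (complexify f)).trans ?_
  refine le_antisymm (Lp.norm_le_norm_of_ae_le ?_) (Lp.norm_le_norm_of_ae_le ?_) <;>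
  · filter_upwards [complexify_ae f] with x hx
    rw [hx]
    simp

/-- Parseval, together with f being real: only the real part of the synthesis survives. This turns
the ℓ² pairings of the energy identity into integrals over the torus. -/
theorem re_inner_analysis (a : Ell2) (f : Lp ℝ 2 torusMeasure) :
    (inner ℂ a (analysis f)).re = inner ℝ (synth a) f := by
  have h1 : inner ℂ a (analysis f) =
      inner ℂ (synthC a) (complexify f) := by
    rw [← synthC.inner_map_map]
    congr 1
    exact synthC.apply_symm_apply _
  have hi := L2.integrable_inner (𝕜 := ℂ) (synthC a) (complexify f)
  rw [h1, L2.inner_def, L2.inner_def]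
  refine (integral_re hi).symm.trans (integral_congr_ae ?_)
  filter_upwards [complexify_ae f, synth_ae a] with x hx hx'
  rw [hx, hx']
  simp

theorem memℓp_two_iff {a : Dist} : Memℓp a 2 ↔ Summable fun n => ‖a n‖ ^ 2 := by
  rw [memℓp_gen_iff (by norm_num)]
  simp

theorem norm_sq_eq_tsum (a : Ell2) : ‖a‖ ^ 2 = ∑' n, ‖a n‖ ^ 2 := by
  have := lp.norm_rpow_eq_tsum (p := 2) (by norm_num) a
  simpa using this

theorem hasSum_norm_sq (a : Ell2) : HasSum (fun n => ‖a n‖ ^ 2) (‖a‖ ^ 2) := by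
  rw [norm_sq_eq_tsum]
  exact (memℓp_two_iff.mp (lp.memℓp a)).hasSum

/-- Multiplication of the Fourier coefficients by a real symbol bounded by one. -/
def diag (m : Freq → ℝ) (hm : ∀ n, |m n| ≤ 1) : Ell2 →L[ℝ] Ell2 :=
  LinearMap.mkContinuous
    { toFun := fun a => ⟨fun n => (m n : ℂ) * a n, by
        refine memℓp_two_iff.mpr (Summable.of_nonneg_of_le (fun n => by positivity) (fun n => ?_)
          (memℓp_two_iff.mp (lp.memℓp a)))
        rw [norm_mul, Complex.norm_real, Real.norm_eq_abs, mul_pow]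
        exact mul_le_of_le_one_left (by positivity) (pow_le_one₀ (abs_nonneg _) (hm n))⟩
      map_add' := fun a b => by
        ext n
        exact mul_add _ _ _
      map_smul' := fun c a => by
        ext n
        simp
        ring } 1 fun a => by
    rw [one_mul]
    refine le_of_sq_le_sq ?_ (norm_nonneg _)
    refine hasSum_le (fun n => ?_) (hasSum_norm_sq _) (hasSum_norm_sq a)
    change ‖(m n : ℂ) * a n‖ ^ 2 ≤ _
    rw [norm_mul, Complex.norm_real, Real.norm_eq_abs, mul_pow]
    exact mul_le_of_le_one_left (by positivity) (pow_le_one₀ (abs_nonneg _) (hm n))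

@[simp]
theorem diag_apply (m : Freq → ℝ) (hm : ∀ n, |m n| ≤ 1) (a : Ell2) (n : Freq) :
    diag m hm a n = (m n : ℂ) * a n := rfl

theorem norm_diag_le (m : Freq → ℝ) (hm : ∀ n, |m n| ≤ 1) (a : Ell2) : ‖diag m hm a‖ ≤ ‖a‖ := by
  refine ((diag m hm).le_opNorm a).trans ?_
  exact mul_le_of_le_one_left (norm_nonneg _) (LinearMap.mkContinuous_norm_le _ zero_le_one _)

theorem inner_diag (m : Freq → ℝ) (hm : ∀ n, |m n| ≤ 1) (a b : Ell2) :
    inner ℂ a (diag m hm b) = inner ℂ (diag m hm a) b := by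
  rw [lp.inner_eq_tsum, lp.inner_eq_tsum]
  refine tsum_congr fun n => ?_
  simp
  ring

/-- Symbols continuous in t give only strong continuity, not norm continuity. For a fixed sequence
it follows by dominated convergence; the moving sequence is handled by the uniform bound 1. -/
theorem continuous_diag {m : ℝ → Freq → ℝ} (hm : ∀ t n, |m t n| ≤ 1)
    (hc : ∀ n, Continuous fun t => m t n) {a : ℝ → Ell2} (ha : Continuous a) :
    Continuous fun t => diag (m t) (hm t) (a t) := by
  rw [continuous_iff_continuousAt]
  intro t₀
  have h1 : Tendsto (fun t => diag (m t) (hm t) (a t₀)) (𝓝 t₀) (𝓝 (diag (m t₀) (hm t₀) (a t₀))) := by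
    rw [tendsto_iff_norm_sub_tendsto_zero]
    have h2 : Tendsto (fun t => ‖diag (m t) (hm t) (a t₀) - diag (m t₀) (hm t₀) (a t₀)‖ ^ 2)
        (𝓝 t₀) (𝓝 0) := by
      have h3 : (∑' n : Freq, (0 : ℝ)) = 0 := tsum_zero
      rw [← h3]
      simp_rw [norm_sq_eq_tsum]
      refine tendsto_tsum_of_dominated_convergence (bound := fun n => 4 * ‖a t₀ n‖ ^ 2)
        ((memℓp_two_iff.mp (lp.memℓp (a t₀))).mul_left 4) (fun n => ?_)
        (Eventually.of_forall fun t n => ?_)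
      · have : Continuous fun t => ‖((m t n : ℂ) * a t₀ n - (m t₀ n : ℂ) * a t₀ n)‖ ^ 2 := by
          have := hc n
          fun_prop
        simpa using this.tendsto t₀
      · have e : ‖(diag (m t) (hm t) (a t₀) - diag (m t₀) (hm t₀) (a t₀)) n‖ =
            |m t n - m t₀ n| * ‖a t₀ n‖ := by
          change ‖(m t n : ℂ) * a t₀ n - (m t₀ n : ℂ) * a t₀ n‖ = _
          rw [← sub_mul, ← Complex.ofReal_sub, norm_mul, Complex.norm_real, Real.norm_eq_abs]
        have h5 : |m t n - m t₀ n| ≤ 2 := (abs_sub _ _).trans (by linarith [hm t n, hm t₀ n])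
        rw [e, Real.norm_of_nonneg (by positivity), mul_pow]
        gcongr
        nlinarith [abs_nonneg (m t n - m t₀ n)]
    have := h2.sqrt
    simpa [Real.sqrt_sq (norm_nonneg _)] using this
  have h2 : Tendsto (fun t => diag (m t) (hm t) (a t - a t₀)) (𝓝 t₀) (𝓝 0) := by
    refine squeeze_zero_norm (fun t => norm_diag_le _ _ _) ?_
    have := (ha.tendsto t₀).sub_const (a t₀)
    simpa using this.norm
  have := h2.add h1
  simpa [ContinuousAt] using this

/-- Finite truncations are measurable and converge pointwise in ℓ². -/
theorem aestronglyMeasurable_ell2 {α : Type*} [MeasurableSpace α] {μ : Measure α} {a : α → Ell2}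
    (h : ∀ n, AEStronglyMeasurable (fun t => a t n) μ) : AEStronglyMeasurable a μ := by
  classical
  refine aestronglyMeasurable_of_tendsto_ae (atTop : Filter (Finset Freq))
    (f := fun S t => ∑ n ∈ S, lp.single 2 n (a t n)) (fun S => ?_)
    (Eventually.of_forall fun t => lp.hasSum_single (by norm_num) (a t))
  refine Finset.aestronglyMeasurable_fun_sum S fun n _ => ?_
  exact (lp.singleContinuousLinearMap ℂ (fun _ : Freq => ℂ) 2 n).continuous.comp_aestronglyMeasurable (h n)

theorem continuous_coord {α : Type*} [TopologicalSpace α] {a : α → Ell2} (ha : Continuous a)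
    (n : Freq) : Continuous fun t => a t n :=
  (lp.evalCLM ℂ (fun _ : Freq => ℂ) 2 n).continuous.comp ha

end Fourier

end

end RenormNLW

namespace RenormNLW

noncomputable section

/-! ### Sobolev embeddings -/

section Sobolev

theorem normSq_nonneg (n : Freq) : 0 ≤ normSq n := by unfold normSq; positivity

theorem one_le_bracket (n : Freq) : 1 ≤ bracket n := by
  rw [bracket, Real.one_le_sqrt]
  linarith [normSq_nonneg n]

theorem bracket_pos (n : Freq) : 0 < bracket n := zero_lt_one.trans_le (one_le_bracket n)

theorem bracket_sq (n : Freq) : bracket n ^ 2 = 1 + normSq n :=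
  Real.sq_sqrt (by linarith [normSq_nonneg n])

theorem bracket_neg (n : Freq) : bracket (-n) = bracket n := by simp [bracket, normSq]

theorem abs_le_bracket (n : Freq) (i : Fin 2) : |(n i : ℝ)| ≤ bracket n := by
  refine abs_le_of_sq_le_sq ?_ (bracket_pos n).le
  rw [bracket_sq, normSq]
  fin_cases i <;> simp <;> nlinarith [sq_nonneg (n 0 : ℝ), sq_nonneg (n 1 : ℝ)]

theorem abs_bracket_rpow_neg_le {s : ℝ} (hs : 0 ≤ s) (n : Freq) : |bracket n ^ (-s)| ≤ 1 := by
  rw [abs_of_nonneg (Real.rpow_nonneg (bracket_pos n).le _)]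
  exact Real.rpow_le_one_of_one_le_of_nonpos (one_le_bracket n) (by linarith)

/-- Induction on N. Bernoulli's inequality for the concave power 1 - s shows that the right side
grows by at least 2(N+2)^{-s}, the contribution of the two new terms ±(N+1). -/
theorem sum_Icc_rpow_neg_le {s : ℝ} (hs0 : 0 ≤ s) (hs1 : s < 1) (N : ℕ) :
    ∑ j ∈ Finset.Icc (-(N : ℤ)) N, (1 + |(j : ℝ)|) ^ (-s) ≤
      2 / (1 - s) * ((N : ℝ) + 1) ^ (1 - s) := by
  have h1s : 0 < 1 - s := by linarith
  induction N with
  | zero =>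
    simp
    rw [le_div_iff₀ h1s]
    linarith
  | succ N ih =>
    have e : Finset.Icc (-((N + 1 : ℕ) : ℤ)) (N + 1 : ℕ) =
        insert (-((N : ℤ) + 1)) (insert ((N : ℤ) + 1) (Finset.Icc (-(N : ℤ)) N)) := by
      ext j
      simp only [Finset.mem_Icc, Finset.mem_insert]
      push_cast
      omega
    rw [e, Finset.sum_insert (by simp; omega), Finset.sum_insert (by simp)]
    have hx : (0 : ℝ) < (N : ℝ) + 2 := by positivity
    have hb := rpow_one_add_le_one_add_mul_self (s := -(1 / ((N : ℝ) + 2))) (p := 1 - s)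
      (by rw [neg_le_neg_iff, div_le_one hx]; linarith [(Nat.cast_nonneg N : (0 : ℝ) ≤ N)])
      h1s.le (by linarith)
    have e1 : ((N : ℝ) + 1) ^ (1 - s) =
        ((N : ℝ) + 2) ^ (1 - s) * (1 + -(1 / ((N : ℝ) + 2))) ^ (1 - s) := by
      rw [← Real.mul_rpow hx.le]
      · congr 1; field_simp; ring
      · rw [← sub_eq_add_neg, sub_nonneg, div_le_one hx]
        linarith [(Nat.cast_nonneg N : (0 : ℝ) ≤ N)]
    have e2 : ((N : ℝ) + 2) ^ (-s) = ((N : ℝ) + 2) ^ (1 - s) / (N + 2) := by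
      rw [← Real.rpow_sub_one hx.ne']; congr 1; ring
    have e3 : (1 + |(((-((N : ℤ) + 1) : ℤ)) : ℝ)|) = (N : ℝ) + 2 := by
      push_cast
      rw [abs_neg, abs_of_nonneg (by positivity)]; ring
    have e4 : (1 + |((((N : ℤ) + 1 : ℤ)) : ℝ)|) = (N : ℝ) + 2 := by
      push_cast
      rw [abs_of_nonneg (by positivity)]; ring
    have hX : 0 ≤ ((N : ℝ) + 2) ^ (1 - s) := by positivity
    rw [e3, e4, e2]
    have h3 := mul_le_mul_of_nonneg_left hb hX
    rw [← e1] at h3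
    have h4 := mul_le_mul_of_nonneg_left h3 (by positivity : 0 ≤ 2 / (1 - s))
    have h5 : ((N + 1 : ℕ) : ℝ) + 1 = N + 2 := by push_cast; ring
    rw [h5]
    have h6 : 2 / (1 - s) * (((N : ℝ) + 2) ^ (1 - s) * (1 + (1 - s) * -(1 / ((N : ℝ) + 2)))) =
        2 / (1 - s) * ((N : ℝ) + 2) ^ (1 - s) - 2 * (((N : ℝ) + 2) ^ (1 - s) / (N + 2)) := by
      field_simp
      ring
    linarith

/-- The square box `{n : |n₁|, |n₂| ≤ N}`. -/
def freqBox (N : ℕ) : Finset Freq := Fintype.piFinset fun _ => Finset.Icc (-(N : ℤ)) N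

theorem mem_freqBox_of_bracket_le {R : ℝ} {n : Freq} (h : bracket n ≤ R) : n ∈ freqBox ⌊R⌋₊ := by
  refine Fintype.mem_piFinset.mpr fun i => ?_
  have h1 := (abs_le_bracket n i).trans h
  have h2 : (n i).natAbs ≤ ⌊R⌋₊ := by
    refine Nat.le_floor ?_
    rw [Nat.cast_natAbs, Int.cast_abs]
    exact h1
  rw [Finset.mem_Icc]
  omega

/-- From (1+|n₁|)(1+|n₂|) ≤ 2⟨n⟩². The product form splits a lattice sum over a box into
one-dimensional sums. -/
theorem bracket_rpow_le_prod {s : ℝ} (hs0 : 0 ≤ s) (n : Freq) :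
    bracket n ^ (-(2 * s)) ≤ 2 ^ s * ∏ i, (1 + |(n i : ℝ)|) ^ (-s) := by
  have h1 : (1 + |(n 0 : ℝ)|) * (1 + |(n 1 : ℝ)|) ≤ 2 * bracket n ^ 2 := by
    rw [bracket_sq, normSq, ← sq_abs (n 0 : ℝ), ← sq_abs (n 1 : ℝ)]
    nlinarith [sq_nonneg (|(n 0 : ℝ)| - 1), sq_nonneg (|(n 1 : ℝ)| - 1),
      sq_nonneg (|(n 0 : ℝ)| - |(n 1 : ℝ)|)]
  have hb := bracket_pos n
  rw [Fin.prod_univ_two, ← Real.mul_rpow (by positivity) (by positivity)]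
  have h2 : (2 * bracket n ^ 2) ^ (-s) ≤ ((1 + |(n 0 : ℝ)|) * (1 + |(n 1 : ℝ)|)) ^ (-s) :=
    Real.rpow_le_rpow_of_nonpos (by positivity) h1 (by linarith)
  have h3 : (2 * bracket n ^ 2) ^ (-s) = 2 ^ (-s) * bracket n ^ (-(2 * s)) := by
    rw [Real.mul_rpow (by norm_num) (by positivity), ← Real.rpow_natCast, ← Real.rpow_mul hb.le]
    congr 2; push_cast; ring
  rw [h3] at h2
  have h4 := mul_le_mul_of_nonneg_left h2 (by positivity : (0 : ℝ) ≤ 2 ^ s)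
  rwa [← mul_assoc, ← Real.rpow_add (by norm_num), add_neg_cancel, Real.rpow_zero, one_mul] at h4

/-- Written as a square for use with Cauchy–Schwarz: a function in H^s with frequencies ⟨n⟩ ≤ R is
bounded by K R^{1-s} times its H^s norm. -/
theorem sum_bracket_rpow_le {s : ℝ} (hs0 : 0 ≤ s) (hs1 : s < 1) :
    ∃ K : ℝ, 0 < K ∧ ∀ (R : ℝ) (S : Finset Freq), (∀ n ∈ S, bracket n ≤ R) →
      ∑ n ∈ S, bracket n ^ (-(2 * s)) ≤ (K * R ^ (1 - s)) ^ 2 := by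
  have h1s : 0 < 1 - s := by linarith
  refine ⟨(2 : ℝ) ^ (s / 2) * (2 / (1 - s) * 2 ^ (1 - s)), by positivity, fun R S hS => ?_⟩
  rcases S.eq_empty_or_nonempty with rfl | ⟨n₀, hn₀⟩
  · simp only [Finset.sum_empty]; positivity
  have hR : 1 ≤ R := (one_le_bracket n₀).trans (hS n₀ hn₀)
  calc ∑ n ∈ S, bracket n ^ (-(2 * s)) ≤ ∑ n ∈ freqBox ⌊R⌋₊, bracket n ^ (-(2 * s)) :=
        Finset.sum_le_sum_of_subset_of_nonneg (fun n hn => mem_freqBox_of_bracket_le (hS n hn))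
          fun n _ _ => Real.rpow_nonneg (bracket_pos n).le _
    _ ≤ ∑ n ∈ freqBox ⌊R⌋₊, 2 ^ s * ∏ i, (1 + |(n i : ℝ)|) ^ (-s) :=
        Finset.sum_le_sum fun n _ => bracket_rpow_le_prod hs0 n
    _ = 2 ^ s * (∑ j ∈ Finset.Icc (-(⌊R⌋₊ : ℤ)) ⌊R⌋₊, (1 + |(j : ℝ)|) ^ (-s)) ^ 2 := by
        rw [← Finset.mul_sum, freqBox, ← Finset.prod_univ_sum
          (f := fun (_ : Fin 2) (j : ℤ) => (1 + |(j : ℝ)|) ^ (-s)), Fin.prod_univ_two, sq]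
    _ ≤ 2 ^ s * (2 / (1 - s) * ((2 * R) ^ (1 - s))) ^ 2 := by
        gcongr
        refine (sum_Icc_rpow_neg_le hs0 hs1 _).trans ?_
        gcongr
        linarith [Nat.floor_le (zero_le_one.trans hR)]
    _ = _ := by
        rw [Real.mul_rpow (by norm_num) (by linarith)]
        have : (2 : ℝ) ^ s = ((2 : ℝ) ^ (s / 2)) ^ 2 := by
          rw [← Real.rpow_natCast, ← Real.rpow_mul (by norm_num)]; congr 1; push_cast; ring
        rw [this]; ring

theorem synthC_ae_sum {a : Ell2} {S : Finset Freq} (h : ∀ n ∉ S, a n = 0) :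
    synthC a =ᵐ[torusMeasure] fun x => ∑ n ∈ S, a n * UnitAddTorus.mFourier n x := by
  have h1 : HasSum (fun n => a n • (UnitAddTorus.mFourierBasis (d := Fin 2)) n) (synthC a) := by
    exact (UnitAddTorus.mFourierBasis (d := Fin 2)).hasSum_repr_symm a
  have h2 : synthC a = ∑ n ∈ S, a n • (UnitAddTorus.mFourierLp (d := Fin 2) 2 n :
      Lp ℂ 2 torusMeasure) := by
    refine h1.unique ?_
    rw [UnitAddTorus.coe_mFourierBasis]
    exact hasSum_sum_of_ne_finset_zero fun n hn => by rw [h n hn, zero_smul]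
  rw [h2]
  have h3 : ∀ᵐ x ∂torusMeasure, ∀ n ∈ S, (a n • (UnitAddTorus.mFourierLp (d := Fin 2) 2 n :
      Lp ℂ 2 torusMeasure) : Lp ℂ 2 torusMeasure) x = a n * UnitAddTorus.mFourier n x := by
    rw [eventually_all_finset]
    intro n _
    filter_upwards [Lp.coeFn_smul (a n) (UnitAddTorus.mFourierLp (d := Fin 2) 2 n :
      Lp ℂ 2 torusMeasure), UnitAddTorus.coeFn_mFourierLp (d := Fin 2) 2 n] with x hx hx'
    rw [hx, Pi.smul_apply, smul_eq_mul]
    exact congrArg _ hx'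
  filter_upwards [Lp.coeFn_finsetSum S fun n => a n • (UnitAddTorus.mFourierLp (d := Fin 2) 2 n :
      Lp ℂ 2 torusMeasure), h3] with x hx hx'
  refine hx.trans ?_
  rw [Finset.sum_apply]
  exact Finset.sum_congr rfl hx'

theorem norm_mFourier_apply (n : Freq) (x : Torus) : ‖UnitAddTorus.mFourier n x‖ = 1 := by
  simp [UnitAddTorus.mFourier, fourier_apply, Circle.norm_coe]

theorem lintegral_rpow_lt {p B : ℝ} (hp : 2 < p) (hB : 0 ≤ B) :
    ∫⁻ t in Set.Ioi (0 : ℝ), (if t < B then ENNReal.ofReal (t ^ (p - 3)) else 0) =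
      ENNReal.ofReal (B ^ (p - 2) / (p - 2)) := by
  have h1 : (fun t : ℝ => if t < B then ENNReal.ofReal (t ^ (p - 3)) else 0) =
      (Set.Iio B).indicator fun t => ENNReal.ofReal (t ^ (p - 3)) := by
    ext t; simp [Set.indicator_apply]
  rw [h1, setLIntegral_indicator measurableSet_Iio, Set.inter_comm, Set.Ioi_inter_Iio,
    Measure.restrict_congr_set Ioo_ae_eq_Ioc, ← ofReal_integral_eq_lintegral_ofReal,
    ← intervalIntegral.integral_of_le hB, integral_rpow (Or.inl (by linarith))]
  · rw [show p - 3 + 1 = p - 2 by ring, Real.zero_rpow (by linarith), sub_zero]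
  · exact (intervalIntegral.intervalIntegrable_rpow' (by linarith)).1
  · filter_upwards [ae_restrict_mem measurableSet_Ioc] with t ht
    exact Real.rpow_nonneg ht.1.le _

/-- Where |f| > t and |g| ≤ t/2, the remainder satisfies |h| > t/2; then Chebyshev in L². -/
theorem meas_lt_norm_le (f g h : Lp ℂ 2 torusMeasure) (hf : f = g + h) {t : ℝ} (ht : 0 < t)
    (hg : ∀ᵐ x ∂torusMeasure, ‖g x‖ ≤ t / 2) :
    torusMeasure {x | t < ‖f x‖} ≤ ENNReal.ofReal (4 / t ^ 2 * ‖h‖ ^ 2) := by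
  have h1 : torusMeasure {x | t < ‖f x‖} ≤ torusMeasure {x | ENNReal.ofReal (t / 2) ≤ ‖h x‖ₑ} := by
    refine measure_mono_ae ?_
    filter_upwards [hg, Lp.coeFn_add g h] with x hx hx'
    intro hlt
    change t < ‖f x‖ at hlt
    change ENNReal.ofReal (t / 2) ≤ ‖h x‖ₑ
    rw [hf, hx', Pi.add_apply] at hlt
    have := norm_add_le (g x) (h x)
    rw [← ofReal_norm]
    exact ENNReal.ofReal_le_ofReal (by linarith)
  refine h1.trans ?_
  have h2 := mul_meas_ge_le_pow_eLpNorm' torusMeasure (p := 2) (by norm_num) (by norm_num)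
    (Lp.aestronglyMeasurable h) (ENNReal.ofReal (t / 2))
  rw [← Lp.enorm_def, ← ofReal_norm] at h2
  simp only [ENNReal.toReal_ofNat, ENNReal.rpow_ofNat] at h2
  rw [← ENNReal.ofReal_pow (by positivity), ← ENNReal.ofReal_pow (by positivity)] at h2
  have hpos : 0 < (t / 2) ^ 2 := by positivity
  have e : 4 / t ^ 2 * ‖h‖ ^ 2 = ‖h‖ ^ 2 / (t / 2) ^ 2 := by field_simp; ring
  rw [e, ENNReal.ofReal_div_of_pos hpos, ENNReal.le_div_iff_mul_le (Or.inl (ENNReal.ofReal_pos.mpr hpos).ne')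
    (Or.inl ENNReal.ofReal_ne_top), mul_comm]
  exact h2

/-- Layer-cake proof. At each level t the frequencies are cut so that the low part is at most t/2
everywhere; only the high part contributes to the measure of {|f| > t}, by Chebyshev. Integrating in
t first, for each frequency separately, gives a weight that exactly undoes ⟨n⟩^{-2s}. -/
theorem sobolev_embedding {p : ℝ} (hp : 2 < p) :
    ∃ C : ℝ≥0, ∀ (hm : ∀ n, |bracket n ^ (-(1 - 2 / p))| ≤ 1) (a : Ell2),
      eLpNorm (synthC (diag (fun n => bracket n ^ (-(1 - 2 / p))) hm a)) (ENNReal.ofReal p)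
        torusMeasure ≤ C * ‖a‖ₑ := by
  have hp0 : 0 < p := by linarith
  set s := 1 - 2 / p with hs
  have h2p : 2 / p < 1 := (div_lt_one hp0).mpr hp
  have hs0 : 0 ≤ s := by linarith
  have hs1 : s < 1 := by have : 0 < 2 / p := by positivity
                         linarith
  have h1s : 0 < 1 - s := by linarith
  -- Scaling relation between s and p which makes the weights cancel at the end.
  have hexp : (1 - s) * (p - 2) = 2 * s := by rw [hs]; field_simp; ring
  obtain ⟨K, hK0, hK⟩ := sum_bracket_rpow_le hs0 hs1
  set C₀ : ℝ := p * 4 / (p - 2) * (2 * K) ^ (p - 2) with hC₀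
  have hC₀0 : 0 ≤ C₀ := by
    have : 0 < p - 2 := by linarith
    positivity
  refine ⟨Real.toNNReal (C₀ ^ (1 / p)), fun hm a => ?_⟩
  rcases eq_or_ne a 0 with rfl | ha
  · rw [map_zero, map_zero, eLpNorm_congr_ae (Lp.coeFn_zero _ _ _)]
    simp
  set M := ‖a‖ with hM
  have hM0 : 0 < M := norm_pos_iff.mpr ha
  set c : Ell2 := diag (fun n => bracket n ^ (-s)) hm a with hc
  have hbp := bracket_pos
  have hcn : ∀ n, ‖c n‖ = bracket n ^ (-s) * ‖a n‖ := fun n => by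
    rw [hc, diag_apply, norm_mul, Complex.norm_real, Real.norm_of_nonneg
      (Real.rpow_nonneg (hbp n).le _)]
  -- The frequency n counts as high at level t exactly when t < B n.
  set B : Freq → ℝ := fun n => 2 * M * K * bracket n ^ (1 - s) with hB
  have hB0 : ∀ n, 0 < B n := fun n => by have := hbp n; positivity
  have hmeas : ∀ t : ℝ, 0 < t → torusMeasure {x | t < ‖synthC c x‖} ≤
      ∑' n, if t < B n then ENNReal.ofReal (4 / t ^ 2 * ‖c n‖ ^ 2) else 0 := by
    intro t ht
    have hlm : ∀ n, |(if t < B n then (0 : ℝ) else 1)| ≤ 1 := fun n => by split_ifs <;> simp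
    have hhm : ∀ n, |(if t < B n then (1 : ℝ) else 0)| ≤ 1 := fun n => by split_ifs <;> simp
    set lo := diag _ hlm c with hlo
    set hi := diag _ hhm c with hhi
    have hsum : c = lo + hi := by
      ext n
      change c n = ((if t < B n then (0 : ℝ) else 1 : ℝ) : ℂ) * c n +
        ((if t < B n then (1 : ℝ) else 0 : ℝ) : ℂ) * c n
      split_ifs <;> simp
    -- Chosen so that K M R^{1-s} = t/2.
    set R := (t / (2 * M * K)) ^ (1 / (1 - s)) with hR
    have hBR : ∀ n, ¬ t < B n → bracket n ≤ R := by
      intro n hn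
      have h1 : bracket n ^ (1 - s) ≤ t / (2 * M * K) := by
        rw [le_div_iff₀ (by positivity)]
        have := not_lt.mp hn
        simp only [hB] at this
        linarith
      have h2 := Real.rpow_le_rpow (by have := hbp n; positivity) h1
        (by positivity : 0 ≤ 1 / (1 - s))
      rwa [← Real.rpow_mul (hbp n).le, mul_one_div_cancel h1s.ne', Real.rpow_one] at h2
    have hRp : R ^ (1 - s) = t / (2 * M * K) := by
      rw [hR, ← Real.rpow_mul (by positivity), one_div_mul_cancel h1s.ne', Real.rpow_one]
    set S : Finset Freq := (freqBox ⌊R⌋₊).filter fun n => ¬ t < B n with hS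
    have hloS : ∀ n ∉ S, lo n = 0 := by
      intro n hn
      rw [hlo, diag_apply]
      by_cases h : t < B n
      · simp [h]
      · exact absurd (Finset.mem_filter.mpr ⟨mem_freqBox_of_bracket_le (hBR n h), h⟩) hn
    have hlob : ∀ᵐ x ∂torusMeasure, ‖synthC lo x‖ ≤ t / 2 := by
      filter_upwards [synthC_ae_sum hloS] with x hx
      rw [hx]
      have hle : ∀ n, ‖lo n‖ ≤ bracket n ^ (-s) * ‖a n‖ := fun n => by
        rw [← hcn, hlo, diag_apply]; split_ifs <;> simp
      have hcs := Finset.sum_mul_sq_le_sq_mul_sq S (fun n => bracket n ^ (-s)) fun n => ‖a n‖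
      have h1 : ∑ n ∈ S, (bracket n ^ (-s)) ^ 2 ≤ (K * R ^ (1 - s)) ^ 2 := by
        refine le_trans (le_of_eq (Finset.sum_congr rfl fun n _ => ?_))
          (hK R S fun n hn => hBR n (Finset.mem_filter.mp hn).2)
        rw [← Real.rpow_natCast, ← Real.rpow_mul (hbp n).le]
        congr 1; push_cast; ring
      have h2 : ∑ n ∈ S, ‖a n‖ ^ 2 ≤ M ^ 2 :=
        sum_le_hasSum S (fun n _ => by positivity) (hasSum_norm_sq a)
      have h3 : (∑ n ∈ S, bracket n ^ (-s) * ‖a n‖) ^ 2 ≤ (t / 2) ^ 2 := by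
        refine hcs.trans ((mul_le_mul h1 h2 (Finset.sum_nonneg fun n _ => by positivity)
          (by positivity)).trans (le_of_eq ?_))
        rw [hRp]; field_simp
      calc ‖∑ n ∈ S, lo n * UnitAddTorus.mFourier n x‖
          ≤ ∑ n ∈ S, ‖lo n * UnitAddTorus.mFourier n x‖ := norm_sum_le _ _
        _ ≤ ∑ n ∈ S, bracket n ^ (-s) * ‖a n‖ := Finset.sum_le_sum fun n _ => by
            rw [norm_mul, norm_mFourier_apply, mul_one]; exact hle n
        _ ≤ t / 2 := le_of_sq_le_sq h3 (by positivity)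
    refine (meas_lt_norm_le (synthC c) (synthC lo) (synthC hi) (by rw [← map_add, ← hsum]) ht
      hlob).trans ?_
    rw [synthC.norm_map, norm_sq_eq_tsum, ← tsum_mul_left, ENNReal.ofReal_tsum_of_nonneg
      (fun n => by positivity) ((hasSum_norm_sq hi).summable.mul_left _)]
    refine ENNReal.tsum_le_tsum fun n => ?_
    rw [hhi, diag_apply]
    split_ifs <;> simp
  have hmain : ∫⁻ x, ENNReal.ofReal (‖synthC c x‖ ^ p) ∂torusMeasure ≤
      ENNReal.ofReal (C₀ * M ^ p) := by
    rw [lintegral_rpow_eq_lintegral_meas_lt_mul torusMeasure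
      (Eventually.of_forall fun x => norm_nonneg _)
      (Lp.aestronglyMeasurable (synthC c)).norm.aemeasurable hp0]
    -- Tonelli: t^{p-1}·t^{-2} = t^{p-3} is integrable at 0 as p > 2, and for each n the integral
    -- stops at B n.
    calc ENNReal.ofReal p * ∫⁻ t in Set.Ioi (0 : ℝ), torusMeasure {x | t < ‖synthC c x‖} *
          ENNReal.ofReal (t ^ (p - 1))
        ≤ ENNReal.ofReal p * ∫⁻ t in Set.Ioi (0 : ℝ), ∑' n, ENNReal.ofReal (4 * ‖c n‖ ^ 2) *
          (if t < B n then ENNReal.ofReal (t ^ (p - 3)) else 0) := by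
          refine mul_le_mul_right ?_ _
          refine setLIntegral_mono' measurableSet_Ioi fun t ht => ?_
          have ht : 0 < t := ht
          refine (mul_le_mul_left (hmeas t ht) _).trans (le_of_eq ?_)
          rw [← ENNReal.tsum_mul_right]
          refine tsum_congr fun n => ?_
          split_ifs
          · rw [← ENNReal.ofReal_mul (by positivity), ← ENNReal.ofReal_mul (by positivity)]
            congr 1
            have : t ^ (p - 1) = t ^ (p - 3) * t ^ 2 := by
              rw [← Real.rpow_natCast, ← Real.rpow_add ht]; congr 1; push_cast; ring
            rw [this]; field_simp
          · simp
      _ = ENNReal.ofReal p * ∑' n, ENNReal.ofReal (4 * ‖c n‖ ^ 2) *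
          ENNReal.ofReal (B n ^ (p - 2) / (p - 2)) := by
          congr 1
          have hmeas' : ∀ n, Measurable fun t : ℝ =>
              if t < B n then ENNReal.ofReal (t ^ (p - 3)) else 0 := fun n =>
            Measurable.ite measurableSet_Iio (by fun_prop) measurable_const
          rw [lintegral_tsum fun n => ((hmeas' n).const_mul _).aemeasurable]
          refine tsum_congr fun n => ?_
          rw [lintegral_const_mul _ (hmeas' n), lintegral_rpow_lt hp (hB0 n).le]
      _ = ENNReal.ofReal p * ∑' n, ENNReal.ofReal
          (4 / (p - 2) * (2 * M * K) ^ (p - 2) * ‖a n‖ ^ 2) := by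
          congr 1
          refine tsum_congr fun n => ?_
          rw [← ENNReal.ofReal_mul (by positivity)]
          congr 1
          have hb := hbp n
          have h1 : B n ^ (p - 2) = (2 * M * K) ^ (p - 2) * bracket n ^ (2 * s) := by
            simp only [hB]
            rw [Real.mul_rpow (by positivity) (by positivity), ← Real.rpow_mul hb.le, hexp]
          have h2 : (bracket n ^ (-s)) ^ 2 * bracket n ^ (2 * s) = 1 := by
            rw [← Real.rpow_natCast, ← Real.rpow_mul hb.le, ← Real.rpow_add hb]
            simp only [Nat.cast_ofNat]
            rw [show -s * 2 + 2 * s = 0 by ring, Real.rpow_zero]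
          rw [h1, hcn, mul_pow]
          calc _ = 4 / (p - 2) * (2 * M * K) ^ (p - 2) * ‖a n‖ ^ 2 *
                ((bracket n ^ (-s)) ^ 2 * bracket n ^ (2 * s)) := by ring
            _ = _ := by rw [h2, mul_one]
      _ = _ := by
          have hp2 : 0 < p - 2 := by linarith
          rw [← ENNReal.ofReal_tsum_of_nonneg (fun n => by positivity)
            ((hasSum_norm_sq a).summable.mul_left _), tsum_mul_left, ← norm_sq_eq_tsum,
            ← ENNReal.ofReal_mul hp0.le]
          congr 1
          have h1 : (2 * M * K) ^ (p - 2) = (2 * K) ^ (p - 2) * M ^ (p - 2) := by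
            rw [← Real.mul_rpow (by positivity) hM0.le]; congr 1; ring
          have h2 : M ^ p = M ^ (p - 2) * M ^ 2 := by
            rw [← Real.rpow_natCast M 2, ← Real.rpow_add hM0]; congr 1; push_cast; ring
          rw [h1, h2, hC₀]; ring
  have hpE : ENNReal.ofReal p ≠ 0 := by simpa using hp0
  rw [eLpNorm_eq_lintegral_rpow_enorm_toReal hpE ENNReal.ofReal_ne_top,
    ENNReal.toReal_ofReal hp0.le]
  have h3 : ∫⁻ x, ‖synthC c x‖ₑ ^ p ∂torusMeasure =
      ∫⁻ x, ENNReal.ofReal (‖synthC c x‖ ^ p) ∂torusMeasure := by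
    refine lintegral_congr fun x => ?_
    rw [← ENNReal.ofReal_rpow_of_nonneg (norm_nonneg _) hp0.le, ofReal_norm]
  rw [h3]
  refine (ENNReal.rpow_le_rpow hmain (by positivity)).trans (le_of_eq ?_)
  rw [ENNReal.ofReal_rpow_of_nonneg (by positivity) (by positivity),
    Real.mul_rpow hC₀0 (by positivity), ← Real.rpow_mul hM0.le, mul_one_div_cancel hp0.ne',
    Real.rpow_one, ENNReal.ofReal_mul (by positivity), hM, ofReal_norm]
  rfl

end Sobolev

end

end RenormNLW

namespace RenormNLW

noncomputable section

/-! ### Estimates for the Hermite polynomials -/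

section Hermite

theorem abs_sub_le_of_hasDerivAt {f f' : ℝ → ℝ} {a b M : ℝ}
    (hf : ∀ y ∈ Set.uIcc b a, HasDerivAt f (f' y) y) (hM : ∀ y ∈ Set.uIcc b a, |f' y| ≤ M) :
    |f a - f b| ≤ M * |a - b| :=
  (convex_uIcc b a).norm_image_sub_le_of_norm_hasDerivWithin_le
    (fun y hy => (hf y hy).hasDerivWithinAt) hM Set.left_mem_uIcc Set.right_mem_uIcc

theorem abs_le_of_mem_uIcc {a b y : ℝ} (hy : y ∈ Set.uIcc b a) : |y| ≤ |a| + |b| := by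
  rw [Set.mem_uIcc] at hy
  rcases hy with ⟨h1, h2⟩ | ⟨h1, h2⟩ <;> rw [abs_le] <;> constructor <;>
    linarith [neg_abs_le a, neg_abs_le b, le_abs_self a, le_abs_self b, abs_nonneg a, abs_nonneg b]

theorem hermiteH_growth (σm : ℝ) (k : ℕ) :
    ∃ C : ℝ, 0 ≤ C ∧ ∀ x σ : ℝ, |σ| ≤ σm → |hermiteH k x σ| ≤ C * (1 + |x|) ^ k := by
  induction k using Nat.twoStepInduction with
  | zero => exact ⟨1, by norm_num, fun x σ _ => by simp [hermiteH]⟩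
  | one => exact ⟨1, by norm_num, fun x σ _ => by simp [hermiteH]⟩
  | more k ih1 ih2 =>
    obtain ⟨C1, hC1, h1⟩ := ih1
    obtain ⟨C2, hC2, h2⟩ := ih2
    refine ⟨C2 + (k + 1) * |σm| * C1, by positivity, fun x σ hσ => ?_⟩
    have hx : (1 : ℝ) ≤ 1 + |x| := by linarith [abs_nonneg x]
    calc |hermiteH (k + 2) x σ| ≤ |x * hermiteH (k + 1) x σ| + |(k + 1) * σ * hermiteH k x σ| := by
          rw [hermiteH]; exact abs_sub _ _
      _ = |x| * |hermiteH (k + 1) x σ| + (k + 1) * |σ| * |hermiteH k x σ| := by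
          rw [abs_mul, abs_mul, abs_mul, abs_of_nonneg (by positivity : (0 : ℝ) ≤ k + 1)]
      _ ≤ (1 + |x|) * (C2 * (1 + |x|) ^ (k + 1)) +
          (k + 1) * |σm| * (C1 * (1 + |x|) ^ (k + 2)) := by
          have e1 := h2 x σ hσ
          have e2 : |hermiteH k x σ| ≤ C1 * (1 + |x|) ^ (k + 2) :=
            (h1 x σ hσ).trans (mul_le_mul_of_nonneg_left (pow_le_pow_right₀ hx (by omega)) hC1)
          have e3 : |σ| ≤ |σm| := hσ.trans (le_abs_self _)
          have e4 : |x| ≤ 1 + |x| := by linarith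
          exact add_le_add (mul_le_mul e4 e1 (abs_nonneg _) (by positivity))
            (mul_le_mul (by gcongr) e2 (abs_nonneg _) (by positivity))
      _ = _ := by ring

theorem hermiteH_lipschitz (σm : ℝ) (k : ℕ) :
    ∃ C : ℝ, 0 ≤ C ∧ ∀ a b σ : ℝ, |σ| ≤ σm →
      |hermiteH (k + 1) a σ - hermiteH (k + 1) b σ| ≤ C * (1 + |a| + |b|) ^ k * |a - b| := by
  obtain ⟨C, hC, h⟩ := hermiteH_growth σm k
  refine ⟨(k + 1) * C, by positivity, fun a b σ hσ => ?_⟩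
  refine abs_sub_le_of_hasDerivAt (fun y _ => hasDerivAt_hermiteH σ k y) fun y hy => ?_
  rw [abs_mul, abs_of_nonneg (by positivity : (0 : ℝ) ≤ k + 1), mul_assoc]
  gcongr
  refine (h y σ hσ).trans ?_
  have : 1 + |y| ≤ 1 + |a| + |b| := by linarith [abs_le_of_mem_uIcc hy]
  gcongr

/-- The generating function solves the backward heat equation ∂_σ = -½∂ₓ². This is how a
time-dependent variance enters the energy balance. -/
theorem hasDerivAt_hermiteH_variance (x : ℝ) (k : ℕ) (σ : ℝ) :
    HasDerivAt (fun s => hermiteH (k + 2) x s) (-((k + 2) * (k + 1) / 2) * hermiteH k x σ) σ := by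
  induction k using Nat.twoStepInduction with
  | zero =>
    have h := (hasDerivAt_id σ).const_sub (x * x)
    refine (h.congr_deriv ?_).congr_of_eventuallyEq (Eventually.of_forall fun y => ?_)
    · simp [hermiteH]
    · simp [hermiteH]
  | one =>
    have h := ((hasDerivAt_id σ).const_mul (-(3 * x))).const_add (x * x * x)
    refine (h.congr_deriv ?_).congr_of_eventuallyEq (Eventually.of_forall fun y => ?_)
    · simp only [hermiteH]; push_cast; ring
    · simp [hermiteH]; ring
  | more k ih1 ih2 =>
    have h := (ih2.const_mul x).sub
      (((hasDerivAt_id σ).const_mul (((k + 2 : ℕ) : ℝ) + 1)).mul ih1)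
    refine (h.congr_deriv ?_).congr_of_eventuallyEq (Eventually.of_forall fun y => ?_)
    · simp only [hermiteH, id]; push_cast; ring
    · simp [hermiteH]

theorem hermiteH_lipschitz_variance (σm : ℝ) (k : ℕ) :
    ∃ C : ℝ, 0 ≤ C ∧ ∀ x s s' : ℝ, |s| ≤ σm → |s'| ≤ σm →
      |hermiteH k x s' - hermiteH k x s| ≤ C * (1 + |x|) ^ k * |s' - s| := by
  match k with
  | 0 => exact ⟨0, le_rfl, fun x s s' _ _ => by simp [hermiteH]⟩
  | 1 => exact ⟨0, le_rfl, fun x s s' _ _ => by simp [hermiteH]⟩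
  | k + 2 =>
    obtain ⟨C, hC, h⟩ := hermiteH_growth σm k
    refine ⟨(k + 2) * (k + 1) / 2 * C, by positivity, fun x s s' hs hs' => ?_⟩
    refine abs_sub_le_of_hasDerivAt (fun y _ => hasDerivAt_hermiteH_variance x k y) fun y hy => ?_
    have hy' : |y| ≤ σm := by
      rw [abs_le] at *
      rw [Set.mem_uIcc] at hy
      rcases hy with hy | hy <;> constructor <;> linarith [hs.1, hs.2, hs'.1, hs'.2]
    rw [abs_mul, abs_neg, abs_of_nonneg (by positivity), mul_assoc]
    gcongr
    refine (h x y hy').trans ?_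
    gcongr
    · linarith [abs_nonneg x]
    · omega

/-- First-order expansion jointly in the argument and the variance. The change is made in x at
variance s', then in σ at the point b, and the mismatch between H_{j+1} at s' and at s is a product
of two increments, split by Young. -/
theorem hermiteH_taylor (σm : ℝ) (j : ℕ) :
    ∃ C : ℝ, 0 ≤ C ∧ ∀ a b s s' : ℝ, |s| ≤ σm → |s'| ≤ σm →
      |hermiteH (j + 2) a s' - hermiteH (j + 2) b s - (j + 2) * hermiteH (j + 1) b s * (a - b) +
        (j + 2) * (j + 1) / 2 * hermiteH j b s * (s' - s)| ≤
      C * (1 + |a| + |b|) ^ (j + 2) * ((a - b) ^ 2 + (s' - s) ^ 2) := by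
  obtain ⟨C1, hC1, h1⟩ := hermiteH_lipschitz σm j
  obtain ⟨C2, hC2, h2⟩ := hermiteH_lipschitz_variance σm (j + 1)
  obtain ⟨C3, hC3, h3⟩ := hermiteH_lipschitz_variance σm j
  refine ⟨(j + 2) * C1 * 2 ^ j + (j + 2) * C2 + (j + 2) * (j + 1) / 2 * C3, by positivity,
    fun a b s s' hs hs' => ?_⟩
  set X := 1 + |a| + |b| with hX
  have hX1 : 1 ≤ X := by linarith [abs_nonneg a, abs_nonneg b]
  have hbX : 1 + |b| ≤ X := by linarith [abs_nonneg a]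
  have hj : X ^ j ≤ X ^ (j + 2) := pow_le_pow_right₀ hX1 (by omega)
  have hj1 : X ^ (j + 1) ≤ X ^ (j + 2) := pow_le_pow_right₀ hX1 (by omega)
  have t1 : |hermiteH (j + 2) a s' - hermiteH (j + 2) b s' -
      (j + 2) * hermiteH (j + 1) b s' * (a - b)| ≤ (j + 2) * C1 * 2 ^ j * X ^ j * (a - b) ^ 2 := by
    have := abs_sub_le_of_hasDerivAt (a := a) (b := b)
      (f := fun y => hermiteH (j + 2) y s' - (j + 2) * hermiteH (j + 1) b s' * y)
      (f' := fun y => (j + 2) * (hermiteH (j + 1) y s' - hermiteH (j + 1) b s'))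
      (M := (j + 2) * C1 * 2 ^ j * X ^ j * |a - b|) (fun y _ => by
        have h := (hasDerivAt_hermiteH s' (j + 1) y).sub
          ((hasDerivAt_id y).const_mul ((j + 2) * hermiteH (j + 1) b s'))
        refine h.congr_deriv ?_
        push_cast; ring) fun y hy => by
        rw [abs_mul, abs_of_nonneg (by positivity : (0 : ℝ) ≤ j + 2)]
        have hyb : |y - b| ≤ |a - b| := Set.abs_sub_left_of_mem_uIcc hy
        have hy1 : 1 + |y| + |b| ≤ 2 * X := by
          linarith [abs_le_of_mem_uIcc hy, abs_nonneg a]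
        calc _ ≤ (j + 2) * (C1 * (1 + |y| + |b|) ^ j * |y - b|) := by
              gcongr; exact h1 y b s' hs'
          _ ≤ (j + 2) * (C1 * (2 * X) ^ j * |a - b|) := by gcongr
          _ = _ := by rw [mul_pow]; ring
    rw [mul_assoc _ |a - b|, ← sq, sq_abs] at this
    refine le_trans (le_of_eq ?_) this
    congr 1; ring
  have t2 : |(j + 2) * (hermiteH (j + 1) b s' - hermiteH (j + 1) b s) * (a - b)| ≤
      (j + 2) * C2 * X ^ (j + 2) * ((a - b) ^ 2 + (s' - s) ^ 2) := by
    rw [abs_mul, abs_mul, abs_of_nonneg (by positivity : (0 : ℝ) ≤ j + 2)]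
    calc _ ≤ (j + 2) * (C2 * X ^ (j + 2) * |s' - s|) * |a - b| := by
          gcongr
          refine (h2 b s s' hs hs').trans ?_
          gcongr
          exact (pow_le_pow_left₀ (by positivity) hbX _).trans hj1
      _ = (j + 2) * C2 * X ^ (j + 2) * (|s' - s| * |a - b|) := by ring
      _ ≤ _ := by
          gcongr
          rw [← sq_abs (a - b), ← sq_abs (s' - s)]
          nlinarith [sq_nonneg (|a - b| - |s' - s|), sq_nonneg (|a - b|), sq_nonneg (|s' - s|)]
  have t3 : |hermiteH (j + 2) b s' - hermiteH (j + 2) b s +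
      (j + 2) * (j + 1) / 2 * hermiteH j b s * (s' - s)| ≤
      (j + 2) * (j + 1) / 2 * C3 * X ^ j * (s' - s) ^ 2 := by
    have := abs_sub_le_of_hasDerivAt (a := s') (b := s)
      (f := fun y => hermiteH (j + 2) b y + (j + 2) * (j + 1) / 2 * hermiteH j b s * y)
      (f' := fun y => -((j + 2) * (j + 1) / 2) * (hermiteH j b y - hermiteH j b s))
      (M := (j + 2) * (j + 1) / 2 * C3 * X ^ j * |s' - s|) (fun y _ => by
        have h := (hasDerivAt_hermiteH_variance b j y).add
          ((hasDerivAt_id y).const_mul ((j + 2) * (j + 1) / 2 * hermiteH j b s))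
        refine h.congr_deriv ?_
        ring) fun y hy => by
        have hy' : |y| ≤ σm := by
          rw [abs_le] at *
          rw [Set.mem_uIcc] at hy
          rcases hy with hy | hy <;> constructor <;> linarith [hs.1, hs.2, hs'.1, hs'.2]
        rw [abs_mul, abs_neg, abs_of_nonneg (by positivity)]
        have hyb : |y - s| ≤ |s' - s| := Set.abs_sub_left_of_mem_uIcc hy
        calc _ ≤ (j + 2) * (j + 1) / 2 * (C3 * (1 + |b|) ^ j * |y - s|) := by
              gcongr; exact h3 b s y hs hy'
          _ ≤ (j + 2) * (j + 1) / 2 * (C3 * X ^ j * |s' - s|) := by gcongr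
          _ = _ := by ring
    rw [mul_assoc _ |s' - s|, ← sq, sq_abs] at this
    refine le_trans (le_of_eq ?_) this
    congr 1; ring
  have e : hermiteH (j + 2) a s' - hermiteH (j + 2) b s - (j + 2) * hermiteH (j + 1) b s * (a - b) +
        (j + 2) * (j + 1) / 2 * hermiteH j b s * (s' - s) =
      (hermiteH (j + 2) a s' - hermiteH (j + 2) b s' - (j + 2) * hermiteH (j + 1) b s' * (a - b)) +
      (j + 2) * (hermiteH (j + 1) b s' - hermiteH (j + 1) b s) * (a - b) +
      (hermiteH (j + 2) b s' - hermiteH (j + 2) b s +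
        (j + 2) * (j + 1) / 2 * hermiteH j b s * (s' - s)) := by ring
  rw [e]
  refine (abs_add_three _ _ _).trans ((add_le_add (add_le_add t1 t2) t3).trans ?_)
  have u1 : (j + 2) * C1 * 2 ^ j * X ^ j * (a - b) ^ 2 ≤
      (j + 2) * C1 * 2 ^ j * X ^ (j + 2) * ((a - b) ^ 2 + (s' - s) ^ 2) := by
    gcongr
    linarith [sq_nonneg (s' - s)]
  have u3 : (j + 2) * (j + 1) / 2 * C3 * X ^ j * (s' - s) ^ 2 ≤
      (j + 2) * (j + 1) / 2 * C3 * X ^ (j + 2) * ((a - b) ^ 2 + (s' - s) ^ 2) := by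
    gcongr
    linarith [sq_nonneg (a - b)]
  calc _ ≤ (j + 2) * C1 * 2 ^ j * X ^ (j + 2) * ((a - b) ^ 2 + (s' - s) ^ 2) +
      (j + 2) * C2 * X ^ (j + 2) * ((a - b) ^ 2 + (s' - s) ^ 2) +
      (j + 2) * (j + 1) / 2 * C3 * X ^ (j + 2) * ((a - b) ^ 2 + (s' - s) ^ 2) := by linarith
    _ = _ := by ring

theorem hermiteH_sub_pow (σm : ℝ) (k : ℕ) :
    ∃ C : ℝ, 0 ≤ C ∧ ∀ x σ : ℝ, |σ| ≤ σm →
      |hermiteH (k + 1) x σ - x ^ (k + 1)| ≤ C * (1 + |x|) ^ k := by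
  induction k with
  | zero => exact ⟨0, le_rfl, fun x σ _ => by simp [hermiteH]⟩
  | succ k ih =>
    obtain ⟨C1, hC1, h1⟩ := ih
    obtain ⟨C2, hC2, h2⟩ := hermiteH_growth σm k
    refine ⟨C1 + (k + 1) * |σm| * C2, by positivity, fun x σ hσ => ?_⟩
    have hx : (1 : ℝ) ≤ 1 + |x| := by linarith [abs_nonneg x]
    have e : hermiteH (k + 1 + 1) x σ - x ^ (k + 1 + 1) =
        x * (hermiteH (k + 1) x σ - x ^ (k + 1)) - (k + 1) * σ * hermiteH k x σ := by
      rw [hermiteH]; ring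
    calc _ ≤ |x * (hermiteH (k + 1) x σ - x ^ (k + 1))| + |(k + 1) * σ * hermiteH k x σ| := by
          rw [e]; exact abs_sub _ _
      _ = |x| * |hermiteH (k + 1) x σ - x ^ (k + 1)| + (k + 1) * |σ| * |hermiteH k x σ| := by
          rw [abs_mul, abs_mul, abs_mul, abs_of_nonneg (by positivity : (0 : ℝ) ≤ k + 1)]
      _ ≤ (1 + |x|) * (C1 * (1 + |x|) ^ k) + (k + 1) * |σm| * (C2 * (1 + |x|) ^ (k + 1)) := by
          have e1 := h1 x σ hσ
          have e2 : |hermiteH k x σ| ≤ C2 * (1 + |x|) ^ (k + 1) :=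
            (h2 x σ hσ).trans (mul_le_mul_of_nonneg_left (pow_le_pow_right₀ hx (by omega)) hC2)
          have e3 : |σ| ≤ |σm| := hσ.trans (le_abs_self _)
          have e4 : |x| ≤ 1 + |x| := by linarith
          exact add_le_add (mul_le_mul e4 e1 (abs_nonneg _) (by positivity))
            (mul_le_mul (by gcongr) e2 (abs_nonneg _) (by positivity))
      _ = _ := by ring

theorem exists_mul_pow_le (C : ℝ) (k : ℕ) :
    ∃ C' : ℝ, 0 ≤ C' ∧ ∀ x : ℝ, C * (1 + |x|) ^ k ≤ 2⁻¹ * |x| ^ (k + 1) + C' := by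
  set K : ℝ := 2 + |C| * 2 ^ (k + 2) with hK
  have hK2 : 2 ≤ K := by rw [hK]; linarith [(by positivity : 0 ≤ |C| * 2 ^ (k + 2))]
  refine ⟨|C| * K ^ k, by positivity, fun x => ?_⟩
  have hC : C * (1 + |x|) ^ k ≤ |C| * (1 + |x|) ^ k := by gcongr; exact le_abs_self _
  refine hC.trans ?_
  rcases le_or_gt (1 + |x|) K with h | h
  · have : |C| * (1 + |x|) ^ k ≤ |C| * K ^ k := by gcongr
    linarith [(by positivity : 0 ≤ 2⁻¹ * |x| ^ (k + 1))]
  · have h1 : 1 + |x| ≤ 2 * |x| := by linarith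
    have h2 : |C| * 2 ^ (k + 1) ≤ |x| := by
      have : |C| * 2 ^ (k + 2) = 2 * (|C| * 2 ^ (k + 1)) := by ring
      linarith
    have h3 : |C| * (1 + |x|) ^ k ≤ 2⁻¹ * |x| ^ (k + 1) := by
      calc |C| * (1 + |x|) ^ k ≤ |C| * (2 * |x|) ^ k := by gcongr
        _ = 2⁻¹ * (|C| * 2 ^ (k + 1)) * |x| ^ k := by rw [mul_pow]; ring
        _ ≤ 2⁻¹ * |x| * |x| ^ k := by gcongr
        _ = _ := by ring
    linarith [(by positivity : 0 ≤ |C| * K ^ k)]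

/-- The leading monomial has even degree, hence a sign, and half of it absorbs the lower-order
terms. -/
theorem hermiteH_coercive (σm : ℝ) {k : ℕ} (hk : Even (k + 1)) :
    ∃ C : ℝ, 0 ≤ C ∧ ∀ x σ : ℝ, |σ| ≤ σm →
      2⁻¹ * |x| ^ (k + 1) - C ≤ hermiteH (k + 1) x σ := by
  obtain ⟨C1, hC1, h1⟩ := hermiteH_sub_pow σm k
  obtain ⟨C2, hC2, h2⟩ := exists_mul_pow_le C1 k
  refine ⟨C2, hC2, fun x σ hσ => ?_⟩
  have h3 := (abs_le.mp (h1 x σ hσ)).1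
  have h4 := h2 x
  have h5 : |x| ^ (k + 1) = x ^ (k + 1) := hk.pow_abs x
  rw [← h5] at h3
  linarith

theorem hermiteH_three (x σ : ℝ) : hermiteH 3 x σ = x ^ 3 - 3 * σ * x := by
  simp [hermiteH]; ring

theorem hermiteH_zero_variance (k : ℕ) (x : ℝ) : hermiteH k x 0 = x ^ k := by
  induction k using Nat.twoStepInduction with
  | zero => simp [hermiteH]
  | one => simp [hermiteH]
  | more k ih1 ih2 => rw [hermiteH, ih2]; ring

/-- In 3zu² + 3z²u + z³ - 3σ(z + u) the square of every term but the first is controlled by pure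
powers of z and u and by z²u⁴; for z²u one uses z⁴u² ≤ z²u⁴ + z⁶. Only z²u⁴ is dangerous. -/
theorem sq_hermiteH_three_sub_le {z u σ σm : ℝ} (hσ : |σ| ≤ σm) :
    (hermiteH 3 (z + u) σ - u ^ 3) ^ 2 ≤
      (100 + 100 * σm ^ 2) * (z ^ 2 * u ^ 4 + z ^ 6 + 1 + u ^ 4) := by
  have hσ2 : σ ^ 2 ≤ σm ^ 2 := sq_le_sq' (by linarith [abs_le.mp hσ]) (abs_le.mp hσ).2
  have e : hermiteH 3 (z + u) σ - u ^ 3 =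
      3 * (z * u ^ 2) + 3 * (z ^ 2 * u) + z ^ 3 - 3 * σ * z - 3 * σ * u := by
    rw [hermiteH_three]; ring
  have h5 : (3 * (z * u ^ 2) + 3 * (z ^ 2 * u) + z ^ 3 - 3 * σ * z - 3 * σ * u) ^ 2 ≤
      5 * ((3 * (z * u ^ 2)) ^ 2 + (3 * (z ^ 2 * u)) ^ 2 + (z ^ 3) ^ 2 + (3 * σ * z) ^ 2 +
        (3 * σ * u) ^ 2) := by
    generalize 3 * (z * u ^ 2) = a, 3 * (z ^ 2 * u) = b, z ^ 3 = c, 3 * σ * z = d, 3 * σ * u = f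
    nlinarith [sq_nonneg (a - b), sq_nonneg (a - c), sq_nonneg (a + d), sq_nonneg (a + f),
      sq_nonneg (b - c), sq_nonneg (b + d), sq_nonneg (b + f), sq_nonneg (c + d),
      sq_nonneg (c + f), sq_nonneg (d - f)]
  have a1 : (z ^ 2 * u) ^ 2 ≤ z ^ 2 * u ^ 4 + z ^ 6 := by
    nlinarith [mul_nonneg (sq_nonneg z) (sq_nonneg (u ^ 2 - z ^ 2)), sq_nonneg (z ^ 2 * u),
      mul_nonneg (sq_nonneg z) (sq_nonneg (u ^ 2)), mul_nonneg (sq_nonneg z) (sq_nonneg (z ^ 2))]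
  have a2 : z ^ 2 ≤ 1 + z ^ 6 := by
    nlinarith [sq_nonneg (z ^ 2 - 1), sq_nonneg z, sq_nonneg (z * (z ^ 2 - 1)),
      sq_nonneg (z ^ 3), sq_nonneg (z ^ 2)]
  have a3 : u ^ 2 ≤ 1 + u ^ 4 := by nlinarith [sq_nonneg (u ^ 2 - 1), sq_nonneg u]
  have a4 : (σ * z) ^ 2 ≤ σm ^ 2 * (1 + z ^ 6) := by
    rw [mul_pow]; gcongr
  have a5 : (σ * u) ^ 2 ≤ σm ^ 2 * (1 + u ^ 4) := by
    rw [mul_pow]; gcongr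
  have p1 : 0 ≤ z ^ 2 * u ^ 4 := by positivity
  have p2 : 0 ≤ z ^ 6 := by positivity
  have p3 : 0 ≤ u ^ 4 := by positivity
  have q1 : 0 ≤ σm ^ 2 * (z ^ 2 * u ^ 4) := by positivity
  have q2 : 0 ≤ σm ^ 2 * z ^ 6 := by positivity
  have q3 : 0 ≤ σm ^ 2 * u ^ 4 := by positivity
  have q4 : 0 ≤ σm ^ 2 := by positivity
  rw [e]
  refine h5.trans ?_
  nlinarith

theorem continuous_hermiteH (k : ℕ) : Continuous fun p : ℝ × ℝ => hermiteH k p.1 p.2 := by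
  induction k using Nat.twoStepInduction with
  | zero => simpa [hermiteH] using continuous_const
  | one => simpa [hermiteH] using continuous_fst
  | more k ih1 ih2 =>
    simp only [hermiteH]
    fun_prop

end Hermite

/-! ### Semicontinuity of integral functionals -/

section Semicontinuity

variable {α : Type*} [MeasurableSpace α] {μ : Measure α}

/-- Fatou along a subsequence converging almost everywhere. The fields are curves in L² without a
chosen jointly measurable representative in (t, x); semicontinuity gives measurability in t of
integrals over x nevertheless. -/
theorem lowerSemicontinuous_lintegral {θ : ℝ → ℝ → α → ℝ≥0∞}
    (hc : ∀ x, Continuous fun p : ℝ × ℝ => θ p.1 p.2 x)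
    (hm : Measurable fun p : ℝ × ℝ × α => θ p.1 p.2.1 p.2.2) :
    LowerSemicontinuous fun p : Lp ℝ 2 μ × ℝ => ∫⁻ x, θ p.2 (p.1 x) x ∂μ := by
  intro p₀ c hc₀
  by_contra hcon
  rw [not_eventually] at hcon
  obtain ⟨ps, hps, hle⟩ := exists_seq_forall_of_frequently hcon
  have hps1 : Tendsto (fun i => (ps i).1) atTop (𝓝 p₀.1) := (continuous_fst.tendsto p₀).comp hps
  have hps2 : Tendsto (fun i => (ps i).2) atTop (𝓝 p₀.2) := (continuous_snd.tendsto p₀).comp hps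
  obtain ⟨ns, hns, hae⟩ := (tendstoInMeasure_of_tendsto_Lp hps1).exists_seq_tendsto_ae
  have hns2 := hps2.comp hns.tendsto_atTop
  have hmeas : ∀ (s : ℝ) (f : Lp ℝ 2 μ), AEMeasurable (fun x => θ s (f x) x) μ := fun s f =>
    hm.comp_aemeasurable (aemeasurable_const.prodMk
      ((Lp.aestronglyMeasurable f).aemeasurable.prodMk aemeasurable_id))
  have hfatou : ∫⁻ x, θ p₀.2 (p₀.1 x) x ∂μ ≤
      liminf (fun i => ∫⁻ x, θ (ps (ns i)).2 ((ps (ns i)).1 x) x ∂μ) atTop := by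
    refine le_trans (le_of_eq (lintegral_congr_ae ?_))
      (lintegral_liminf_le' (f := fun i x => θ (ps (ns i)).2 ((ps (ns i)).1 x) x)
        fun i => hmeas _ _)
    filter_upwards [hae] with x hx
    exact ((((hc x).tendsto (p₀.2, p₀.1 x)).comp (hns2.prodMk_nhds hx)).liminf_eq).symm
  refine absurd hc₀ (not_lt.mpr (hfatou.trans ?_))
  refine liminf_le_of_le (by isBoundedDefault) fun b hb => ?_
  obtain ⟨i, hi⟩ := hb.exists
  exact hi.trans (not_lt.mp (hle (ns i)))

theorem aemeasurable_lintegral_comp {β : Type*} [MeasurableSpace β] {ν : Measure β}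
    {θ : ℝ → ℝ → α → ℝ≥0∞} (hc : ∀ x, Continuous fun p : ℝ × ℝ => θ p.1 p.2 x)
    (hm : Measurable fun p : ℝ × ℝ × α => θ p.1 p.2.1 p.2.2) {q : β → Lp ℝ 2 μ} {σ : β → ℝ}
    (hq : AEStronglyMeasurable q ν) (hσ : AEStronglyMeasurable σ ν) :
    AEMeasurable (fun t => ∫⁻ x, θ (σ t) (q t x) x ∂μ) ν := by
  borelize (Lp ℝ 2 μ × ℝ)
  exact (lowerSemicontinuous_lintegral hc hm).measurable.comp_aemeasurable
    (hq.prodMk hσ).aemeasurable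

theorem aestronglyMeasurable_integral_comp {β : Type*} [MeasurableSpace β] {ν : Measure β}
    {θ : ℝ → ℝ → α → ℝ} (hc : ∀ x, Continuous fun p : ℝ × ℝ => θ p.1 p.2 x)
    (hm : Measurable fun p : ℝ × ℝ × α => θ p.1 p.2.1 p.2.2) {q : β → Lp ℝ 2 μ} {σ : β → ℝ}
    (hq : AEStronglyMeasurable q ν) (hσ : AEStronglyMeasurable σ ν)
    (hi : ∀ᵐ t ∂ν, Integrable (fun x => θ (σ t) (q t x) x) μ) :
    AEStronglyMeasurable (fun t => ∫ x, θ (σ t) (q t x) x ∂μ) ν := by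
  have h1 := aemeasurable_lintegral_comp (θ := fun s y x => ENNReal.ofReal (θ s y x))
    (fun x => ENNReal.continuous_ofReal.comp (hc x)) hm.ennreal_ofReal hq hσ
  have h2 := aemeasurable_lintegral_comp (θ := fun s y x => ENNReal.ofReal (-θ s y x))
    (fun x => ENNReal.continuous_ofReal.comp (hc x).neg) hm.neg.ennreal_ofReal hq hσ
  refine (h1.ennreal_toReal.sub h2.ennreal_toReal).aestronglyMeasurable.congr ?_
  filter_upwards [hi] with t ht
  exact (integral_eq_lintegral_pos_part_sub_lintegral_neg_part ht).symm

end Semicontinuity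

end

end RenormNLW

namespace RenormNLW

noncomputable section

/-! ### Lebesgue norms on the torus -/

section Norms

/-- The norm of `L^p(𝕋²)` for integer `p`. -/
def tnorm (p : ℕ) (f : Torus → ℝ) : ℝ≥0∞ := eLpNorm f p torusMeasure

theorem tnorm_two (f : Lp ℝ 2 torusMeasure) : tnorm 2 f = ‖f‖ₑ := by
  rw [Lp.enorm_def, tnorm, Nat.cast_ofNat]

theorem tnorm_mono {p q : ℕ} (h : p ≤ q) {f : Torus → ℝ}
    (hf : AEStronglyMeasurable f torusMeasure) : tnorm p f ≤ tnorm q f :=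
  eLpNorm_le_eLpNorm_of_exponent_le (by exact_mod_cast h) hf

theorem tnorm_congr {p : ℕ} {f g : Torus → ℝ} (h : f =ᵐ[torusMeasure] g) : tnorm p f = tnorm p g :=
  eLpNorm_congr_ae h

theorem tnorm_mono_fun {p : ℕ} {f g : Torus → ℝ} (h : ∀ᵐ x ∂torusMeasure, |f x| ≤ g x) :
    tnorm p f ≤ tnorm p g := eLpNorm_mono_ae_real h

theorem tnorm_add_le {p : ℕ} (hp : 1 ≤ p) {f g : Torus → ℝ}
    (hf : AEStronglyMeasurable f torusMeasure) (hg : AEStronglyMeasurable g torusMeasure) :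
    tnorm p (fun x => f x + g x) ≤ tnorm p f + tnorm p g :=
  eLpNorm_add_le hf hg (by exact_mod_cast hp)

theorem tnorm_const_mul {p : ℕ} (c : ℝ≥0) (f : Torus → ℝ) :
    tnorm p (fun x => (c : ℝ) * f x) = c * tnorm p f := by
  have := eLpNorm_const_smul (c : ℝ) f (p : ℝ≥0∞) torusMeasure
  have h2 : ‖(c : ℝ)‖ₑ = c := by simp
  rw [h2] at this
  exact this

theorem tnorm_abs {p : ℕ} (f : Torus → ℝ) : tnorm p (fun x => |f x|) = tnorm p f :=
  eLpNorm_norm f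

theorem tnorm_pow {p : ℕ} (j : ℕ) {f : Torus → ℝ} (hf : ∀ x, 0 ≤ f x) :
    tnorm p (fun x => f x ^ j) ≤ tnorm (p * j) f ^ j := by
  rcases Nat.eq_zero_or_pos j with rfl | hj
  · rcases Nat.eq_zero_or_pos p with rfl | hp
    · simp [tnorm]
    · simp only [pow_zero, tnorm]
      rw [eLpNorm_const _ (by simpa using hp.ne') (IsProbabilityMeasure.ne_zero _)]
      simp
  · have h := eLpNorm_norm_rpow (p := (p : ℝ≥0∞)) (μ := torusMeasure) f (q := j)
      (by exact_mod_cast hj)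
    simp only [Real.rpow_natCast, ENNReal.rpow_natCast, ENNReal.ofReal_natCast] at h
    rw [tnorm, tnorm, Nat.cast_mul, ← h]
    refine le_of_eq (eLpNorm_congr_ae (Eventually.of_forall fun x => ?_))
    simp [abs_of_nonneg (hf x)]

theorem tnorm_one_le (p : ℕ) : tnorm p (fun _ => 1) ≤ 1 := by
  rcases Nat.eq_zero_or_pos p with rfl | hp
  · simp [tnorm]
  · rw [tnorm, eLpNorm_const _ (by simpa using hp.ne') (IsProbabilityMeasure.ne_zero _)]
    simp

theorem tnorm_weight_le {p : ℕ} (hp : 1 ≤ p) (j : ℕ) {f g : Torus → ℝ}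
    (hf : AEStronglyMeasurable f torusMeasure) (hg : AEStronglyMeasurable g torusMeasure) :
    tnorm p (fun x => (1 + |f x| + |g x|) ^ j) ≤ (1 + tnorm (p * j) f + tnorm (p * j) g) ^ j := by
  refine (tnorm_pow j fun x => by positivity).trans ?_
  rcases Nat.eq_zero_or_pos j with rfl | hj
  · simp
  have hpj : 1 ≤ p * j := Nat.mul_pos hp hj
  gcongr
  refine (tnorm_add_le hpj (aestronglyMeasurable_const.add hf.norm) hg.norm).trans ?_
  have h2 := tnorm_add_le hpj (aestronglyMeasurable_const (b := (1 : ℝ))) hf.norm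
  refine add_le_add (h2.trans (add_le_add (tnorm_one_le _) (tnorm_abs f).le)) (tnorm_abs g).le

theorem holderTriple_four : ENNReal.HolderTriple (4 : ℝ≥0∞) 4 2 := by
  refine ⟨?_⟩
  have h : (4 : ℝ≥0∞) = 2 * 2 := by norm_num
  rw [h, ENNReal.mul_inv (by simp) (by simp), ← add_mul, ENNReal.inv_two_add_inv_two, one_mul]

theorem tnorm_two_mul_le {f g : Torus → ℝ} (hf : AEStronglyMeasurable f torusMeasure)
    (hg : AEStronglyMeasurable g torusMeasure) :
    tnorm 2 (fun x => f x * g x) ≤ tnorm 4 f * tnorm 4 g := by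
  have := holderTriple_four
  have h := eLpNorm_le_eLpNorm_mul_eLpNorm_of_nnnorm (p := 4) (q := 4) (r := 2) hf hg
    (fun a b => a * b) 1 (Eventually.of_forall fun x => by simp)
  simp only [tnorm, Nat.cast_ofNat]
  simpa only [ENNReal.coe_one, one_mul] using h

theorem lintegral_mul_le_tnorm {f g : Torus → ℝ} (hf : AEStronglyMeasurable f torusMeasure)
    (hg : AEStronglyMeasurable g torusMeasure) :
    ∫⁻ x, ‖f x * g x‖ₑ ∂torusMeasure ≤ tnorm 2 f * tnorm 2 g := by
  have h := eLpNorm_le_eLpNorm_mul_eLpNorm_of_nnnorm (p := 2) (q := 2) (r := 1) hf hg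
    (fun a b => a * b) 1 (Eventually.of_forall fun x => by simp)
  rw [← eLpNorm_one_eq_lintegral_enorm]
  simp only [tnorm, Nat.cast_ofNat]
  simpa only [ENNReal.coe_one, one_mul] using h

theorem tnorm_pow_eq_lintegral {p : ℕ} (hp : p ≠ 0) (f : Torus → ℝ) :
    tnorm p f ^ p = ∫⁻ x, ‖f x‖ₑ ^ p ∂torusMeasure := by
  have := eLpNorm_nnreal_pow_eq_lintegral (μ := torusMeasure) (f := f) (p := (p : ℝ≥0))
    (by exact_mod_cast hp)
  simpa [tnorm] using this

theorem aestronglyMeasurable_hermiteH (k : ℕ) (s : ℝ) {f : Torus → ℝ}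
    (hf : AEStronglyMeasurable f torusMeasure) :
    AEStronglyMeasurable (fun x => hermiteH k (f x) s) torusMeasure :=
  (((continuous_hermiteH k).comp (continuous_id.prodMk
    continuous_const)).comp_aestronglyMeasurable hf)

theorem tnorm_hermiteH_le (σm : ℝ) (k : ℕ) : ∃ C : ℝ≥0, ∀ (p : ℕ), 1 ≤ p → ∀ (f : Torus → ℝ) (s : ℝ),
    AEStronglyMeasurable f torusMeasure → |s| ≤ σm →
    tnorm p (fun x => hermiteH k (f x) s) ≤ C * (1 + tnorm (p * k) f) ^ k := by
  obtain ⟨C, hC, h⟩ := hermiteH_growth σm k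
  lift C to ℝ≥0 using hC
  refine ⟨C, fun p hp f s hf hs => ?_⟩
  have h1 : tnorm p (fun x => hermiteH k (f x) s) ≤
      tnorm p (fun x => C * (1 + |f x| + |(0 : ℝ)|) ^ k) :=
    tnorm_mono_fun (Eventually.of_forall fun x => by simpa using h (f x) s hs)
  refine h1.trans ?_
  rw [tnorm_const_mul C]
  gcongr
  refine (tnorm_weight_le hp k hf aestronglyMeasurable_const).trans (le_of_eq ?_)
  simp [tnorm]

theorem tnorm_hermiteH_sub_le (σm : ℝ) (k : ℕ) : ∃ C : ℝ≥0, ∀ (f g : Torus → ℝ) (s : ℝ),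
    AEStronglyMeasurable f torusMeasure → AEStronglyMeasurable g torusMeasure → |s| ≤ σm →
    tnorm 2 (fun x => hermiteH (k + 1) (f x) s - hermiteH (k + 1) (g x) s) ≤
      C * tnorm 4 (fun x => f x - g x) * (1 + tnorm (4 * k) f + tnorm (4 * k) g) ^ k := by
  obtain ⟨C, hC, h⟩ := hermiteH_lipschitz σm k
  lift C to ℝ≥0 using hC
  refine ⟨C, fun f g s hf hg hs => ?_⟩
  have h1 : tnorm 2 (fun x => hermiteH (k + 1) (f x) s - hermiteH (k + 1) (g x) s) ≤
      tnorm 2 (fun x => C * (|f x - g x| * (1 + |f x| + |g x|) ^ k)) :=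
    tnorm_mono_fun (Eventually.of_forall fun x => by
      refine (h (f x) (g x) s hs).trans (le_of_eq (by ring)))
  refine h1.trans ?_
  rw [tnorm_const_mul C (fun x => |f x - g x| * (1 + |f x| + |g x|) ^ k), mul_assoc]
  gcongr
  have hw : AEStronglyMeasurable (fun x => (1 + |f x| + |g x|) ^ k) torusMeasure :=
    ((aestronglyMeasurable_const.add hf.norm).add hg.norm).pow k
  refine (tnorm_two_mul_le (hf.sub hg).norm hw).trans ?_
  gcongr
  · exact (tnorm_abs _).le
  · exact tnorm_weight_le (by norm_num) k hf hg

end Norms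

/-! ### The interaction picture -/

section Interaction

theorem abs_cos_bracket_le (t : ℝ) (n : Freq) : |Real.cos (t * bracket n)| ≤ 1 :=
  Real.abs_cos_le_one _

theorem abs_sin_bracket_le (t : ℝ) (n : Freq) : |Real.sin (t * bracket n)| ≤ 1 :=
  Real.abs_sin_le_one _

theorem abs_bracket_inv_le (n : Freq) : |(bracket n)⁻¹| ≤ 1 := by
  rw [abs_of_pos (inv_pos.mpr (bracket_pos n))]
  exact inv_le_one_of_one_le₀ (one_le_bracket n)

/-- The pairs of square-summable families. -/
abbrev State : Type := Ell2 × Ell2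

/-- The operator `cos(t⟨∇⟩)`. -/
def cosOp (t : ℝ) : Ell2 →L[ℝ] Ell2 := diag _ (abs_cos_bracket_le t)

/-- The operator `sin(t⟨∇⟩)`. -/
def sinOp (t : ℝ) : Ell2 →L[ℝ] Ell2 := diag _ (abs_sin_bracket_le t)

/-- The operator `⟨∇⟩⁻¹`. -/
def invOp : Ell2 →L[ℝ] Ell2 := diag _ abs_bracket_inv_le

/-- `⟨∇⟩u(t)`, in terms of the state in the interaction picture. -/
def rot (t : ℝ) : State →L[ℝ] Ell2 :=
  (cosOp t).comp (ContinuousLinearMap.fst ℝ Ell2 Ell2) +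
    (sinOp t).comp (ContinuousLinearMap.snd ℝ Ell2 Ell2)

/-- `∂ₜu(t)`, in terms of the state in the interaction picture. -/
def vel (t : ℝ) : State →L[ℝ] Ell2 :=
  (cosOp t).comp (ContinuousLinearMap.snd ℝ Ell2 Ell2) -
    (sinOp t).comp (ContinuousLinearMap.fst ℝ Ell2 Ell2)

/-- `u(t)`, in terms of the state in the interaction picture. -/
def pos (t : ℝ) : State →L[ℝ] Ell2 := invOp.comp (rot t)

/-- The effect of a force on the state in the interaction picture. -/
def kick (t : ℝ) : Ell2 →L[ℝ] State := (sinOp t).prod (-cosOp t)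

theorem rot_apply (t : ℝ) (y : State) (n : Freq) :
    rot t y n = Real.cos (t * bracket n) * y.1 n + Real.sin (t * bracket n) * y.2 n := rfl

theorem vel_apply (t : ℝ) (y : State) (n : Freq) :
    vel t y n = Real.cos (t * bracket n) * y.2 n - Real.sin (t * bracket n) * y.1 n := rfl

theorem pos_apply (t : ℝ) (y : State) (n : Freq) :
    pos t y n = ((bracket n)⁻¹ : ℝ) * rot t y n := rfl

theorem kick_fst_apply (t : ℝ) (a : Ell2) (n : Freq) :
    (kick t a).1 n = Real.sin (t * bracket n) * a n := rfl

theorem kick_snd_apply (t : ℝ) (a : Ell2) (n : Freq) :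
    (kick t a).2 n = -(Real.cos (t * bracket n) * a n) := rfl

theorem norm_rot_le (t : ℝ) (y : State) : ‖rot t y‖ ≤ 2 * ‖y‖ := by
  refine (norm_add_le _ _).trans ?_
  have h1 := (norm_diag_le _ (abs_cos_bracket_le t) y.1).trans (norm_fst_le y)
  have h2 := (norm_diag_le _ (abs_sin_bracket_le t) y.2).trans (norm_snd_le y)
  change ‖cosOp t y.1‖ + ‖sinOp t y.2‖ ≤ _
  exact (add_le_add h1 h2).trans (by linarith)

/-- Mode by mode the passage from the interaction picture is a rotation, so the quadratic energy is
the Euclidean norm of the state. -/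
theorem norm_vel_sq_add_norm_rot_sq (t : ℝ) (y : State) :
    ‖vel t y‖ ^ 2 + ‖rot t y‖ ^ 2 = ‖y.1‖ ^ 2 + ‖y.2‖ ^ 2 := by
  refine ((hasSum_norm_sq _).add (hasSum_norm_sq _)).unique ?_
  refine ((hasSum_norm_sq y.1).add (hasSum_norm_sq y.2)).congr_fun fun n => ?_
  rw [vel_apply, rot_apply]
  simp only [← Complex.normSq_eq_norm_sq, Complex.normSq_apply, Complex.sub_re, Complex.sub_im,
    Complex.add_re, Complex.add_im, Complex.re_ofReal_mul, Complex.im_ofReal_mul]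
  have := Real.cos_sq_add_sin_sq (t * bracket n)
  linear_combination ((y.1 n).re ^ 2 + (y.1 n).im ^ 2 + (y.2 n).re ^ 2 + (y.2 n).im ^ 2) * this

theorem norm_kick_le (t : ℝ) (a : Ell2) : ‖kick t a‖ ≤ ‖a‖ := by
  refine max_le (norm_diag_le _ (abs_sin_bracket_le t) a) ?_
  change ‖-cosOp t a‖ ≤ _
  rw [norm_neg]
  exact norm_diag_le _ (abs_cos_bracket_le t) a

theorem continuous_cosOp {a : ℝ → Ell2} (ha : Continuous a) : Continuous fun t => cosOp t (a t) :=
  continuous_diag abs_cos_bracket_le (fun n => by fun_prop) ha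

theorem continuous_sinOp {a : ℝ → Ell2} (ha : Continuous a) : Continuous fun t => sinOp t (a t) :=
  continuous_diag abs_sin_bracket_le (fun n => by fun_prop) ha

theorem continuous_rot {Y : ℝ → State} (hY : Continuous Y) : Continuous fun t => rot t (Y t) :=
  (continuous_cosOp hY.fst).add (continuous_sinOp hY.snd)

theorem continuous_vel {Y : ℝ → State} (hY : Continuous Y) : Continuous fun t => vel t (Y t) :=
  (continuous_cosOp hY.snd).sub (continuous_sinOp hY.fst)

theorem continuous_pos {Y : ℝ → State} (hY : Continuous Y) : Continuous fun t => pos t (Y t) :=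
  invOp.continuous.comp (continuous_rot hY)

theorem aestronglyMeasurable_coord {α : Type*} [MeasurableSpace α] {μ : Measure α} {a : α → Ell2}
    (ha : AEStronglyMeasurable a μ) (n : Freq) : AEStronglyMeasurable (fun t => a t n) μ :=
  (lp.evalCLM ℂ (fun _ : Freq => ℂ) 2 n).continuous.comp_aestronglyMeasurable ha

theorem aestronglyMeasurable_pos {Y : ℝ → State} (hY : StronglyMeasurable Y) :
    AEStronglyMeasurable fun t => pos t (Y t) := by
  refine aestronglyMeasurable_ell2 fun n => ?_
  simp only [pos_apply, rot_apply]
  have h1 := aestronglyMeasurable_coord (μ := volume)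
    (continuous_fst.comp_stronglyMeasurable hY).aestronglyMeasurable n
  have h2 := aestronglyMeasurable_coord (μ := volume)
    (continuous_snd.comp_stronglyMeasurable hY).aestronglyMeasurable n
  have hc : Continuous fun t : ℝ => (Real.cos (t * bracket n) : ℂ) := by fun_prop
  have hs : Continuous fun t : ℝ => (Real.sin (t * bracket n) : ℂ) := by fun_prop
  exact aestronglyMeasurable_const.mul
    ((hc.aestronglyMeasurable.mul h1).add (hs.aestronglyMeasurable.mul h2))

theorem aestronglyMeasurable_kick {a : ℝ → Ell2} (ha : AEStronglyMeasurable a) :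
    AEStronglyMeasurable fun t => kick t (a t) := by
  have h := aestronglyMeasurable_coord ha
  have hc : ∀ n, Continuous fun t : ℝ => (Real.cos (t * bracket n) : ℂ) := fun n => by fun_prop
  have hs : ∀ n, Continuous fun t : ℝ => (Real.sin (t * bracket n) : ℂ) := fun n => by fun_prop
  exact (aestronglyMeasurable_ell2 fun n => (hs n).aestronglyMeasurable.mul (h n)).prodMk
    (aestronglyMeasurable_ell2 fun n => ((hc n).aestronglyMeasurable.mul (h n)).neg)

/-- The Sobolev embedding `H¹ ⊂ L^q`. -/
theorem tnorm_synth_invOp_le (q : ℕ) :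
    ∃ C : ℝ≥0, ∀ a : Ell2, tnorm q (synth (invOp a)) ≤ C * ‖a‖ₑ := by
  -- Any exponent above 2 and at least q would do. The surplus smoothing ⟨n⟩^{-2/p} is discarded
  -- below.
  obtain ⟨C, hC⟩ := sobolev_embedding (p := (q + 3 : ℕ)) (by push_cast; linarith [(Nat.cast_nonneg q : (0:ℝ) ≤ q)])
  refine ⟨C, fun a => ?_⟩
  set p : ℝ := ((q + 3 : ℕ) : ℝ) with hp
  have hp3 : 3 ≤ p := by rw [hp]; push_cast; linarith [(Nat.cast_nonneg q : (0:ℝ) ≤ q)]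
  have h2p : 0 < 2 / p := by positivity
  have h2p1 : 2 / p < 1 := by rw [div_lt_one (by linarith)]; linarith
  have hm1 := abs_bracket_rpow_neg_le (s := 1 - 2 / p) (by linarith)
  have hm2 := abs_bracket_rpow_neg_le h2p.le
  have e : invOp a = diag (fun n => bracket n ^ (-(1 - 2 / p))) hm1
      (diag (fun n => bracket n ^ (-(2 / p))) hm2 a) := by
    ext n
    rw [diag_apply, diag_apply, ← mul_assoc, ← Complex.ofReal_mul,
      ← Real.rpow_add (bracket_pos n), show -(1 - 2 / p) + -(2 / p) = -1 by ring, Real.rpow_neg_one]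
    rfl
  have h1 : tnorm q (synth (invOp a)) ≤ eLpNorm (synthC (invOp a)) q torusMeasure := by
    refine eLpNorm_mono_ae ?_
    filter_upwards [synth_ae (invOp a)] with x hx
    rw [hx]
    exact Complex.abs_re_le_norm _
  refine h1.trans ((eLpNorm_le_eLpNorm_of_exponent_le (q := ENNReal.ofReal p) ?_
    (Lp.aestronglyMeasurable _)).trans ?_)
  · rw [hp, ENNReal.ofReal_natCast]
    exact_mod_cast (by omega : q ≤ q + 3)
  · rw [e]
    refine (hC hm1 _).trans ?_
    gcongr
    rw [← ofReal_norm, ← ofReal_norm]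
    exact ENNReal.ofReal_le_ofReal (norm_diag_le _ _ _)

theorem tnorm_synth_pos_le (q : ℕ) :
    ∃ C : ℝ≥0, ∀ (t : ℝ) (y : State), tnorm q (synth (pos t y)) ≤ C * ‖y‖ₑ := by
  obtain ⟨C, hC⟩ := tnorm_synth_invOp_le q
  refine ⟨C * 2, fun t y => (hC (rot t y)).trans ?_⟩
  rw [ENNReal.coe_mul, mul_assoc]
  gcongr
  rw [← ofReal_norm, ← ofReal_norm, show ((2 : ℝ≥0) : ℝ≥0∞) = ENNReal.ofReal 2 by simp,
    ← ENNReal.ofReal_mul (by norm_num)]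
  exact ENNReal.ofReal_le_ofReal (norm_rot_le t y)

end Interaction

end

end RenormNLW

namespace RenormNLW

noncomputable section

/-! ### The force and the vector field -/

section Force

open Classical in
/-- The function `H_k(q; s)`, as an element of `L²(𝕋²)` (zero if it is not in `L²`). -/
def force (k : ℕ) (s : ℝ) (q : Lp ℝ 2 torusMeasure) : Lp ℝ 2 torusMeasure :=
  if h : MemLp (fun x => hermiteH k (q x) s) 2 torusMeasure then h.toLp else 0

theorem aestronglyMeasurable_lp (q : Lp ℝ 2 torusMeasure) :
    AEStronglyMeasurable q torusMeasure := Lp.aestronglyMeasurable q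

theorem memLp_hermiteH {k : ℕ} (s : ℝ) {f : Torus → ℝ} (hf : AEStronglyMeasurable f torusMeasure)
    (hfin : tnorm (4 * k) f ≠ ∞) : MemLp (fun x => hermiteH k (f x) s) 2 torusMeasure := by
  obtain ⟨C, hC⟩ := tnorm_hermiteH_le |s| k
  refine ⟨aestronglyMeasurable_hermiteH k s hf, ?_⟩
  have h := hC 2 (by norm_num) f s hf le_rfl
  rw [tnorm, Nat.cast_ofNat] at h
  refine h.trans_lt (ENNReal.mul_lt_top (by simp) (ENNReal.pow_lt_top (ENNReal.add_lt_top.mpr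
    ⟨by simp, lt_of_le_of_lt (tnorm_mono (by omega) hf) hfin.lt_top⟩)))

theorem force_ae {k : ℕ} {s : ℝ} {q : Lp ℝ 2 torusMeasure}
    (h : MemLp (fun x => hermiteH k (q x) s) 2 torusMeasure) :
    force k s q =ᵐ[torusMeasure] fun x => hermiteH k (q x) s := by
  rw [force, dif_pos h]
  exact h.coeFn_toLp

theorem enorm_force_le (σm : ℝ) (k : ℕ) : ∃ C : ℝ≥0, ∀ (s : ℝ) (q : Lp ℝ 2 torusMeasure),
    |s| ≤ σm → ‖force k s q‖ₑ ≤ C * (1 + tnorm (4 * k) q) ^ k := by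
  obtain ⟨C, hC⟩ := tnorm_hermiteH_le σm k
  refine ⟨C, fun s q hs => ?_⟩
  by_cases h : MemLp (fun x => hermiteH k (q x) s) 2 torusMeasure
  · rw [← tnorm_two, tnorm_congr (force_ae h)]
    refine (hC 2 (by norm_num) q s (aestronglyMeasurable_lp q) hs).trans ?_
    gcongr
    exact tnorm_mono (by omega) (aestronglyMeasurable_lp q)
  · rw [force, dif_neg h]
    simp

/-- Hölder L⁴·L⁴ ⊂ L² would need only L^{4j} in the weight; L^{4(j+1)} is used throughout so that
one norm of the field serves both growth and Lipschitz bounds. -/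
theorem enorm_force_sub_le (σm : ℝ) (j : ℕ) : ∃ C : ℝ≥0, ∀ (s : ℝ) (q q' : Lp ℝ 2 torusMeasure),
    |s| ≤ σm → tnorm (4 * (j + 1)) q ≠ ∞ → tnorm (4 * (j + 1)) q' ≠ ∞ →
    ‖force (j + 1) s q - force (j + 1) s q'‖ₑ ≤ C * tnorm 4 (q - q' : Lp ℝ 2 torusMeasure) *
      (1 + tnorm (4 * (j + 1)) q + tnorm (4 * (j + 1)) q') ^ j := by
  obtain ⟨C, hC⟩ := tnorm_hermiteH_sub_le σm j
  refine ⟨C, fun s q q' hs hq hq' => ?_⟩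
  have h1 := force_ae (memLp_hermiteH s (aestronglyMeasurable_lp q) hq)
  have h2 := force_ae (memLp_hermiteH s (aestronglyMeasurable_lp q') hq')
  have e : (force (j + 1) s q - force (j + 1) s q' : Lp ℝ 2 torusMeasure) =ᵐ[torusMeasure]
      fun x => hermiteH (j + 1) (q x) s - hermiteH (j + 1) (q' x) s := by
    filter_upwards [Lp.coeFn_sub (force (j + 1) s q) (force (j + 1) s q'), h1, h2] with x hx hx1 hx2
    rw [hx, Pi.sub_apply, hx1, hx2]
  rw [← tnorm_two, tnorm_congr e]
  refine (hC q q' s (aestronglyMeasurable_lp q) (aestronglyMeasurable_lp q') hs).trans ?_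
  have e2 : tnorm 4 (fun x => q x - q' x) = tnorm 4 (q - q' : Lp ℝ 2 torusMeasure) :=
    tnorm_congr (Lp.coeFn_sub q q').symm
  rw [e2]
  gcongr
  · exact tnorm_mono (by omega) (aestronglyMeasurable_lp q)
  · exact tnorm_mono (by omega) (aestronglyMeasurable_lp q')

theorem enorm_force_variance_sub_le (σm : ℝ) (k : ℕ) : ∃ C : ℝ≥0,
    ∀ (s s' : ℝ) (q : Lp ℝ 2 torusMeasure), |s| ≤ σm → |s'| ≤ σm → tnorm (4 * k) q ≠ ∞ →
    ‖force k s' q - force k s q‖ₑ ≤ C * ‖s' - s‖ₑ * (1 + tnorm (4 * k) q) ^ k := by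
  obtain ⟨C, hC0, hC⟩ := hermiteH_lipschitz_variance σm k
  lift C to ℝ≥0 using hC0
  refine ⟨C, fun s s' q hs hs' hq => ?_⟩
  have h1 := force_ae (memLp_hermiteH s (aestronglyMeasurable_lp q) hq)
  have h2 := force_ae (memLp_hermiteH s' (aestronglyMeasurable_lp q) hq)
  have e : ∀ᵐ x ∂torusMeasure, |(force k s' q - force k s q : Lp ℝ 2 torusMeasure) x| ≤
      ((C * ‖s' - s‖₊ : ℝ≥0) : ℝ) * (1 + |q x| + |(0 : ℝ)|) ^ k := by
    filter_upwards [Lp.coeFn_sub (force k s' q) (force k s q), h1, h2] with x hx hx1 hx2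
    rw [hx, Pi.sub_apply, hx1, hx2]
    refine (hC (q x) s s' hs hs').trans (le_of_eq ?_)
    push_cast
    rw [Real.norm_eq_abs, abs_zero]
    ring
  rw [← tnorm_two]
  refine (tnorm_mono_fun e).trans ?_
  rw [tnorm_const_mul _ (fun x => (1 + |q x| + |(0 : ℝ)|) ^ k), ENNReal.coe_mul]
  refine mul_le_mul_right ((tnorm_weight_le (by norm_num) k (aestronglyMeasurable_lp q)
    aestronglyMeasurable_const).trans (pow_le_pow_left' ?_ k)) _
  refine (add_le_add (add_le_add le_rfl (tnorm_mono (by omega : 2 * k ≤ 4 * k)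
    (aestronglyMeasurable_lp q))) le_rfl).trans (le_of_eq ?_)
  simp [tnorm]

/-- The vector field of the equation in the interaction picture. -/
def vfield (k : ℕ) (s : ℝ) (q : Lp ℝ 2 torusMeasure) (t : ℝ) (y : State) : State :=
  kick t (analysis (force k s (q + synth (pos t y))))

theorem tnorm_add_synth_pos_le (p : ℕ) (hp : 1 ≤ p) : ∃ C : ℝ≥0, ∀ (q : Lp ℝ 2 torusMeasure) (t : ℝ) (y : State),
    tnorm p (q + synth (pos t y) : Lp ℝ 2 torusMeasure) ≤ tnorm p q + C * ‖y‖ₑ := by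
  obtain ⟨C, hC⟩ := tnorm_synth_pos_le p
  refine ⟨C, fun q t y => ?_⟩
  rw [tnorm_congr (Lp.coeFn_add q (synth (pos t y)))]
  exact (tnorm_add_le hp (aestronglyMeasurable_lp _) (aestronglyMeasurable_lp _)).trans
    (add_le_add le_rfl (hC t y))

theorem norm_vfield_le (σm : ℝ) (k : ℕ) (hk : 1 ≤ k) : ∃ A : ℝ≥0, ∀ (s : ℝ) (q : Lp ℝ 2 torusMeasure)
    (t : ℝ) (y : State), |s| ≤ σm → tnorm (4 * k) q ≠ ∞ →
    ‖vfield k s q t y‖ ≤ A * (1 + (tnorm (4 * k) q).toReal + ‖y‖) ^ k := by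
  obtain ⟨C, hC⟩ := enorm_force_le σm k
  obtain ⟨B, hB⟩ := tnorm_add_synth_pos_le (4 * k) (by omega)
  refine ⟨C * (1 + B) ^ k, fun s q t y hs hq => ?_⟩
  refine (norm_kick_le _ _).trans ?_
  rw [norm_analysis]
  have h := (hC s (q + synth (pos t y)) hs).trans (mul_le_mul_right (pow_le_pow_left' (add_le_add
    le_rfl (hB q t y)) k) _)
  lift tnorm (4 * k) q to ℝ≥0 using hq with τ
  rw [enorm_eq_nnnorm, enorm_eq_nnnorm] at h
  have h' : ‖force k s (q + synth (pos t y))‖₊ ≤ C * (1 + (τ + B * ‖y‖₊)) ^ k := by exact_mod_cast h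
  have h2 : (‖force k s (q + synth (pos t y))‖₊ : ℝ≥0) ≤ C * (1 + B) ^ k * (1 + τ + ‖y‖₊) ^ k := by
    refine h'.trans ?_
    rw [mul_assoc, ← mul_pow]
    gcongr
    calc 1 + (τ + B * ‖y‖₊) ≤ 1 + (τ + B * ‖y‖₊) + (‖y‖₊ + B * (1 + τ)) := le_self_add
      _ = (1 + B) * (1 + τ + ‖y‖₊) := by ring
  exact_mod_cast h2

/-- Lipschitz on balls: the difference sits in L⁴ and the polynomial weight in L⁴, both controlled
by H¹. The field z enters only through its own Lebesgue norm, so it need not be in H¹. -/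
theorem norm_vfield_sub_le (σm : ℝ) (j : ℕ) : ∃ A : ℝ≥0, ∀ (s : ℝ) (q : Lp ℝ 2 torusMeasure)
    (t : ℝ) (y y' : State), |s| ≤ σm → tnorm (4 * (j + 1)) q ≠ ∞ →
    ‖vfield (j + 1) s q t y - vfield (j + 1) s q t y'‖ ≤
      A * (1 + (tnorm (4 * (j + 1)) q).toReal + ‖y‖ + ‖y'‖) ^ j * ‖y - y'‖ := by
  obtain ⟨C, hC⟩ := enorm_force_sub_le σm j
  obtain ⟨B, hB⟩ := tnorm_add_synth_pos_le (4 * (j + 1)) (by omega)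
  obtain ⟨D, hD⟩ := tnorm_synth_pos_le 4
  refine ⟨C * D * (2 + B) ^ j, fun s q t y y' hs hq => ?_⟩
  rw [vfield, vfield, ← map_sub, ← map_sub]
  refine (norm_kick_le _ _).trans ?_
  rw [norm_analysis]
  have hfin : ∀ y, tnorm (4 * (j + 1)) (q + synth (pos t y) : Lp ℝ 2 torusMeasure) ≠ ∞ := fun y =>
    ((hB q t y).trans_lt (ENNReal.add_lt_top.mpr ⟨hq.lt_top, ENNReal.mul_lt_top (by simp)
      (by simp)⟩)).ne
  have h := hC s (q + synth (pos t y)) (q + synth (pos t y')) hs (hfin y) (hfin y')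
  rw [add_sub_add_left_eq_sub, ← map_sub, ← map_sub] at h
  replace h := h.trans (mul_le_mul' (mul_le_mul_right (hD t (y - y')) _)
    (pow_le_pow_left' (add_le_add (add_le_add le_rfl (hB q t y)) (hB q t y')) j))
  clear hfin hC hB hD
  lift tnorm (4 * (j + 1)) q to ℝ≥0 using hq with τ
  simp only [enorm_eq_nnnorm] at h
  have h' : ‖force (j + 1) s (q + synth (pos t y)) - force (j + 1) s (q + synth (pos t y'))‖₊ ≤
    C * (D * ‖y - y'‖₊) * (1 + (τ + B * ‖y‖₊) + (τ + B * ‖y'‖₊)) ^ j := by exact_mod_cast h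
  have h2 : ‖force (j + 1) s (q + synth (pos t y)) - force (j + 1) s (q + synth (pos t y'))‖₊ ≤
      C * D * (2 + B) ^ j * (1 + τ + ‖y‖₊ + ‖y'‖₊) ^ j * ‖y - y'‖₊ := by
    refine h'.trans ?_
    calc _ = C * D * ‖y - y'‖₊ * (1 + (τ + B * ‖y‖₊) + (τ + B * ‖y'‖₊)) ^ j := by ring
      _ ≤ C * D * ‖y - y'‖₊ * ((2 + B) * (1 + τ + ‖y‖₊ + ‖y'‖₊)) ^ j := by
        gcongr
        calc 1 + (τ + B * ‖y‖₊) + (τ + B * ‖y'‖₊) ≤ 1 + (τ + B * ‖y‖₊) + (τ + B * ‖y'‖₊) +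
              (1 + B + B * τ + 2 * ‖y‖₊ + 2 * ‖y'‖₊) := le_self_add
          _ = (2 + B) * (1 + τ + ‖y‖₊ + ‖y'‖₊) := by ring
      _ = _ := by rw [mul_pow]; ring
  exact_mod_cast h2

/-- Integration against `e_{-n}`, in terms of real integrals. -/
theorem analysis_force_apply {k : ℕ} {s : ℝ} {q : Lp ℝ 2 torusMeasure}
    (h : MemLp (fun x => hermiteH k (q x) s) 2 torusMeasure) (n : Freq) :
    analysis (force k s q) n = coeff (fun x => hermiteH k (q x) s) n := by
  rw [coeff_eq h, force, dif_pos h]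

/-- The real and imaginary parts of a coefficient are integrals of continuous functions of (σ,
q(x)), to which the semicontinuity argument applies; joint measurability in (t, x) is not needed. -/
theorem aestronglyMeasurable_coeff_hermiteH {β : Type*} [MeasurableSpace β] {ν : Measure β} (k : ℕ)
    {q : β → Lp ℝ 2 torusMeasure} {σ : β → ℝ}
    (hq : AEStronglyMeasurable q ν) (hσ : AEStronglyMeasurable σ ν)
    (hi : ∀ᵐ t ∂ν, Integrable (fun x => hermiteH k (q t x) (σ t)) torusMeasure) (n : Freq) :
    AEStronglyMeasurable (fun t => coeff (fun x => hermiteH k (q t x) (σ t)) n) ν := by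
  have hcont : Continuous fun x : Torus => UnitAddTorus.mFourier (-n) x :=
    (UnitAddTorus.mFourier (-n)).continuous
  have key : ∀ L : ℂ →L[ℝ] ℝ, AEStronglyMeasurable (fun t => ∫ x, L (UnitAddTorus.mFourier (-n) x) *
      hermiteH k (q t x) (σ t) ∂torusMeasure) ν := fun L => by
    refine aestronglyMeasurable_integral_comp
      (θ := fun s y x => L (UnitAddTorus.mFourier (-n) x) * hermiteH k y s) (fun x => ?_) ?_ hq hσ ?_
    · exact continuous_const.mul ((continuous_hermiteH k).comp continuous_swap)
    · refine ((L.continuous.comp hcont).measurable.comp (measurable_snd.comp measurable_snd)).mul ?_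
      exact (continuous_hermiteH k).measurable.comp
        ((measurable_fst.comp measurable_snd).prodMk measurable_fst)
    · filter_upwards [hi] with t ht
      refine ht.bdd_mul (c := ‖L‖) (L.continuous.comp hcont).aestronglyMeasurable
        (Eventually.of_forall fun x => ?_)
      refine (L.le_opNorm _).trans ?_
      rw [norm_mFourier_apply, mul_one]
  have e : ∀ᵐ t ∂ν, ((∫ x, Complex.reCLM (UnitAddTorus.mFourier (-n) x) *
      hermiteH k (q t x) (σ t) ∂torusMeasure : ℝ) : ℂ) +
      ((∫ x, Complex.imCLM (UnitAddTorus.mFourier (-n) x) *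
      hermiteH k (q t x) (σ t) ∂torusMeasure : ℝ) : ℂ) * Complex.I =
      coeff (fun x => hermiteH k (q t x) (σ t)) n := by
    filter_upwards [hi] with t ht
    have hint : Integrable (fun x => UnitAddTorus.mFourier (-n) x *
        ((hermiteH k (q t x) (σ t) : ℝ) : ℂ)) torusMeasure := by
      refine ht.ofReal.bdd_mul (c := 1) hcont.aestronglyMeasurable
        (Eventually.of_forall fun x => ?_)
      rw [norm_mFourier_apply]
    change _ = ∫ x, UnitAddTorus.mFourier (-n) x *
        ((hermiteH k (q t x) (σ t) : ℝ) : ℂ) ∂torusMeasure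
    rw [← integral_re_add_im hint]
    simp
  refine AEStronglyMeasurable.congr ?_ e
  exact (Complex.continuous_ofReal.comp_aestronglyMeasurable (key _)).add
    ((Complex.continuous_ofReal.comp_aestronglyMeasurable (key _)).mul aestronglyMeasurable_const)

theorem aestronglyMeasurable_vfield (k : ℕ) (hk : 1 ≤ k) {z : ℝ → Lp ℝ 2 torusMeasure} {σ : ℝ → ℝ}
    (hz : Continuous z) (hσ : Continuous σ) (hfin : ∀ᵐ t, tnorm (4 * k) (z t) ≠ ∞)
    {Y : ℝ → State} (hY : StronglyMeasurable Y) :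
    AEStronglyMeasurable fun t => vfield k (σ t) (z t) t (Y t) := by
  obtain ⟨B, hB⟩ := tnorm_add_synth_pos_le (4 * k) (by omega)
  have hmem : ∀ᵐ t, MemLp (fun x => hermiteH k ((z t + synth (pos t (Y t)) :
      Lp ℝ 2 torusMeasure) x) (σ t)) 2 torusMeasure := by
    filter_upwards [hfin] with t ht
    refine memLp_hermiteH _ (aestronglyMeasurable_lp _) ((hB _ t (Y t)).trans_lt
      (ENNReal.add_lt_top.mpr ⟨ht.lt_top, ENNReal.mul_lt_top (by simp) (by simp)⟩)).ne
  have hq : AEStronglyMeasurable fun t => z t + synth (pos t (Y t)) :=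
    hz.aestronglyMeasurable.add (synth.continuous.comp_aestronglyMeasurable
      (aestronglyMeasurable_pos hY))
  refine aestronglyMeasurable_kick (aestronglyMeasurable_ell2 fun n => ?_)
  refine (aestronglyMeasurable_coeff_hermiteH k hq hσ.aestronglyMeasurable ?_ n).congr ?_
  · filter_upwards [hmem] with t ht using ht.integrable (by norm_num)
  · filter_upwards [hmem] with t ht using (analysis_force_apply ht n).symm

end Force

end

end RenormNLW

namespace RenormNLW

noncomputable section

/-! ### The energy -/

section Energy

/-- `⟨∇⟩⁻¹a` as a function. -/
def synthInv (a : Ell2) : Lp ℝ 2 torusMeasure := synth (invOp a)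

theorem synthInv_sub (a b : Ell2) : synthInv (a - b) = synthInv a - synthInv b := by
  rw [synthInv, synthInv, synthInv, map_sub, map_sub]

theorem tnorm_synthInv_ne_top (q : ℕ) (a : Ell2) : tnorm q (synthInv a) ≠ ∞ := by
  obtain ⟨C, hC⟩ := tnorm_synth_invOp_le q
  exact ((hC a).trans_lt (ENNReal.mul_lt_top (by simp) (by simp))).ne

theorem memLp_hermiteH_synthInv (k : ℕ) (s : ℝ) (a : Ell2) :
    MemLp (fun x => hermiteH k (synthInv a x) s) 2 torusMeasure :=
  memLp_hermiteH s (aestronglyMeasurable_lp _) (tnorm_synthInv_ne_top _ a)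

theorem integrable_hermiteH_synthInv (k : ℕ) (s : ℝ) (a : Ell2) :
    Integrable (fun x => hermiteH k (synthInv a x) s) torusMeasure :=
  (memLp_hermiteH_synthInv k s a).integrable (by norm_num)

theorem norm_force_synthInv_sub_le (σm : ℝ) (j : ℕ) : ∃ C : ℝ≥0, ∀ (s s' : ℝ) (a b : Ell2),
    |s| ≤ σm → |s'| ≤ σm → ‖force (j + 1) s' (synthInv a) - force (j + 1) s (synthInv b)‖ ≤
      C * (1 + ‖a‖ + ‖b‖) ^ (j + 1) * (‖a - b‖ + |s' - s|) := by
  obtain ⟨C1, h1⟩ := enorm_force_sub_le σm j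
  obtain ⟨C2, h2⟩ := enorm_force_variance_sub_le σm (j + 1)
  obtain ⟨B, hB⟩ := tnorm_synth_invOp_le (4 * (j + 1))
  obtain ⟨D, hD⟩ := tnorm_synth_invOp_le 4
  refine ⟨C1 * D * (1 + B) ^ j + C2 * (1 + B) ^ (j + 1), fun s s' a b hs hs' => ?_⟩
  have e1 := h1 s' (synthInv a) (synthInv b) hs' (tnorm_synthInv_ne_top _ a)
    (tnorm_synthInv_ne_top _ b)
  have e2 := h2 s s' (synthInv b) hs hs' (tnorm_synthInv_ne_top _ b)
  rw [← synthInv_sub] at e1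
  replace e1 := e1.trans (mul_le_mul' (mul_le_mul_right (hD (a - b)) _)
    (pow_le_pow_left' (add_le_add (add_le_add le_rfl (hB a)) (hB b)) j))
  replace e2 := e2.trans (mul_le_mul_right (pow_le_pow_left' (add_le_add le_rfl (hB b)) (j + 1)) _)
  simp only [enorm_eq_nnnorm] at e1 e2
  have e1' : ‖force (j + 1) s' (synthInv a) - force (j + 1) s' (synthInv b)‖₊ ≤
      C1 * (D * ‖a - b‖₊) * (1 + B * ‖a‖₊ + B * ‖b‖₊) ^ j := by exact_mod_cast e1
  have e2' : ‖force (j + 1) s' (synthInv b) - force (j + 1) s (synthInv b)‖₊ ≤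
      C2 * ‖s' - s‖₊ * (1 + B * ‖b‖₊) ^ (j + 1) := by exact_mod_cast e2
  have e3 : ‖force (j + 1) s' (synthInv a) - force (j + 1) s (synthInv b)‖₊ ≤
      (C1 * D * (1 + B) ^ j + C2 * (1 + B) ^ (j + 1)) * (1 + ‖a‖₊ + ‖b‖₊) ^ (j + 1) *
        (‖a - b‖₊ + ‖s' - s‖₊) := by
    have hW : (1 : ℝ≥0) ≤ 1 + ‖a‖₊ + ‖b‖₊ := by rw [add_assoc]; exact le_self_add
    have hw1 : 1 + B * ‖a‖₊ + B * ‖b‖₊ ≤ (1 + B) * (1 + ‖a‖₊ + ‖b‖₊) := by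
      calc _ ≤ 1 + B * ‖a‖₊ + B * ‖b‖₊ + (B + ‖a‖₊ + ‖b‖₊) := le_self_add
        _ = _ := by ring
    have hw2 : 1 + B * ‖b‖₊ ≤ (1 + B) * (1 + ‖a‖₊ + ‖b‖₊) := by
      calc _ ≤ 1 + B * ‖b‖₊ + (B + (1 + B) * ‖a‖₊ + ‖b‖₊) := le_self_add
        _ = _ := by ring
    rw [← sub_add_sub_cancel _ (force (j + 1) s' (synthInv b))]
    refine (nnnorm_add_le _ _).trans ((add_le_add e1' e2').trans ?_)
    calc _ ≤ C1 * (D * ‖a - b‖₊) * ((1 + B) * (1 + ‖a‖₊ + ‖b‖₊)) ^ j +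
          C2 * ‖s' - s‖₊ * ((1 + B) * (1 + ‖a‖₊ + ‖b‖₊)) ^ (j + 1) := by gcongr
      _ = C1 * D * (1 + B) ^ j * (1 + ‖a‖₊ + ‖b‖₊) ^ j * ‖a - b‖₊ +
          C2 * (1 + B) ^ (j + 1) * (1 + ‖a‖₊ + ‖b‖₊) ^ (j + 1) * ‖s' - s‖₊ := by
        rw [mul_pow, mul_pow]; ring
      _ ≤ C1 * D * (1 + B) ^ j * (1 + ‖a‖₊ + ‖b‖₊) ^ (j + 1) * (‖a - b‖₊ + ‖s' - s‖₊) +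
          C2 * (1 + B) ^ (j + 1) * (1 + ‖a‖₊ + ‖b‖₊) ^ (j + 1) * (‖a - b‖₊ + ‖s' - s‖₊) := by
        refine add_le_add (mul_le_mul' (mul_le_mul_right (pow_le_pow_right₀ hW (by omega)) _)
          le_self_add) (mul_le_mul_right le_add_self _)
      _ = _ := by ring
  have e4 := NNReal.coe_le_coe.mpr e3
  push_cast at e4 ⊢
  simpa only [Real.norm_eq_abs] using e4

theorem continuous_force_synthInv (j : ℕ) {ς : ℝ → ℝ} {a : ℝ → Ell2} (hς : Continuous ς)
    (ha : Continuous a) : Continuous fun t => force (j + 1) (ς t) (synthInv (a t)) := by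
  rw [continuous_iff_continuousAt]
  intro t
  obtain ⟨C, hC⟩ := norm_force_synthInv_sub_le (|ς t| + 1) j
  refine tendsto_iff_norm_sub_tendsto_zero.mpr ?_
  have hb : Tendsto (fun τ => C * (1 + ‖a τ‖ + ‖a t‖) ^ (j + 1) *
      (‖a τ - a t‖ + |ς τ - ς t|)) (𝓝 t) (𝓝 0) := by
    have : Continuous fun τ => C * (1 + ‖a τ‖ + ‖a t‖) ^ (j + 1) *
      (‖a τ - a t‖ + |ς τ - ς t|) := by fun_prop
    simpa using this.tendsto t
  refine squeeze_zero' (Eventually.of_forall fun τ => norm_nonneg _) ?_ hb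
  have : ∀ᶠ τ in 𝓝 t, |ς τ| < |ς t| + 1 := (hς.abs.tendsto t).eventually_lt_const (by linarith)
  filter_upwards [this] with τ hτ
  exact hC _ _ _ _ (by linarith) hτ.le

/-- `∫ H_k(⟨∇⟩⁻¹a; s)`. -/
def potential (k : ℕ) (s : ℝ) (a : Ell2) : ℝ := ∫ x, hermiteH k (synthInv a x) s ∂torusMeasure

theorem inner_lp (f g : Lp ℝ 2 torusMeasure) : inner ℝ f g = ∫ x, f x * g x ∂torusMeasure := by
  rw [L2.inner_def]
  refine integral_congr_ae (Eventually.of_forall fun x => ?_)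
  simp [mul_comm]

theorem integrable_mul_lp (f g : Lp ℝ 2 torusMeasure) :
    Integrable (fun x => f x * g x) torusMeasure :=
  MemLp.integrable_mul (p := 2) (q := 2) (Lp.memLp f) (Lp.memLp g)

/-- The constant function `1`. -/
def oneLp : Lp ℝ 2 torusMeasure := (memLp_const (1 : ℝ)).toLp (fun _ => 1)

theorem potential_eq_inner (k : ℕ) (s : ℝ) (a : Ell2) :
    potential k s a = inner ℝ oneLp (force k s (synthInv a)) := by
  rw [inner_lp]
  refine integral_congr_ae ?_
  filter_upwards [(memLp_const (μ := torusMeasure) (p := 2) (1 : ℝ)).coeFn_toLp,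
    force_ae (memLp_hermiteH_synthInv k s a)] with x h1 h2
  rw [oneLp, h1, h2, one_mul]

theorem continuous_potential (j : ℕ) {ς : ℝ → ℝ} {a : ℝ → Ell2} (hς : Continuous ς)
    (ha : Continuous a) : Continuous fun t => potential (j + 1) (ς t) (a t) := by
  simp only [potential_eq_inner]
  exact continuous_const.inner (continuous_force_synthInv j hς ha)

/-- Hölder with exponents 2, 4, 4: one factor of the squared difference goes into L², where ⟨∇⟩⁻¹(a
- b) is differentiable in time, the other into L⁴ ⊃ H¹, where it is only continuous. -/
theorem lintegral_sq_mul_weight_le (p : ℕ) : ∃ C : ℝ≥0, ∀ (a b : Ell2) (δ : ℝ),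
    ∫⁻ x, ‖(1 + |synthInv a x| + |synthInv b x|) ^ p *
      ((synthInv a x - synthInv b x) ^ 2 + δ ^ 2)‖ₑ ∂torusMeasure ≤
      C * (1 + ‖a‖ₑ + ‖b‖ₑ) ^ p * (‖invOp (a - b)‖ₑ * ‖a - b‖ₑ + ‖δ‖ₑ ^ 2) := by
  obtain ⟨B, hB⟩ := tnorm_synth_invOp_le (4 * p)
  obtain ⟨D, hD⟩ := tnorm_synth_invOp_le 4
  refine ⟨(1 + B) ^ p * (1 + D), fun a b δ => ?_⟩
  have ma := aestronglyMeasurable_lp (synthInv a)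
  have mb := aestronglyMeasurable_lp (synthInv b)
  set w : Torus → ℝ := fun x => (1 + |synthInv a x| + |synthInv b x|) ^ p with hw
  have mw : AEStronglyMeasurable w torusMeasure :=
    ((aestronglyMeasurable_const.add ma.norm).add mb.norm).pow p
  have hW : tnorm 4 w ≤ (1 + B) ^ p * (1 + ‖a‖ₑ + ‖b‖ₑ) ^ p := by
    refine (tnorm_weight_le (by norm_num) p ma mb).trans ?_
    rw [← mul_pow]
    refine pow_le_pow_left' ((add_le_add (add_le_add le_rfl (hB a)) (hB b)).trans ?_) p
    calc _ ≤ 1 + B * ‖a‖ₑ + B * ‖b‖ₑ + (B + ‖a‖ₑ + ‖b‖ₑ) := le_self_add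
      _ = _ := by ring
  set d : Torus → ℝ := fun x => synthInv a x - synthInv b x with hd
  have md : AEStronglyMeasurable d torusMeasure := ma.sub mb
  have ed : d =ᵐ[torusMeasure] synthInv (a - b) := by
    rw [synthInv_sub]
    exact (Lp.coeFn_sub _ _).symm
  have hd4 : tnorm 4 d ≤ D * ‖a - b‖ₑ := by rw [tnorm_congr ed]; exact hD _
  have hd2 : tnorm 2 d ≤ ‖invOp (a - b)‖ₑ := by
    rw [tnorm_congr ed, tnorm_two, ← ofReal_norm, ← ofReal_norm]
    exact ENNReal.ofReal_le_ofReal (norm_synth_le _)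
  have h1 : ∫⁻ x, ‖d x * (d x * w x)‖ₑ ∂torusMeasure ≤
      ‖invOp (a - b)‖ₑ * (D * ‖a - b‖ₑ * ((1 + B) ^ p * (1 + ‖a‖ₑ + ‖b‖ₑ) ^ p)) :=
    (lintegral_mul_le_tnorm md (md.mul mw)).trans (mul_le_mul' hd2
      ((tnorm_two_mul_le md mw).trans (mul_le_mul' hd4 hW)))
  have h2 : ∫⁻ x, ‖δ ^ 2 * w x‖ₑ ∂torusMeasure ≤
      ‖δ‖ₑ ^ 2 * ((1 + B) ^ p * (1 + ‖a‖ₑ + ‖b‖ₑ) ^ p) := by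
    simp only [enorm_mul, enorm_pow]
    rw [lintegral_const_mul' _ _ (by simp), ← eLpNorm_one_eq_lintegral_enorm]
    refine mul_le_mul_right (le_trans ?_ hW) _
    have := tnorm_mono (by norm_num : 1 ≤ 4) mw
    rwa [tnorm, Nat.cast_one] at this
  calc _ ≤ ∫⁻ x, (‖d x * (d x * w x)‖ₑ + ‖δ ^ 2 * w x‖ₑ) ∂torusMeasure := by
        refine lintegral_mono fun x => ?_
        have : w x * (d x ^ 2 + δ ^ 2) = d x * (d x * w x) + δ ^ 2 * w x := by ring
        change ‖w x * (d x ^ 2 + δ ^ 2)‖ₑ ≤ _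
        rw [this]
        exact enorm_add_le _ _
    _ = ∫⁻ x, ‖d x * (d x * w x)‖ₑ ∂torusMeasure + ∫⁻ x, ‖δ ^ 2 * w x‖ₑ ∂torusMeasure :=
        lintegral_add_left' (md.mul (md.mul mw)).enorm _
    _ ≤ _ := add_le_add h1 h2
    _ = (1 + B) ^ p * (1 + ‖a‖ₑ + ‖b‖ₑ) ^ p * (D * (‖invOp (a - b)‖ₑ * ‖a - b‖ₑ) + ‖δ‖ₑ ^ 2) := by
        ring
    _ ≤ (1 + B) ^ p * (1 + ‖a‖ₑ + ‖b‖ₑ) ^ p *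
        ((1 + D) * (‖invOp (a - b)‖ₑ * ‖a - b‖ₑ + ‖δ‖ₑ ^ 2)) := by
        refine mul_le_mul_right ?_ _
        calc _ ≤ (D * (‖invOp (a - b)‖ₑ * ‖a - b‖ₑ) + ‖δ‖ₑ ^ 2) +
              (‖invOp (a - b)‖ₑ * ‖a - b‖ₑ + D * ‖δ‖ₑ ^ 2) := le_self_add
          _ = _ := by ring
    _ = _ := by push_cast; ring

/-- The pointwise Taylor expansion integrated in x. The remainder is (L² difference)·(H¹
difference), not the square of the latter; this asymmetry is what makes it o(τ - t) for an
energy-class path. -/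
theorem potential_taylor (σm : ℝ) (j : ℕ) : ∃ C : ℝ≥0, ∀ (a b : Ell2) (s s' : ℝ),
    |s| ≤ σm → |s'| ≤ σm →
    |potential (j + 2) s' a - potential (j + 2) s b -
      (j + 2) * inner ℝ (synth (invOp a - invOp b)) (force (j + 1) s (synthInv b)) +
      (j + 2) * (j + 1) / 2 * potential j s b * (s' - s)| ≤
      C * (1 + ‖a‖ + ‖b‖) ^ (j + 2) * (‖invOp a - invOp b‖ * ‖a - b‖ + (s' - s) ^ 2) := by
  obtain ⟨C1, hC1, h1⟩ := hermiteH_taylor σm j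
  lift C1 to ℝ≥0 using hC1
  obtain ⟨C2, h2⟩ := lintegral_sq_mul_weight_le (j + 2)
  refine ⟨C1 * C2, fun a b s s' hs hs' => ?_⟩
  set R : Torus → ℝ := fun x => hermiteH (j + 2) (synthInv a x) s' -
    hermiteH (j + 2) (synthInv b x) s -
      (j + 2) * (synth (invOp a - invOp b) x * force (j + 1) s (synthInv b) x) +
      (j + 2) * (j + 1) / 2 * hermiteH j (synthInv b x) s * (s' - s) with hR
  have i1 := integrable_hermiteH_synthInv (j + 2) s' a
  have i2 := integrable_hermiteH_synthInv (j + 2) s b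
  have i3 := (integrable_mul_lp (synth (invOp a - invOp b))
    (force (j + 1) s (synthInv b))).const_mul ((j : ℝ) + 2)
  have i4 := ((integrable_hermiteH_synthInv j s b).const_mul
    (((j : ℝ) + 2) * (j + 1) / 2)).mul_const (s' - s)
  have e : potential (j + 2) s' a - potential (j + 2) s b -
      (j + 2) * inner ℝ (synth (invOp a - invOp b)) (force (j + 1) s (synthInv b)) +
      (j + 2) * (j + 1) / 2 * potential j s b * (s' - s) = ∫ x, R x ∂torusMeasure := by
    have h12 : Integrable (fun x => hermiteH (j + 2) (synthInv a x) s' -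
      hermiteH (j + 2) (synthInv b x) s) torusMeasure := i1.sub i2
    have h123 : Integrable (fun x => hermiteH (j + 2) (synthInv a x) s' -
      hermiteH (j + 2) (synthInv b x) s - (j + 2) * (synth (invOp a - invOp b) x *
        force (j + 1) s (synthInv b) x)) torusMeasure := h12.sub i3
    rw [hR, integral_add h123 i4, integral_sub h12 i3, integral_sub i1 i2,
      integral_const_mul, integral_mul_const, integral_const_mul, inner_lp]
    rfl
  have hle : ∀ᵐ x ∂torusMeasure, ‖R x‖ₑ ≤ C1 * ‖(1 + |synthInv a x| + |synthInv b x|) ^ (j + 2) *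
      ((synthInv a x - synthInv b x) ^ 2 + (s' - s) ^ 2)‖ₑ := by
    filter_upwards [force_ae (memLp_hermiteH_synthInv (j + 1) s b),
      Lp.coeFn_sub (synthInv a) (synthInv b)] with x hx hx2
    have e3 : synth (invOp a - invOp b) x = synthInv a x - synthInv b x := by
      rw [map_sub]; exact hx2
    have h := h1 (synthInv a x) (synthInv b x) s s' hs hs'
    have hR' : R x = hermiteH (j + 2) (synthInv a x) s' - hermiteH (j + 2) (synthInv b x) s -
      (j + 2) * hermiteH (j + 1) (synthInv b x) s * (synthInv a x - synthInv b x) +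
      (j + 2) * (j + 1) / 2 * hermiteH j (synthInv b x) s * (s' - s) := by
      simp only [hR]
      rw [e3, hx]
      ring
    rw [← hR'] at h
    have hc : (C1 : ℝ≥0∞) = ‖(C1 : ℝ)‖ₑ := by simp
    rw [hc, ← enorm_mul, ← ofReal_norm, ← ofReal_norm]
    refine ENNReal.ofReal_le_ofReal ?_
    rw [Real.norm_eq_abs, Real.norm_eq_abs, ← mul_assoc]
    exact h.trans (le_abs_self _)
  have hfin : ‖∫ x, R x ∂torusMeasure‖ₑ ≤ C1 * (C2 * (1 + ‖a‖ₑ + ‖b‖ₑ) ^ (j + 2) *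
      (‖invOp (a - b)‖ₑ * ‖a - b‖ₑ + ‖s' - s‖ₑ ^ 2)) := by
    refine (enorm_integral_le_lintegral_enorm _).trans ((lintegral_mono_ae hle).trans ?_)
    rw [lintegral_const_mul' _ _ (by simp)]
    exact mul_le_mul_right (h2 a b (s' - s)) _
  rw [e]
  rw [map_sub] at hfin
  simp only [enorm_eq_nnnorm] at hfin
  have h3 : ‖∫ x, R x ∂torusMeasure‖₊ ≤ C1 * (C2 * (1 + ‖a‖₊ + ‖b‖₊) ^ (j + 2) *
      (‖invOp a - invOp b‖₊ * ‖a - b‖₊ + ‖s' - s‖₊ ^ 2)) := by exact_mod_cast hfin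
  have h4 := NNReal.coe_le_coe.mpr h3
  push_cast at h4 ⊢
  rw [Real.norm_eq_abs, Real.norm_eq_abs, sq_abs] at h4
  linarith

/-- The path ⟨∇⟩⁻¹a is differentiable only in L² and continuous in H¹. The Taylor remainder is O(τ -
t)·o(1) + (ς τ - ς t)², hence negligible, so the potential energy is differentiated directly,
without regularising the solution. -/
theorem hasDerivAt_potential (j : ℕ) {ς : ℝ → ℝ} {ς' t : ℝ} {a : ℝ → Ell2} {w : Ell2}
    (hς : HasDerivAt ς ς' t) (ha : ContinuousAt a t)
    (hw : HasDerivAt (fun τ => invOp (a τ)) w t) :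
    HasDerivAt (fun τ => potential (j + 2) (ς τ) (a τ))
      ((j + 2) * inner ℝ (synth w) (force (j + 1) (ς t) (synthInv (a t))) -
        (j + 2) * (j + 1) / 2 * potential j (ς t) (a t) * ς') t := by
  obtain ⟨C, hC⟩ := potential_taylor (|ς t| + 1) j
  set R : ℝ → ℝ := fun τ => potential (j + 2) (ς τ) (a τ) - potential (j + 2) (ς t) (a t) -
      (j + 2) * inner ℝ (synth (invOp (a τ) - invOp (a t))) (force (j + 1) (ς t) (synthInv (a t))) +
      (j + 2) * (j + 1) / 2 * potential j (ς t) (a t) * (ς τ - ς t) with hR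
  have hR0 : HasDerivAt R 0 t := by
    have hRt : R t = 0 := by simp [hR]
    rw [hasDerivAt_iff_isLittleO]
    simp only [hRt, smul_zero, sub_zero]
    have hs : ∀ᶠ τ in 𝓝 t, |ς τ| < |ς t| + 1 :=
      (hς.continuousAt.abs.tendsto).eventually_lt_const (by linarith)
    have h1 : R =O[𝓝 t] fun τ => C * (1 + ‖a τ‖ + ‖a t‖) ^ (j + 2) *
        (‖invOp (a τ) - invOp (a t)‖ * ‖a τ - a t‖ + (ς τ - ς t) ^ 2) := by
      refine Asymptotics.IsBigO.of_bound 1 ?_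
      filter_upwards [hs] with τ hτ
      rw [one_mul]
      exact (hC _ _ _ _ (by linarith) hτ.le).trans (le_abs_self _)
    refine h1.trans_isLittleO ?_
    have hO1 : (fun τ => ‖invOp (a τ) - invOp (a t)‖) =O[𝓝 t] fun τ => τ - t := hw.isBigO_sub.norm_left
    have hO2 : (fun τ => ς τ - ς t) =O[𝓝 t] fun τ => τ - t := hς.isBigO_sub
    have ho1 : (fun τ => ‖a τ - a t‖) =o[𝓝 t] fun _ => (1 : ℝ) := by
      rw [Asymptotics.isLittleO_one_iff]
      simpa using (ha.sub (continuousAt_const (y := a t))).norm.tendsto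
    have ho2 : (fun τ => ς τ - ς t) =o[𝓝 t] fun _ => (1 : ℝ) := by
      rw [Asymptotics.isLittleO_one_iff]
      exact tendsto_sub_nhds_zero_iff.mpr hς.continuousAt.tendsto
    have hb : (fun τ => C * (1 + ‖a τ‖ + ‖a t‖) ^ (j + 2)) =O[𝓝 t] fun _ => (1 : ℝ) := by
      have : ContinuousAt (fun τ => C * (1 + ‖a τ‖ + ‖a t‖) ^ (j + 2)) t := by fun_prop
      exact this.tendsto.isBigO_one ℝ
    have hsum : (fun τ => ‖invOp (a τ) - invOp (a t)‖ * ‖a τ - a t‖ + (ς τ - ς t) ^ 2) =o[𝓝 t]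
        fun τ => τ - t := by
      have e1 := hO1.mul_isLittleO ho1
      have e2 := hO2.mul_isLittleO ho2
      simp only [mul_one] at e1 e2
      refine e1.add (e2.congr_left fun τ => by ring)
    simpa only [one_mul] using hb.mul_isLittleO hsum
  have hU : HasDerivAt (fun τ => synth (invOp (a τ) - invOp (a t))) (synth w) t :=
    synth.hasFDerivAt.comp_hasDerivAt t (hw.sub_const _)
  have hI := ((hU.inner ℝ (hasDerivAt_const t (force (j + 1) (ς t) (synthInv (a t))))).const_mul
    ((j : ℝ) + 2))
  have hS := (hς.sub_const (ς t)).const_mul (((j : ℝ) + 2) * (j + 1) / 2 * potential j (ς t) (a t))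
  have := (((hR0.add hI).sub hS).add_const (potential (j + 2) (ς t) (a t)))
  refine (this.congr_deriv ?_).congr_of_eventuallyEq (Eventually.of_forall fun τ => ?_)
  · simp
  · simp only [hR, Pi.add_apply, Pi.sub_apply]
    ring

theorem isPrimitive_coord {Y : ℝ → State} {f : ℝ → Lp ℝ 2 torusMeasure}
    (hY : IsPrimitive Y fun t => kick t (analysis (f t))) (n : Freq) :
    IsPrimitive (fun t => (Y t).1 n) (fun t => Real.sin (t * bracket n) * analysis (f t) n) ∧
    IsPrimitive (fun t => (Y t).2 n) (fun t => -(Real.cos (t * bracket n) * analysis (f t) n)) :=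
  ⟨hY.clm (((lp.evalCLM ℂ (fun _ : Freq => ℂ) 2 n).restrictScalars ℝ).comp
      (ContinuousLinearMap.fst ℝ Ell2 Ell2)),
    hY.clm (((lp.evalCLM ℂ (fun _ : Freq => ℂ) 2 n).restrictScalars ℝ).comp
      (ContinuousLinearMap.snd ℝ Ell2 Ell2))⟩

theorem isPrimitive_cos (b : ℝ) :
    IsPrimitive (fun t : ℝ => Real.cos (t * b)) fun t => -(b * Real.sin (t * b)) :=
  isPrimitive_of_hasDerivAt (fun t => by
    simpa [mul_comm] using ((hasDerivAt_id t).mul_const b).cos) (by fun_prop)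

theorem isPrimitive_sin (b : ℝ) :
    IsPrimitive (fun t : ℝ => Real.sin (t * b)) fun t => b * Real.cos (t * b) :=
  isPrimitive_of_hasDerivAt (fun t => by
    simpa [mul_comm] using ((hasDerivAt_id t).mul_const b).sin) (by fun_prop)

/-- The two contributions of the force, cos·sin and -sin·cos, cancel in the position, leaving the
velocity. -/
theorem isPrimitive_pos_coord {Y : ℝ → State} {f : ℝ → Lp ℝ 2 torusMeasure}
    (hY : IsPrimitive Y fun t => kick t (analysis (f t))) (n : Freq) :
    IsPrimitive (fun t => pos t (Y t) n) fun t => vel t (Y t) n := by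
  obtain ⟨h1, h2⟩ := isPrimitive_coord hY n
  have h := (((isPrimitive_cos (bracket n)).smul h1).add ((isPrimitive_sin (bracket n)).smul h2)).clm
    ((bracket n)⁻¹ • ContinuousLinearMap.id ℝ ℂ)
  have hb : (bracket n : ℂ) ≠ 0 := by exact_mod_cast (bracket_pos n).ne'
  have e : (fun t => pos t (Y t) n) = fun t => ((bracket n)⁻¹ • ContinuousLinearMap.id ℝ ℂ)
      (Real.cos (t * bracket n) • (Y t).1 n + Real.sin (t * bracket n) • (Y t).2 n) := by
    funext t
    rw [pos_apply, rot_apply]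
    simp [mul_add]
  rw [e]
  refine h.congr (funext fun t => ?_)
  rw [vel_apply]
  simp only [_root_.smul_apply, ContinuousLinearMap.id_apply, Complex.real_smul]
  push_cast
  field_simp
  ring

theorem isPrimitive_pos {Y : ℝ → State} {f : ℝ → Lp ℝ 2 torusMeasure}
    (hY : IsPrimitive Y fun t => kick t (analysis (f t))) :
    IsPrimitive (fun t => pos t (Y t)) fun t => vel t (Y t) := by
  have hv := continuous_vel hY.continuous
  refine ⟨hv.locallyIntegrable, fun t => ?_⟩
  ext n
  rw [(isPrimitive_pos_coord hY n).eq_integral t]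
  refine ((((isPrimitive_integral hv.locallyIntegrable (pos 0 (Y 0))).clm
    ((lp.evalCLM ℂ (fun _ : Freq => ℂ) 2 n).restrictScalars ℝ)).eq_integral t).trans ?_).symm
  simp
  rfl

/-- In the interaction picture the free flow has disappeared, so only the work of the force remains;
moving the cosine and sine multipliers to the other side of the pairing reassembles the velocity. -/
theorem isPrimitive_norm_sq {Y : ℝ → State} {f : ℝ → Lp ℝ 2 torusMeasure}
    (hY : IsPrimitive Y fun t => kick t (analysis (f t))) :
    IsPrimitive (fun t => (‖(Y t).1‖ ^ 2 + ‖(Y t).2‖ ^ 2) / 2)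
      fun t => -inner ℝ (synth (vel t (Y t))) (f t) := by
  have h1 := hY.clm (ContinuousLinearMap.fst ℝ Ell2 Ell2)
  have h2 := hY.clm (ContinuousLinearMap.snd ℝ Ell2 Ell2)
  have h := ((h1.bilin (innerSL ℝ) h1).add (h2.bilin (innerSL ℝ) h2)).clm
    ((2 : ℝ)⁻¹ • ContinuousLinearMap.id ℝ ℝ)
  have e1 : ∀ a b : Ell2, innerSL ℝ a b = (inner ℂ a b).re := fun a b => by
    change inner ℝ a b = _
    rw [lp.inner_eq_tsum, lp.inner_eq_tsum, Complex.re_tsum (lp.summable_inner a b)]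
    exact tsum_congr fun n => real_inner_eq_re_inner ℂ _ _
  have e : (fun t => (‖(Y t).1‖ ^ 2 + ‖(Y t).2‖ ^ 2) / 2) = fun t =>
      ((2 : ℝ)⁻¹ • ContinuousLinearMap.id ℝ ℝ) (innerSL ℝ (Y t).1 (Y t).1 +
        innerSL ℝ (Y t).2 (Y t).2) := by
    funext t
    have e7 : ∀ a : Ell2, (inner ℂ a a).re = ‖a‖ ^ 2 := fun a => inner_self_eq_norm_sq (𝕜 := ℂ) a
    simp only [e1, _root_.smul_apply, ContinuousLinearMap.id_apply, smul_eq_mul, e7]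
    ring
  refine e ▸ h.congr (funext fun t => ?_)
  rw [← re_inner_analysis]
  have e2 : vel t (Y t) = cosOp t (Y t).2 - sinOp t (Y t).1 := rfl
  have e3 : kick t (analysis (f t)) = (sinOp t (analysis (f t)), -cosOp t (analysis (f t))) := rfl
  have e4 : ∀ a b, inner ℂ a (cosOp t b) = inner ℂ (cosOp t a) b := inner_diag _ _
  have e5 : ∀ a b, inner ℂ a (sinOp t b) = inner ℂ (sinOp t a) b := inner_diag _ _
  simp only [_root_.smul_apply, ContinuousLinearMap.id_apply, smul_eq_mul, e1,
    ContinuousLinearMap.coe_fst', ContinuousLinearMap.coe_snd', e3]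
  have e6 : ∀ a b : Ell2, (inner ℂ a b).re = (inner ℂ b a).re := fun a b => inner_re_symm (𝕜 := ℂ) a b
  rw [e6 (sinOp t _), e6 (-cosOp t _), e2, inner_sub_left, inner_neg_right, e4, e5,
    Complex.sub_re, Complex.neg_re]
  ring

/-- The energy of the equation with the nonlinearity `H_{j+2}`. -/
def energy (j : ℕ) (s t : ℝ) (y : State) : ℝ :=
  (‖y.1‖ ^ 2 + ‖y.2‖ ^ 2) / 2 + potential (j + 3) s (rot t y) / (j + 3)

/-- The force f driving Y is arbitrary, independent of the potential in the energy. Thus the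
defocusing energy without z can be tested against the true force, and the derivative shows exactly
the mismatch. -/
theorem isPrimitive_energy (j : ℕ) {Y : ℝ → State} {f : ℝ → Lp ℝ 2 torusMeasure}
    (hY : IsPrimitive Y fun t => kick t (analysis (f t))) {ς ς' : ℝ → ℝ}
    (hς : ∀ t, HasDerivAt ς (ς' t) t) (hς' : Continuous ς') :
    IsPrimitive (fun t => energy j (ς t) t (Y t)) fun t =>
      inner ℝ (synth (vel t (Y t))) (force (j + 2) (ς t) (synth (pos t (Y t))) - f t) -
        (j + 2) / 2 * potential (j + 1) (ς t) (rot t (Y t)) * ς' t := by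
  have hrot := continuous_rot hY.continuous
  have hvel := continuous_vel hY.continuous
  have hςc : Continuous ς := continuous_iff_continuousAt.mpr fun t => (hς t).continuousAt
  have h1 := isPrimitive_of_hasDerivAt (fun t => hasDerivAt_potential (j + 1) (hς t)
    hrot.continuousAt ((isPrimitive_pos hY).hasDerivAt hvel t))
    (((continuous_const.mul ((synth.continuous.comp hvel).inner
      (continuous_force_synthInv (j + 1) hςc hrot))).sub
      ((continuous_const.mul (continuous_potential j hςc hrot)).mul hς')))
  have h2 := (isPrimitive_norm_sq hY).add (h1.clm
    (((j : ℝ) + 3)⁻¹ • ContinuousLinearMap.id ℝ ℝ))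
  have e : (fun t => energy j (ς t) t (Y t)) = fun t => (‖(Y t).1‖ ^ 2 + ‖(Y t).2‖ ^ 2) / 2 +
      (((j : ℝ) + 3)⁻¹ • ContinuousLinearMap.id ℝ ℝ)
        (potential (j + 1 + 2) (ς t) (rot t (Y t))) := by
    funext t
    simp only [energy, _root_.smul_apply, ContinuousLinearMap.id_apply, smul_eq_mul]
    rw [add_assoc j 1 2]
    ring
  rw [e]
  refine h2.congr (funext fun t => ?_)
  simp only [_root_.smul_apply, ContinuousLinearMap.id_apply, smul_eq_mul]
  have e2 : synth (pos t (Y t)) = synthInv (rot t (Y t)) := rfl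
  have e3 : ((j + 1 : ℕ) : ℝ) + 2 = j + 3 := by push_cast; ring
  have e4 : ((j + 1 : ℕ) : ℝ) + 1 = j + 2 := by push_cast; ring
  rw [e2, inner_sub_right, e3, e4, add_assoc j 1 1]
  field_simp
  ring

end Energy

end

end RenormNLW

namespace RenormNLW

noncomputable section

/-! ### Global existence -/

section GlobalExistence

theorem aemeasurable_tnorm {p : ℕ} (hp : p ≠ 0) {β : Type*} [MeasurableSpace β] {ν : Measure β}
    {q : β → Lp ℝ 2 torusMeasure} (hq : AEStronglyMeasurable q ν) :
    AEMeasurable (fun t => tnorm p (q t)) ν := by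
  have h : AEMeasurable (fun t => ∫⁻ x, ‖q t x‖ₑ ^ p ∂torusMeasure) ν :=
    aemeasurable_lintegral_comp (θ := fun _ y _ => ‖y‖ₑ ^ p) (σ := fun _ => 0)
      (fun x => (ENNReal.continuous_pow p).comp continuous_snd.enorm)
      ((measurable_fst.comp measurable_snd).enorm.pow_const p) hq aestronglyMeasurable_const
  refine (h.pow_const ((p : ℝ)⁻¹)).congr (Eventually.of_forall fun t => ?_)
  change (∫⁻ x, ‖q t x‖ₑ ^ p ∂torusMeasure) ^ ((p : ℝ)⁻¹) = tnorm p (q t)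
  rw [← tnorm_pow_eq_lintegral hp, ENNReal.pow_rpow_inv_natCast hp]

theorem exists_subset_Icc {K : Set ℝ} (hK : IsCompact K) : ∃ T : ℝ, 0 ≤ T ∧ K ⊆ Set.Icc (-T) T := by
  obtain ⟨C, hC⟩ := hK.exists_bound_of_continuousOn (f := fun t : ℝ => t) continuousOn_id
  refine ⟨|C|, abs_nonneg C, fun t ht => ?_⟩
  have := (hC t ht).trans (le_abs_self C)
  rwa [Real.norm_eq_abs, abs_le] at this

theorem locallyIntegrable_toReal {f : ℝ → ℝ≥0∞} (hf : AEMeasurable f)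
    (h : ∀ T : ℝ, ∫⁻ t in Set.Icc (-T) T, f t < ∞) :
    LocallyIntegrable (fun t => (f t).toReal) ∧ ∀ᵐ t, f t ≠ ∞ := by
  constructor
  · rw [locallyIntegrable_iff]
    intro K hK
    obtain ⟨T, -, hT⟩ := exists_subset_Icc hK
    have hi : IntegrableOn (fun t => (f t).toReal) (Set.Icc (-T) T) :=
      integrable_toReal_of_lintegral_ne_top hf.restrict (h T).ne
    exact hi.mono_set hT
  · have hN : ∀ N : ℕ, ∀ᵐ t, t ∈ Set.Icc (-(N : ℝ)) N → f t ≠ ∞ := fun N => by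
      rw [← ae_restrict_iff' measurableSet_Icc]
      filter_upwards [ae_lt_top' hf.restrict (h N).ne] with t ht using ht.ne
    filter_upwards [ae_all_iff.mpr hN] with t ht
    obtain ⟨N, hN⟩ := exists_nat_ge |t|
    exact ht N ⟨(abs_le.mp hN).1, (abs_le.mp hN).2⟩

/-- The data of the equation `∂ₜ²u + (1 - Δ)u + H_k(z + u; σ) = 0` for `u`. -/
structure IsForcing (k : ℕ) (z : ℝ → Lp ℝ 2 torusMeasure) (σ : ℝ → ℝ) : Prop where
  continuous_field : Continuous z
  continuous_variance : Continuous σ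
  bounded : ∃ σm, ∀ t, |σ t| ≤ σm
  lintegral_lt_top : ∀ T : ℝ, ∫⁻ t in Set.Icc (-T) T, (1 + tnorm (4 * k) (z t)) ^ k < ∞

namespace IsForcing

variable {k : ℕ} {z : ℝ → Lp ℝ 2 torusMeasure} {σ : ℝ → ℝ}

theorem weight (h : IsForcing k z σ) (hk : 1 ≤ k) :
    LocallyIntegrable (fun t => (1 + (tnorm (4 * k) (z t)).toReal) ^ k) ∧
      ∀ᵐ t, tnorm (4 * k) (z t) ≠ ∞ := by
  have hm : AEMeasurable fun t => (1 + tnorm (4 * k) (z t)) ^ k :=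
    (aemeasurable_const.add (aemeasurable_tnorm (by omega)
      h.continuous_field.aestronglyMeasurable)).pow_const k
  obtain ⟨h1, h2⟩ := locallyIntegrable_toReal hm h.lintegral_lt_top
  have h3 : ∀ᵐ t, tnorm (4 * k) (z t) ≠ ∞ := by
    filter_upwards [h2] with t ht h
    rw [h] at ht
    simp [show k ≠ 0 by omega] at ht
  refine ⟨?_, h3⟩
  rw [locallyIntegrable_iff] at h1 ⊢
  refine fun K hK => (h1 K hK).congr (ae_restrict_of_ae ?_)
  filter_upwards [h3] with t ht
  rw [ENNReal.toReal_pow, ENNReal.toReal_add (by simp) ht]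
  rfl

theorem locallyIntegrable_vfield (h : IsForcing k z σ) (hk : 1 ≤ k) {Y : ℝ → State}
    (hY : Continuous Y) : LocallyIntegrable fun t => vfield k (σ t) (z t) t (Y t) := by
  obtain ⟨σm, hσm⟩ := h.bounded
  obtain ⟨h1, h2⟩ := h.weight hk
  obtain ⟨A, hA⟩ := norm_vfield_le σm k hk
  have hmeas := aestronglyMeasurable_vfield k hk h.continuous_field h.continuous_variance h2
    hY.stronglyMeasurable
  rw [locallyIntegrable_iff] at h1 ⊢
  intro K hK
  obtain ⟨M, hM⟩ := hK.exists_bound_of_continuousOn hY.continuousOn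
  refine ((h1 K hK).const_mul (A * (1 + |M|) ^ k)).mono' hmeas.restrict ?_
  filter_upwards [ae_restrict_of_ae h2, ae_restrict_mem hK.measurableSet] with t ht htK
  refine (hA (σ t) (z t) t (Y t) (hσm t) ht).trans ?_
  rw [mul_assoc, ← mul_pow]
  gcongr
  have h3 := (hM t htK).trans (le_abs_self M)
  have h4 : 0 ≤ (tnorm (4 * k) (z t)).toReal := ENNReal.toReal_nonneg
  nlinarith [abs_nonneg M, norm_nonneg (Y t)]

/-- The path Y of the a priori hypothesis satisfies the equation only on [0, t]. Its companion Z,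
the primitive of the field along Y, is absolutely continuous on ℝ and agrees with Y there, so the
energy identity can be applied to Z. -/
theorem exists_global {j : ℕ} (h : IsForcing (j + 1) z σ) (Y₀ : State)
    (hap : ∀ T : ℕ, ∃ R₀ : ℝ, ∀ R ≥ R₀, ∀ (Y Z : ℝ → State) (t : ℝ), Continuous Y → |t| ≤ T →
      (∀ r ∈ Set.uIcc 0 t, ‖Y r‖ ≤ R) →
      IsPrimitive Z (fun τ => vfield (j + 1) (σ τ) (z τ) τ (Y τ)) → Z 0 = Y₀ →
      (∀ r ∈ Set.uIcc 0 t, Z r = Y r) → ‖Z t‖ < R) :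
    ∃ Y : ℝ → State, Y 0 = Y₀ ∧
      IsPrimitive Y fun τ => vfield (j + 1) (σ τ) (z τ) τ (Y τ) := by
  obtain ⟨σm, hσm⟩ := h.bounded
  obtain ⟨h1, h2⟩ := h.weight (by omega)
  obtain ⟨A1, hA1⟩ := norm_vfield_sub_le σm j
  obtain ⟨A2, hA2⟩ := norm_vfield_le σm (j + 1) (by omega)
  have hex : ∃ Y : ℝ → State, Continuous Y ∧
      ∀ t, Y t = Y₀ + ∫ τ in (0 : ℝ)..t, vfield (j + 1) (σ τ) (z τ) τ (Y τ) := by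
    refine exists_global_of_apriori
      (G := fun t y => vfield (j + 1) (σ t) (z t) t y)
      (C := fun R => A1 * (1 + 2 * |R|) ^ j + A2) h1
      (Eventually.of_forall fun t => by positivity)
      (fun Y hY => aestronglyMeasurable_vfield (j + 1) (by omega) h.continuous_field
        h.continuous_variance h2 hY) (fun R => by positivity) ?_ ?_ Y₀ ?_
    · filter_upwards [h2] with t ht R hR y y' hy hy'
      refine (hA1 (σ t) (z t) t y y' (hσm t) ht).trans (mul_le_mul_of_nonneg_right ?_ (norm_nonneg _))
      set τ := (tnorm (4 * (j + 1)) (z t)).toReal with hτ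
      have hτ0 : 0 ≤ τ := ENNReal.toReal_nonneg
      have hR' := le_abs_self R
      calc A1 * (1 + τ + ‖y‖ + ‖y'‖) ^ j ≤ A1 * ((1 + 2 * |R|) * (1 + τ)) ^ j := by
            gcongr
            nlinarith [abs_nonneg R]
        _ = A1 * (1 + 2 * |R|) ^ j * (1 + τ) ^ j := by rw [mul_pow]; ring
        _ ≤ (A1 * (1 + 2 * |R|) ^ j + A2) * (1 + τ) ^ (j + 1) := by
            gcongr
            · linarith [A2.coe_nonneg]
            · linarith
            · exact Nat.le_succ j
    · filter_upwards [h2] with t ht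
      refine (hA2 (σ t) (z t) t 0 (hσm t) ht).trans ?_
      rw [norm_zero, add_zero]
      gcongr
      exact le_add_of_nonneg_left (by positivity)
    · intro T
      obtain ⟨R₀, hR₀⟩ := hap T
      refine ⟨R₀, fun R hR Y t hYc ht hYR hYe => ?_⟩
      have hi := isPrimitive_integral (h.locallyIntegrable_vfield (by omega) hYc) Y₀
      have := hR₀ R hR Y _ t hYc ht hYR hi (by simp) (fun r hr => (hYe r hr).symm)
      rwa [← hYe t Set.right_mem_uIcc] at this
  obtain ⟨Y, hYc, hY⟩ := hex
  have hi := isPrimitive_integral (h.locallyIntegrable_vfield (by omega) hYc) Y₀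
  have e : Y = fun t => Y₀ + ∫ τ in (0 : ℝ)..t, vfield (j + 1) (σ τ) (z τ) τ (Y τ) := funext hY
  refine ⟨Y, ?_, ?_⟩
  · rw [hY 0]; simp
  · rw [← e] at hi
    exact hi

end IsForcing

/-- Grönwall in integral form, with the inhomogeneity M moved into the constant; it holds in both
time directions because |f'| is bounded. -/
theorem le_of_abs_deriv_le {f f' M : ℝ → ℝ} (hf : IsPrimitive f f') (hf0 : ∀ t, 0 ≤ f t)
    (hM : LocallyIntegrable M) (hM0 : ∀ t, 0 ≤ M t) {L T t : ℝ} (hL : 0 ≤ L) (ht : |t| ≤ T)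
    (h : ∀ᵐ τ, τ ∈ Set.uIcc 0 t → |f' τ| ≤ L * f τ + M τ) :
    f t ≤ (f 0 + ∫ τ in Set.Icc (-T) T, M τ) * Real.exp (L * T) := by
  have hMT : 0 ≤ ∫ τ in Set.Icc (-T) T, M τ := integral_nonneg fun τ => hM0 τ
  have hT := abs_le.mp ht
  have hg := gronwall (l := fun _ => L) (a := f 0 + ∫ τ in Set.Icc (-T) T, M τ) (T := t)
    hf.continuous hf0 (continuous_const.locallyIntegrable) (Eventually.of_forall fun _ => hL) ?_
  · refine hg.trans ?_
    have h0 := hf0 0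
    gcongr
    rw [intervalIntegral.integral_const, sub_zero, smul_eq_mul, abs_mul, abs_of_nonneg hL, mul_comm]
    gcongr
  · intro r hr
    have hsub : Set.uIoc 0 r ⊆ Set.uIcc 0 t :=
      Set.uIoc_subset_uIcc.trans (Set.uIcc_subset_uIcc_left hr)
    have hsub2 : Set.uIoc 0 r ⊆ Set.Icc (-T) T := by
      refine hsub.trans (Set.uIcc_subset_Icc ⟨by linarith [abs_nonneg t], by linarith [abs_nonneg t]⟩
        ⟨hT.1, hT.2⟩)
    have hif : LocallyIntegrable fun τ => L * f τ :=
      (continuous_const.mul hf.continuous).locallyIntegrable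
    have h1 : |∫ τ in (0 : ℝ)..r, f' τ| ≤ |∫ τ in (0 : ℝ)..r, (L * f τ + M τ)| := by
      refine intervalIntegral.norm_integral_le_abs_of_norm_le (f := f') ?_
        (intervalIntegrable_of_locallyIntegrable (hif.add hM) _ _)
      rw [ae_restrict_iff' measurableSet_uIoc]
      filter_upwards [h] with τ hτ hτr using hτ (hsub hτr)
    have h2 : ∫ τ in (0 : ℝ)..r, (L * f τ + M τ) =
        (∫ τ in (0 : ℝ)..r, L * f τ) + ∫ τ in (0 : ℝ)..r, M τ :=
      intervalIntegral.integral_add (intervalIntegrable_of_locallyIntegrable hif _ _)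
        (intervalIntegrable_of_locallyIntegrable hM _ _)
    have h3 : |∫ τ in (0 : ℝ)..r, M τ| ≤ ∫ τ in Set.Icc (-T) T, M τ := by
      rw [← Real.norm_eq_abs]
      refine (intervalIntegral.norm_integral_le_integral_norm_uIoc).trans ?_
      simp only [Real.norm_eq_abs, abs_of_nonneg (hM0 _)]
      exact setIntegral_mono_set (hM.integrableOn_isCompact isCompact_Icc)
        (Eventually.of_forall fun τ => hM0 τ) hsub2.eventuallyLE
    rw [h2] at h1
    have h4 := abs_add_le (∫ τ in (0 : ℝ)..r, L * f τ) (∫ τ in (0 : ℝ)..r, M τ)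
    rw [hf.eq_integral r]
    linarith [le_abs_self (∫ τ in (0 : ℝ)..r, f' τ)]

/-- Even degree makes H_{j+3} bounded below and larger than |H_{j+1}| up to a constant; integrated,
the energy controls its own variation due to the moving variance. -/
theorem potential_coercive (σm : ℝ) {j : ℕ} (hj : Even (j + 3)) : ∃ C : ℝ, 0 ≤ C ∧
    ∀ (s : ℝ) (a : Ell2), |s| ≤ σm →
      |potential (j + 1) s a| ≤ potential (j + 3) s a + C ∧ 0 ≤ potential (j + 3) s a + C := by
  obtain ⟨C1, hC1, h1⟩ := hermiteH_coercive σm hj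
  obtain ⟨C2, hC2, h2⟩ := hermiteH_growth σm (j + 1)
  obtain ⟨C3, hC3, h3⟩ := exists_mul_pow_le C2 (j + 2)
  refine ⟨C3 + C1, by positivity, fun s a hs => ?_⟩
  have hpt : ∀ x, |hermiteH (j + 1) (synthInv a x) s| ≤
      hermiteH (j + 3) (synthInv a x) s + (C3 + C1) := fun x => by
    set y := synthInv a x
    have e1 := h1 y s hs
    have e2 := h2 y s hs
    have e3 := h3 y
    have e4 : C2 * (1 + |y|) ^ (j + 1) ≤ C2 * (1 + |y|) ^ (j + 2) := by
      gcongr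
      · linarith [abs_nonneg y]
      · omega
    simp only [Nat.add_assoc, Nat.reduceAdd] at e1 e2 e3 e4 ⊢
    linarith
  have hi := (integrable_hermiteH_synthInv (j + 3) s a).add (integrable_const (C3 + C1))
  have e : potential (j + 3) s a + (C3 + C1) =
      ∫ x, (hermiteH (j + 3) (synthInv a x) s + (C3 + C1)) ∂torusMeasure := by
    rw [integral_add (integrable_hermiteH_synthInv (j + 3) s a) (integrable_const _)]
    simp [potential]
  have h5 : |potential (j + 1) s a| ≤ potential (j + 3) s a + (C3 + C1) := by
    rw [e]
    exact (abs_integral_le_integral_abs).trans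
      (integral_mono (integrable_hermiteH_synthInv (j + 1) s a).abs hi hpt)
  exact ⟨h5, (abs_nonneg _).trans h5⟩

theorem sq_norm_state_le (y : State) : ‖y‖ ^ 2 ≤ ‖y.1‖ ^ 2 + ‖y.2‖ ^ 2 := by
  rcases max_choice ‖y.1‖ ‖y.2‖ with h | h
  · rw [Prod.norm_def, h]; linarith [sq_nonneg ‖y.2‖]
  · rw [Prod.norm_def, h]; linarith [sq_nonneg ‖y.1‖]

/-- Global existence with a renormalization of class `C¹`, in the energy space. -/
theorem exists_global_of_smooth_variance {j : ℕ} (hj : Even (j + 3)) {σ σ' : ℝ → ℝ}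
    (h : IsForcing (j + 2) (fun _ => 0) σ) (hσ : ∀ t, HasDerivAt σ (σ' t) t) (hσ' : Continuous σ')
    (Y₀ : State) : ∃ Y : ℝ → State, Y 0 = Y₀ ∧
      IsPrimitive Y fun τ => vfield (j + 2) (σ τ) 0 τ (Y τ) := by
  obtain ⟨σm, hσm⟩ := h.bounded
  obtain ⟨C, hC0, hC⟩ := potential_coercive σm hj
  refine h.exists_global Y₀ fun T => ?_
  obtain ⟨B, hB⟩ := (isCompact_Icc (a := -(T : ℝ)) (b := T)).exists_bound_of_continuousOn
    hσ'.continuousOn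
  have hB0 : 0 ≤ B := (norm_nonneg _).trans (hB 0 (by simp))
  -- (j+2)/2 · |σ'| is the coefficient in the energy identity; j + 3 undoes the normalisation of the
  -- potential.
  set L : ℝ := (j + 2) / 2 * B * (j + 3) with hL
  have hL0 : 0 ≤ L := by positivity
  set D : ℝ := (energy j (σ 0) 0 Y₀ + C) * Real.exp (L * T) with hD
  -- The bound here does not depend on R; the 1 makes the inequality strict.
  refine ⟨Real.sqrt (2 * |D|) + 1, fun R hR Y Z t hYc ht hYR hZ hZ0 hZY => ?_⟩
  have hE := isPrimitive_energy j (f := fun τ => force (j + 2) (σ τ) (0 + synth (pos τ (Y τ)))) hZ hσ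
    hσ'
  have hj3 : (1 : ℝ) ≤ j + 3 := by linarith [(Nat.cast_nonneg j : (0 : ℝ) ≤ j)]
  have hdiv : ∀ τ, (‖(Z τ).1‖ ^ 2 + ‖(Z τ).2‖ ^ 2) / 2 +
      (potential (j + 3) (σ τ) (rot τ (Z τ)) + C) / (j + 3) ≤ energy j (σ τ) τ (Z τ) + C := fun τ => by
    have : C / (j + 3) ≤ C := div_le_self hC0 hj3
    rw [energy, add_div (potential _ _ _)]
    linarith
  have hpos : ∀ τ, 0 ≤ (potential (j + 3) (σ τ) (rot τ (Z τ)) + C) / ((j : ℝ) + 3) := fun τ =>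
    div_nonneg (hC _ _ (hσm τ)).2 (by positivity)
  have hnn : ∀ τ, 0 ≤ energy j (σ τ) τ (Z τ) + C := fun τ =>
    le_trans (add_nonneg (by positivity) (hpos τ)) (hdiv τ)
  have hE2 := hE.add (isPrimitive_of_hasDerivAt (fun t => hasDerivAt_const t C) continuous_const)
  have key := le_of_abs_deriv_le hE2 hnn (M := fun _ => 0) (locallyIntegrable_const 0)
    (fun _ => le_rfl) hL0 ht (Eventually.of_forall fun τ hτ => ?_)
  · simp only [integral_zero, add_zero, hZ0] at key
    have h1 : ‖Z t‖ ^ 2 ≤ 2 * |D| := by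
      have := sq_norm_state_le (Z t)
      have h2 := hdiv t
      have h3 := hpos t
      have h4 := le_abs_self D
      linarith
    have h2 : ‖Z t‖ ≤ Real.sqrt (2 * |D|) := Real.le_sqrt_of_sq_le h1
    linarith
  · have hZτ := hZY τ hτ
    simp only [zero_add, hZτ, sub_self, inner_zero_right, zero_sub, add_zero, abs_neg]
    rw [← hZτ]
    have hτT : τ ∈ Set.Icc (-(T : ℝ)) T :=
      Set.uIcc_subset_Icc (by simp) (abs_le.mp ht) hτ
    have h1 : |potential (j + 1) (σ τ) (rot τ (Z τ))| ≤
        (j + 3) * (energy j (σ τ) τ (Z τ) + C) := by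
      have h2 := hdiv τ
      have h3 : (potential (j + 3) (σ τ) (rot τ (Z τ)) + C) / (j + 3) ≤
        energy j (σ τ) τ (Z τ) + C := by
        have : 0 ≤ (‖(Z τ).1‖ ^ 2 + ‖(Z τ).2‖ ^ 2) / 2 := by positivity
        linarith
      rw [div_le_iff₀ (by positivity)] at h3
      linarith [(hC (σ τ) (rot τ (Z τ)) (hσm τ)).1]
    rw [abs_mul, abs_mul, abs_of_nonneg (by positivity : (0 : ℝ) ≤ (j + 2) / 2)]
    calc _ ≤ ((j : ℝ) + 2) / 2 * ((j + 3) * (energy j (σ τ) τ (Z τ) + C)) * B := by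
          refine mul_le_mul (mul_le_mul_of_nonneg_left h1 (by positivity)) (hB τ hτT)
            (abs_nonneg _) (mul_nonneg (by positivity) (mul_nonneg (by positivity) ?_))
          exact hnn τ
      _ = _ := by rw [hL]; ring

/-- Powers are absorbed by one more unit in the exponent; 24 and 720 are 4! and 6!. -/
theorem pow_four_mul_exp_add_pow_six_le (c : ℝ) (hc : 0 ≤ c) : ∃ C : ℝ, 0 ≤ C ∧
    ∀ z : ℝ, z ^ 4 * Real.exp (2 * c * |z|) + z ^ 6 ≤ C * Real.exp ((2 * c + 1) * |z|) := by
  refine ⟨24 + 720, by norm_num, fun z => ?_⟩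
  have h4 := Real.pow_div_factorial_le_exp |z| (abs_nonneg z) 4
  have h6 := Real.pow_div_factorial_le_exp |z| (abs_nonneg z) 6
  rw [div_le_iff₀ (by positivity)] at h4 h6
  have e4 : |z| ^ 4 = z ^ 4 := Even.pow_abs (by decide) z
  have e6 : |z| ^ 6 = z ^ 6 := Even.pow_abs (by decide) z
  have f4 : ((4).factorial : ℝ) = 24 := by norm_num [Nat.factorial]
  have f6 : ((6).factorial : ℝ) = 720 := by norm_num [Nat.factorial]
  rw [e4, f4] at h4
  rw [e6, f6] at h6
  have h1 : 1 ≤ Real.exp (2 * c * |z|) := Real.one_le_exp (by positivity)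
  rw [show (2 * c + 1) * |z| = 2 * c * |z| + |z| by ring, Real.exp_add]
  have h7 := mul_le_mul_of_nonneg_right h4 (Real.exp_nonneg (2 * c * |z|))
  have h8 : Real.exp |z| * 720 ≤ Real.exp |z| * 720 * Real.exp (2 * c * |z|) :=
    le_mul_of_one_le_right (by positivity) h1
  linarith

/-- Where |z| > K one may insert e^{c(|z| - K)} ≥ 1 and split z²e^{c|z|} · e^{-cK}u⁴ by Young. The
level K stays free: it is later taken logarithmic in the bound on u. -/
theorem sq_mul_pow_four_le {c K : ℝ} (hc : 0 ≤ c) (z u : ℝ) :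
    z ^ 2 * u ^ 4 ≤ K ^ 2 * u ^ 4 + z ^ 4 * Real.exp (2 * c * |z|) + Real.exp (-(2 * c * K)) * u ^ 8 := by
  rcases le_or_gt |z| K with h | h
  · have h1 : z ^ 2 ≤ K ^ 2 := sq_le_sq' (by linarith [abs_le.mp h]) (abs_le.mp h).2
    have h2 : z ^ 2 * u ^ 4 ≤ K ^ 2 * u ^ 4 := by gcongr
    have h3 : 0 ≤ z ^ 4 * Real.exp (2 * c * |z|) := by positivity
    have h4 : 0 ≤ Real.exp (-(2 * c * K)) * u ^ 8 := by positivity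
    linarith
  · have h1 : 1 ≤ Real.exp (c * |z|) * Real.exp (-(c * K)) := by
      rw [← Real.exp_add]
      exact Real.one_le_exp (by nlinarith)
    have e1 : Real.exp (2 * c * |z|) = Real.exp (c * |z|) ^ 2 := by
      rw [← Real.exp_nat_mul]; congr 1; push_cast; ring
    have e2 : Real.exp (-(2 * c * K)) = Real.exp (-(c * K)) ^ 2 := by
      rw [← Real.exp_nat_mul]; congr 1; push_cast; ring
    have h2 : z ^ 2 * u ^ 4 ≤ z ^ 2 * u ^ 4 * (Real.exp (c * |z|) * Real.exp (-(c * K))) :=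
      le_mul_of_one_le_right (by positivity) h1
    rw [e1, e2]
    have h3 : 0 ≤ K ^ 2 * u ^ 4 := by positivity
    nlinarith [sq_nonneg (z ^ 2 * Real.exp (c * |z|) - Real.exp (-(c * K)) * u ^ 4),
      sq_nonneg (z ^ 2 * Real.exp (c * |z|)), sq_nonneg (Real.exp (-(c * K)) * u ^ 4)]

theorem abs_potential_le (σm : ℝ) (k : ℕ) : ∃ C : ℝ≥0, ∀ (s : ℝ) (a : Ell2), |s| ≤ σm →
    |potential k s a| ≤ C * (1 + ‖a‖) ^ k := by
  obtain ⟨C, hC⟩ := enorm_force_le σm k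
  obtain ⟨B, hB⟩ := tnorm_synth_invOp_le (4 * k)
  refine ⟨‖oneLp‖₊ * (C * (1 + B) ^ k), fun s a hs => ?_⟩
  have h := (hC s (synthInv a) hs).trans (mul_le_mul_right (pow_le_pow_left' (add_le_add
    le_rfl (hB a)) k) _)
  rw [enorm_eq_nnnorm, enorm_eq_nnnorm] at h
  have h' : ‖force k s (synthInv a)‖₊ ≤ C * (1 + B * ‖a‖₊) ^ k := by exact_mod_cast h
  have h2 : ‖force k s (synthInv a)‖₊ ≤ C * (1 + B) ^ k * (1 + ‖a‖₊) ^ k := by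
    refine h'.trans ?_
    rw [mul_assoc, ← mul_pow]
    refine mul_le_mul_right (pow_le_pow_left' ?_ k) _
    calc 1 + B * ‖a‖₊ ≤ 1 + B * ‖a‖₊ + (B + ‖a‖₊) := le_self_add
      _ = _ := by ring
  have h3 := NNReal.coe_le_coe.mpr h2
  push_cast at h3 ⊢
  rw [potential_eq_inner, mul_assoc]
  exact (abs_real_inner_le_norm _ _).trans (mul_le_mul_of_nonneg_left h3 (norm_nonneg _))

/-- `∫ e^{c|q|}`. -/
def expMoment (c : ℝ) (q : Lp ℝ 2 torusMeasure) : ℝ≥0∞ :=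
  ∫⁻ x, ENNReal.ofReal (Real.exp (c * |q x|)) ∂torusMeasure

theorem aemeasurable_expMoment (c : ℝ) {z : ℝ → Lp ℝ 2 torusMeasure} (hz : Continuous z) :
    AEMeasurable fun t => expMoment c (z t) :=
  aemeasurable_lintegral_comp (θ := fun _ y _ => ENNReal.ofReal (Real.exp (c * |y|)))
    (σ := fun _ => 0) (fun x => ENNReal.continuous_ofReal.comp (by fun_prop)) (by fun_prop) hz.aestronglyMeasurable
    aestronglyMeasurable_const

theorem integrable_exp_of_expMoment {c : ℝ} {q : Lp ℝ 2 torusMeasure} (h : expMoment c q ≠ ∞) :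
    Integrable (fun x => Real.exp (c * |q x|)) torusMeasure := by
  refine ⟨?_, ?_⟩
  · exact (by fun_prop : Continuous fun y : ℝ => Real.exp (c * |y|)).comp_aestronglyMeasurable
      (aestronglyMeasurable_lp q)
  · rw [hasFiniteIntegral_iff_ofReal (Eventually.of_forall fun x => (Real.exp_pos _).le)]
    exact h.lt_top

theorem integral_exp_eq {c : ℝ} (q : Lp ℝ 2 torusMeasure) :
    ∫ x, Real.exp (c * |q x|) ∂torusMeasure = (expMoment c q).toReal :=
  integral_eq_lintegral_of_nonneg_ae (Eventually.of_forall fun x => (Real.exp_pos _).le)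
    ((by fun_prop : Continuous fun y : ℝ => Real.exp (c * |y|)).comp_aestronglyMeasurable
      (aestronglyMeasurable_lp q))

/-- |y|^{4k} ≤ (4k)! e^{|y|}, so the exponential moment with c = 1 controls the L^{4k} norm to the
power 4k. -/
theorem isForcing_of_expMoment {k : ℕ} (hk : 1 ≤ k) {z : ℝ → Lp ℝ 2 torusMeasure} {σ : ℝ → ℝ}
    (hz : Continuous z) (hσ : Continuous σ) (hb : ∃ σm, ∀ t, |σ t| ≤ σm)
    (hexp : ∀ T : ℝ, ∫⁻ t in Set.Icc (-T) T, expMoment 1 (z t) < ∞) : IsForcing k z σ := by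
  refine ⟨hz, hσ, hb, fun T => ?_⟩
  have h1 : ∀ τ : ℝ≥0∞, (1 + τ) ^ k ≤ 2 ^ (4 * k) * (1 + τ ^ (4 * k)) := fun τ => by
    refine (pow_le_pow_right₀ le_self_add (by omega : k ≤ 4 * k)).trans ?_
    rcases le_total 1 τ with h | h
    · calc (1 + τ) ^ (4 * k) ≤ (2 * τ) ^ (4 * k) := by
            refine pow_le_pow_left' ?_ _
            rw [two_mul]; gcongr
        _ = 2 ^ (4 * k) * τ ^ (4 * k) := mul_pow _ _ _
        _ ≤ _ := mul_le_mul_right le_add_self _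
    · calc (1 + τ) ^ (4 * k) ≤ 2 ^ (4 * k) := by
            refine pow_le_pow_left' ?_ _
            rw [← one_add_one_eq_two]; gcongr
        _ = 2 ^ (4 * k) * 1 := (mul_one _).symm
        _ ≤ _ := mul_le_mul_right le_self_add _
  have h2 : ∀ q : Lp ℝ 2 torusMeasure, tnorm (4 * k) q ^ (4 * k) ≤
      ENNReal.ofReal ((4 * k).factorial) * expMoment 1 q := fun q => by
    rw [tnorm_pow_eq_lintegral (by omega), expMoment, ← lintegral_const_mul' _ _ (by simp)]
    refine lintegral_mono fun x => ?_
    rw [← ENNReal.ofReal_mul (by positivity), ← ofReal_norm, ← ENNReal.ofReal_pow (norm_nonneg _)]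
    refine ENNReal.ofReal_le_ofReal ?_
    have := Real.pow_div_factorial_le_exp |q x| (abs_nonneg _) (4 * k)
    rw [div_le_iff₀ (by positivity)] at this
    rw [Real.norm_eq_abs, one_mul]
    linarith
  calc _ ≤ ∫⁻ t in Set.Icc (-T) T, 2 ^ (4 * k) * (1 + ENNReal.ofReal ((4 * k).factorial) *
        expMoment 1 (z t)) :=
        lintegral_mono fun t => (h1 _).trans (mul_le_mul_right (add_le_add le_rfl (h2 _)) _)
    _ = 2 ^ (4 * k) * (volume (Set.Icc (-T) T) + ENNReal.ofReal ((4 * k).factorial) *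
        ∫⁻ t in Set.Icc (-T) T, expMoment 1 (z t)) := by
        rw [lintegral_const_mul' _ _ (by simp), lintegral_add_left measurable_const,
          lintegral_const_mul' _ _ (by simp)]
        simp
    _ < ∞ := by
        refine ENNReal.mul_lt_top (by simp) (ENNReal.add_lt_top.mpr ⟨by simp, ?_⟩)
        exact ENNReal.mul_lt_top (by simp) (hexp T)

/-- The difference between the cubic force and the renormalized force with a rough field. -/
theorem norm_sq_force_three_sub_le (σm : ℝ) : ∃ A : ℝ, 0 ≤ A ∧ ∀ c : ℝ, 0 ≤ c → ∃ C : ℝ, 0 ≤ C ∧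
    ∀ (K s : ℝ) (q : Lp ℝ 2 torusMeasure) (a : Ell2), |s| ≤ σm → tnorm (4 * 3) q ≠ ∞ →
      expMoment (2 * c + 1) q ≠ ∞ →
      ‖force 3 0 (synthInv a) - force 3 s (q + synthInv a)‖ ^ 2 ≤
        A * ((K ^ 2 + 1) * potential 4 0 a + C * (expMoment (2 * c + 1) q).toReal +
          Real.exp (-(2 * c * K)) * potential 8 0 a + 1) := by
  -- A must not depend on c, since c is chosen from A in the global argument.
  refine ⟨100 + 100 * σm ^ 2, by positivity, fun c hc => ?_⟩
  obtain ⟨C, hC, h⟩ := pow_four_mul_exp_add_pow_six_le c hc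
  refine ⟨C, hC, fun K s q a hs hq hexp => ?_⟩
  have hm1 := memLp_hermiteH_synthInv 3 0 a
  have hm2 : MemLp (fun x => hermiteH 3 ((q + synthInv a : Lp ℝ 2 torusMeasure) x) s) 2
      torusMeasure := by
    refine memLp_hermiteH _ (aestronglyMeasurable_lp _) (ne_top_of_le_ne_top
      (b := tnorm (4 * 3) q + tnorm (4 * 3) (synthInv a))
      (ENNReal.add_ne_top.mpr ⟨hq, tnorm_synthInv_ne_top _ a⟩) ?_)
    rw [tnorm_congr (Lp.coeFn_add q (synthInv a))]
    exact tnorm_add_le (by norm_num) (aestronglyMeasurable_lp _) (aestronglyMeasurable_lp _)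
  rw [← real_inner_self_eq_norm_sq, inner_lp]
  have i4 : Integrable (fun x => synthInv a x ^ 4) torusMeasure := by
    simpa only [hermiteH_zero_variance] using integrable_hermiteH_synthInv 4 0 a
  have i8 : Integrable (fun x => synthInv a x ^ 8) torusMeasure := by
    simpa only [hermiteH_zero_variance] using integrable_hermiteH_synthInv 8 0 a
  have ie := integrable_exp_of_expMoment hexp
  have p4 : potential 4 0 a = ∫ x, synthInv a x ^ 4 ∂torusMeasure := by
    simp only [potential, hermiteH_zero_variance]
  have p8 : potential 8 0 a = ∫ x, synthInv a x ^ 8 ∂torusMeasure := by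
    simp only [potential, hermiteH_zero_variance]
  have e : (100 + 100 * σm ^ 2) * ((K ^ 2 + 1) * potential 4 0 a +
      C * (expMoment (2 * c + 1) q).toReal + Real.exp (-(2 * c * K)) * potential 8 0 a + 1) =
      ∫ x, (100 + 100 * σm ^ 2) * ((K ^ 2 + 1) * synthInv a x ^ 4 +
        C * Real.exp ((2 * c + 1) * |q x|) + Real.exp (-(2 * c * K)) * synthInv a x ^ 8 + 1)
        ∂torusMeasure := by
    have j1 := i4.const_mul (K ^ 2 + 1)
    have j2 := ie.const_mul C
    have j3 := i8.const_mul (Real.exp (-(2 * c * K)))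
    have j12 : Integrable (fun x => (K ^ 2 + 1) * synthInv a x ^ 4 +
        C * Real.exp ((2 * c + 1) * |q x|)) torusMeasure := j1.add j2
    have j123 : Integrable (fun x => (K ^ 2 + 1) * synthInv a x ^ 4 +
        C * Real.exp ((2 * c + 1) * |q x|) + Real.exp (-(2 * c * K)) * synthInv a x ^ 8)
        torusMeasure := j12.add j3
    rw [integral_const_mul, integral_add j123 (integrable_const _), integral_add j12 j3,
      integral_add j1 j2, integral_const_mul, integral_const_mul, integral_const_mul, p4, p8,
      integral_exp_eq]
    simp
  rw [e]
  refine integral_mono_ae (integrable_mul_lp _ _) ?_ ?_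
  · exact ((((i4.const_mul _).add (ie.const_mul _)).add (i8.const_mul _)).add
      (integrable_const _)).const_mul _
  · filter_upwards [Lp.coeFn_sub (force 3 0 (synthInv a)) (force 3 s (q + synthInv a)),
      force_ae hm1, force_ae hm2, Lp.coeFn_add q (synthInv a)] with x h1 h2 h3 h4
    rw [h1, Pi.sub_apply, h2, h3, h4, Pi.add_apply, hermiteH_zero_variance]
    have h5 := sq_hermiteH_three_sub_le (z := q x) (u := synthInv a x) hs
    have h6 := sq_mul_pow_four_le (K := K) hc (q x) (synthInv a x)
    have h7 := h (q x)
    calc _ = (hermiteH 3 (q x + synthInv a x) s - synthInv a x ^ 3) ^ 2 := by ring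
      _ ≤ _ := h5
      _ ≤ _ := by
        gcongr ?_ * ?_
        linarith

/-- Young's inequality with weight lam, i.e. 2‖w‖‖g‖ ≤ lam‖w‖² + ‖g‖²/lam. The square lam² in front
of P becomes the first power in Grönwall's rate, and only a rate linear in the cut-off gives a bound
linear in R. -/
theorem inner_vel_le {E A P M lam : ℝ} {w g : Lp ℝ 2 torusMeasure} (hlam : 1 ≤ lam) (hA : 0 ≤ A)
    (hM : 0 ≤ M) (hP : P ≤ 4 * E) (hw : ‖w‖ ^ 2 ≤ 2 * E) (hg : ‖g‖ ^ 2 ≤ A * (lam ^ 2 * P + M)) :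
    |inner ℝ w g| ≤ (1 + 2 * A) * lam * E + A * M / 2 := by
  have h1 := abs_real_inner_le_norm w g
  have hE : 0 ≤ E := by nlinarith [sq_nonneg ‖w‖]
  have h2 : 2 * lam * (‖w‖ * ‖g‖) ≤ lam ^ 2 * ‖w‖ ^ 2 + ‖g‖ ^ 2 := by
    nlinarith [sq_nonneg (lam * ‖w‖ - ‖g‖)]
  have h3 : A * (lam ^ 2 * P + M) ≤ A * (lam ^ 2 * (4 * E)) + A * M := by
    rw [mul_add]
    gcongr
  have h4 : lam ^ 2 * ‖w‖ ^ 2 ≤ lam ^ 2 * (2 * E) := by gcongr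
  have h5 : A * M ≤ lam * (A * M) := le_mul_of_one_le_left (by positivity) hlam
  have h6 : 2 * lam * (‖w‖ * ‖g‖) ≤ 2 * lam * ((1 + 2 * A) * lam * E + A * M / 2) := by
    nlinarith
  exact h1.trans (le_of_mul_le_mul_left h6 (by linarith))

/-- Global existence for the cubic equation with a rough field. -/
theorem exists_global_of_expMoment {z : ℝ → Lp ℝ 2 torusMeasure} {σ : ℝ → ℝ}
    (hz : Continuous z) (hσ : Continuous σ) (hb : ∃ σm, ∀ t, |σ t| ≤ σm)
    (hexp : ∀ c T : ℝ, ∫⁻ t in Set.Icc (-T) T, expMoment c (z t) < ∞) (Y₀ : State) :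
    ∃ Y : ℝ → State, Y 0 = Y₀ ∧ IsPrimitive Y fun τ => vfield 3 (σ τ) (z τ) τ (Y τ) := by
  have h : IsForcing 3 z σ := isForcing_of_expMoment (by norm_num) hz hσ hb (hexp 1)
  obtain ⟨σm, hσm⟩ := h.bounded
  obtain ⟨A, hA, hAc⟩ := norm_sq_force_three_sub_le σm
  obtain ⟨B, hB⟩ := abs_potential_le 0 8
  refine IsForcing.exists_global (j := 2) h Y₀ fun T => ?_
  -- With K below, 2cK = 8 log(1 + 2R), so e^{-2cK} compensates exactly the bound (1 + 2R)⁸ on ∫u⁸.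
  set c : ℝ := 4 * ((1 + 2 * A) * (T + 1)) with hc
  have hT1 : (0 : ℝ) < T + 1 := by positivity
  have hc0 : 0 < c := by positivity
  obtain ⟨C, hC, hF⟩ := hAc c hc0.le
  obtain ⟨hMint, hMfin⟩ := locallyIntegrable_toReal
    (aemeasurable_expMoment (2 * c + 1) hz) (hexp (2 * c + 1))
  set M : ℝ → ℝ := fun t => A * (C * (expMoment (2 * c + 1) (z t)).toReal + (B + 1)) / 2 with hM
  have hM0 : ∀ t, 0 ≤ M t := fun t => by
    have : 0 ≤ (expMoment (2 * c + 1) (z t)).toReal := ENNReal.toReal_nonneg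
    positivity
  have hMloc : LocallyIntegrable M := by
    have h1 := (((hMint.smul C).add (locallyIntegrable_const (B + 1 : ℝ))).smul (A / 2))
    refine h1.congr (Eventually.of_forall fun t => ?_)
    simp [hM]
    ring
  set D : ℝ := (energy 1 0 0 Y₀ + ∫ τ in Set.Icc (-((T : ℝ) + 1)) (T + 1), M τ) *
    Real.exp ((1 + 2 * A) * (T + 1)) with hD
  -- For such R the outcome ‖Z t‖² ≤ 2|D|(1 + 2R) lies strictly below R².
  refine ⟨4 * |D| + 2, fun R hR Y Z t hYc ht hYR hZ hZ0 hZY => ?_⟩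
  have hR0 : 0 ≤ R := by linarith [abs_nonneg D]
  -- The cut level is chosen so that Grönwall's factor e^{(1+2A)(K+1)(T+1)} is a constant times 1 +
  -- 2R.
  set K : ℝ := Real.log (1 + 2 * R) / ((1 + 2 * A) * (T + 1)) with hK
  have hK0 : 0 ≤ K := div_nonneg (Real.log_nonneg (by linarith)) (by positivity)
  -- The energy has zero variance, i.e. potential ¼∫u⁴, while the force is the true renormalized
  -- one.
  have hE := isPrimitive_energy 1 (f := fun τ => force 3 (σ τ) (z τ + synth (pos τ (Y τ)))) hZ
    (ς := fun _ => 0) (ς' := fun _ => 0) (fun t => hasDerivAt_const t 0) continuous_const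
  simp only [mul_zero, sub_zero, Nat.reduceAdd] at hE
  have hpot : ∀ τ, 0 ≤ potential 4 0 (rot τ (Z τ)) := fun τ => by
    refine integral_nonneg fun x => ?_
    simp only [hermiteH_zero_variance]
    positivity
  have hen : ∀ τ, energy 1 0 τ (Z τ) = (‖(Z τ).1‖ ^ 2 + ‖(Z τ).2‖ ^ 2) / 2 +
      potential 4 0 (rot τ (Z τ)) / 4 := fun τ => by
    rw [energy]; norm_num
  have hnn : ∀ τ, 0 ≤ energy 1 0 τ (Z τ) := fun τ => by
    have := hpot τ
    rw [hen]
    positivity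
  have key := le_of_abs_deriv_le hE hnn hMloc hM0 (L := (1 + 2 * A) * (K + 1)) (T := T + 1)
    (t := t) (by positivity) (by linarith) ?_
  · have hexpo : Real.exp ((1 + 2 * A) * (K + 1) * (T + 1)) =
        (1 + 2 * R) * Real.exp ((1 + 2 * A) * (T + 1)) := by
      rw [show (1 + 2 * A) * (K + 1) * ((T : ℝ) + 1) = Real.log (1 + 2 * R) +
        (1 + 2 * A) * (T + 1) by rw [hK]; field_simp, Real.exp_add, Real.exp_log (by linarith)]
    rw [hexpo, hZ0] at key
    have h1 : energy 1 0 t (Z t) ≤ |D| * (1 + 2 * R) := by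
      refine key.trans ?_
      rw [mul_left_comm, mul_comm]
      exact mul_le_mul_of_nonneg_right (le_abs_self D) (by linarith)
    have h2 := sq_norm_state_le (Z t)
    rw [hen] at h1
    have h3 : ‖Z t‖ ^ 2 < R ^ 2 := by nlinarith [hpot t, abs_nonneg D]
    exact lt_of_pow_lt_pow_left₀ 2 hR0 h3
  · filter_upwards [hMfin, (h.weight (by norm_num)).2] with τ hτ1 hτ2 hτ
    have hZτ := hZY τ hτ
    have hf := hF K (σ τ) (z τ) (rot τ (Y τ)) (hσm τ) hτ2 hτ1
    have hP8 : Real.exp (-(2 * c * K)) * potential 8 0 (rot τ (Y τ)) ≤ B := by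
      have h1 := (le_abs_self _).trans (hB 0 (rot τ (Y τ)) (by simp))
      have h2 : ‖rot τ (Y τ)‖ ≤ 2 * R := (norm_rot_le _ _).trans (by linarith [hYR τ hτ])
      have h3 : potential 8 0 (rot τ (Y τ)) ≤ B * (1 + 2 * R) ^ 8 := h1.trans (by gcongr)
      have h4 : Real.exp (-(2 * c * K)) = ((1 + 2 * R) ^ 8)⁻¹ := by
        rw [show 2 * c * K = (8 : ℕ) * Real.log (1 + 2 * R) by
          rw [hK, hc]; push_cast; field_simp; ring, Real.exp_neg, Real.exp_nat_mul,
          Real.exp_log (by linarith)]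
      have hpos : 0 < (1 + 2 * R) ^ 8 := by positivity
      rw [h4, inv_mul_le_iff₀ hpos]
      linarith
    rw [hZτ]
    have hen' := hen τ
    rw [hZτ] at hen'
    have hpot' := hpot τ
    rw [hZτ] at hpot'
    have hvr := norm_vel_sq_add_norm_rot_sq τ (Y τ)
    have hle := inner_vel_le (E := energy 1 0 τ (Y τ)) (A := A) (P := potential 4 0 (rot τ (Y τ)))
      (M := C * (expMoment (2 * c + 1) (z τ)).toReal + (B + 1)) (lam := K + 1)
      (w := synth (vel τ (Y τ))) (g := force 3 0 (synthInv (rot τ (Y τ))) -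
        force 3 (σ τ) (z τ + synthInv (rot τ (Y τ)))) (by linarith) hA
      (by have : 0 ≤ (expMoment (2 * c + 1) (z τ)).toReal := ENNReal.toReal_nonneg
          positivity) ?_ ?_ ?_
    · exact hle
    · rw [hen']
      nlinarith [sq_nonneg ‖(Y τ).1‖, sq_nonneg ‖(Y τ).2‖]
    · have h1 : ‖synth (vel τ (Y τ))‖ ^ 2 ≤ ‖vel τ (Y τ)‖ ^ 2 := by
        gcongr
        exact norm_synth_le _
      rw [hen']
      nlinarith [sq_nonneg ‖rot τ (Y τ)‖]
    · refine hf.trans (mul_le_mul_of_nonneg_left ?_ hA)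
      nlinarith

end GlobalExistence

end

end RenormNLW

namespace RenormNLW

noncomputable section

/-! ### Uniqueness -/

section Uniqueness

theorem abs_bracket_rpow_neg_half_le (n : Freq) : |bracket n ^ (-(1 / 2 : ℝ))| ≤ 1 :=
  abs_bracket_rpow_neg_le (by norm_num) n

/-- The operator `⟨∇⟩^{-1/2}`. -/
def halfOp : Ell2 →L[ℝ] Ell2 := diag _ abs_bracket_rpow_neg_half_le

theorem halfOp_apply (a : Ell2) (n : Freq) :
    halfOp a n = ((bracket n ^ (-(1 / 2 : ℝ)) : ℝ) : ℂ) * a n := rfl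

theorem eLpNorm_synthC_halfOp_le :
    ∃ C : ℝ≥0, ∀ a : Ell2, eLpNorm (synthC (halfOp a)) 4 torusMeasure ≤ C * ‖a‖ₑ := by
  obtain ⟨C, hC⟩ := sobolev_embedding (p := 4) (by norm_num)
  refine ⟨C, fun a => ?_⟩
  have hm : ∀ n, |bracket n ^ (-(1 - 2 / 4 : ℝ))| ≤ 1 :=
    fun n => abs_bracket_rpow_neg_le (by norm_num) n
  have h := hC hm a
  have e : diag (fun n => bracket n ^ (-(1 - 2 / 4 : ℝ))) hm a = halfOp a := by
    ext n
    rw [diag_apply, halfOp_apply]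
    norm_num
  rw [e] at h
  simpa using h

theorem tnorm_synth_halfOp_le :
    ∃ C : ℝ≥0, ∀ a : Ell2, tnorm 4 (synth (halfOp a)) ≤ C * ‖a‖ₑ := by
  obtain ⟨C, hC⟩ := eLpNorm_synthC_halfOp_le
  refine ⟨C, fun a => le_trans ?_ (hC a)⟩
  rw [tnorm, Nat.cast_ofNat]
  refine eLpNorm_mono_ae ?_
  filter_upwards [synth_ae (halfOp a)] with x hx
  rw [hx]
  exact Complex.abs_re_le_norm _

/-- The dual Sobolev embedding `L^{4/3} ⊂ H^{-1/2}`, for products. -/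
theorem exists_sum_coeff_sq_le : ∃ C : ℝ≥0, ∀ (h d Q : Torus → ℝ),
    AEStronglyMeasurable d torusMeasure → AEStronglyMeasurable Q torusMeasure →
    Integrable h torusMeasure → (∀ᵐ x ∂torusMeasure, |h x| ≤ |d x| * |Q x|) →
    tnorm 4 d ≠ ∞ → tnorm 2 Q ≠ ∞ → ∀ S : Finset Freq,
    ∑ n ∈ S, ‖((bracket n ^ (-(1 / 2 : ℝ)) : ℝ) : ℂ) * coeff h n‖ ^ 2 ≤
      (C * (tnorm 4 d * tnorm 2 Q).toReal) ^ 2 := by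
  classical
  obtain ⟨C, hC⟩ := eLpNorm_synthC_halfOp_le
  refine ⟨C, fun h d Q hd hQ hh hle hdfin hQfin S => ?_⟩
  set c : Freq → ℂ := fun n => ((bracket n ^ (-(1 / 2 : ℝ)) : ℝ) : ℂ) * coeff h n with hc
  -- Duality by self-testing: pairing h with the trigonometric polynomial ⟨∇⟩^{-1/2}a gives ‖a‖² =
  -- X, and Hölder with the embedding H^{1/2} ⊂ L⁴ bounds the pairing by C‖a‖ times the norms of d
  -- and Q.
  set a : Ell2 := ∑ n ∈ S, lp.single 2 n (c n) with ha
  have han : ∀ n, a n = if n ∈ S then c n else 0 := fun n => by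
    rw [ha, lp.coeFn_sum, Finset.sum_apply]
    simp only [lp.single_apply, Pi.single_apply]
    rw [Finset.sum_ite_eq]
  set X : ℝ := ∑ n ∈ S, ‖c n‖ ^ 2 with hX
  have hX0 : 0 ≤ X := Finset.sum_nonneg fun n _ => by positivity
  have hanorm : ‖a‖ ^ 2 = X := by
    rw [norm_sq_eq_tsum, tsum_eq_sum (s := S)]
    · exact Finset.sum_congr rfl fun n hn => by rw [han, if_pos hn]
    · intro n hn
      rw [han, if_neg hn]
      simp
  have hsum := synthC_ae_sum (a := halfOp a) (S := S) fun n hn => by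
    rw [halfOp_apply, han, if_neg hn, mul_zero]
  have key : (X : ℂ) = ∫ x, (h x : ℂ) * conj (synthC (halfOp a) x) ∂torusMeasure := by
    have h1 : ∫ x, (h x : ℂ) * conj (synthC (halfOp a) x) ∂torusMeasure =
        ∫ x, ∑ n ∈ S, conj (((bracket n ^ (-(1 / 2 : ℝ)) : ℝ) : ℂ) * c n) *
          (UnitAddTorus.mFourier (-n) x * (h x : ℂ)) ∂torusMeasure := by
      refine integral_congr_ae ?_
      filter_upwards [hsum] with x hx
      simp only [hx, map_sum, Finset.mul_sum]
      refine Finset.sum_congr rfl fun n hn => ?_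
      rw [halfOp_apply, han, if_pos hn, map_mul, UnitAddTorus.mFourier_neg]
      ring
    rw [h1, integral_finsetSum]
    · rw [hX, Complex.ofReal_sum]
      refine Finset.sum_congr rfl fun n _ => ?_
      rw [integral_const_mul]
      change _ = _ * coeff h n
      rw [map_mul, Complex.conj_ofReal, mul_right_comm, Complex.ofReal_pow, ← Complex.mul_conj']
    · intro n _
      refine Integrable.const_mul (hh.ofReal.bdd_mul (c := 1)
        (UnitAddTorus.mFourier (-n)).continuous.aestronglyMeasurable
        (Eventually.of_forall fun x => ?_)) _
      rw [norm_mFourier_apply]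
  set r : Torus → ℝ := fun x => ‖synthC (halfOp a) x‖ with hr
  have mr : AEStronglyMeasurable r torusMeasure := (Lp.aestronglyMeasurable _).norm
  have hr4 : tnorm 4 r ≤ C * ‖a‖ₑ := by
    refine le_trans (le_of_eq ?_) (hC a)
    rw [tnorm, Nat.cast_ofNat]
    exact eLpNorm_norm _
  have h2 : ENNReal.ofReal X ≤ tnorm 4 d * tnorm 2 Q * (C * ‖a‖ₑ) := by
    have e : ENNReal.ofReal X = ‖(X : ℂ)‖ₑ := by
      rw [← ofReal_norm, Complex.norm_real, Real.norm_of_nonneg hX0]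
    rw [e, key]
    refine (enorm_integral_le_lintegral_enorm _).trans ?_
    calc _ ≤ ∫⁻ x, ‖d x * r x * Q x‖ₑ ∂torusMeasure := by
          refine lintegral_mono_ae ?_
          filter_upwards [hle] with x hx
          rw [← ofReal_norm, ← ofReal_norm]
          refine ENNReal.ofReal_le_ofReal ?_
          rw [norm_mul, Complex.norm_real, RCLike.norm_conj, norm_mul, norm_mul, mul_right_comm]
          refine mul_le_mul hx (by simp [hr]) (norm_nonneg _) (by positivity)
      _ ≤ tnorm 2 (fun x => d x * r x) * tnorm 2 Q := lintegral_mul_le_tnorm (hd.mul mr) hQ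
      _ ≤ tnorm 4 d * tnorm 4 r * tnorm 2 Q := mul_le_mul_left (tnorm_two_mul_le hd mr) _
      _ ≤ tnorm 4 d * (C * ‖a‖ₑ) * tnorm 2 Q :=
          mul_le_mul_left (mul_le_mul_right hr4 _) _
      _ = _ := by ring
  have h3 := ENNReal.toReal_mono (ENNReal.mul_ne_top (ENNReal.mul_ne_top hdfin hQfin)
    (ENNReal.mul_ne_top ENNReal.coe_ne_top enorm_ne_top)) h2
  rw [ENNReal.toReal_ofReal hX0, ENNReal.toReal_mul, ENNReal.toReal_mul (a := (C : ℝ≥0∞)),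
    ENNReal.coe_toReal, toReal_enorm] at h3
  set B : ℝ := (tnorm 4 d * tnorm 2 Q).toReal with hB
  have hB0 : 0 ≤ B := ENNReal.toReal_nonneg
  change X ≤ _
  rw [← hanorm] at h3 ⊢
  have h4 : ‖a‖ ≤ C * B := by
    rcases (norm_nonneg a).eq_or_lt with h0 | h0
    · rw [← h0]; positivity
    · refine le_of_mul_le_mul_left ?_ h0
      linarith
  gcongr

theorem hermiteH_sub_abs_le (σm : ℝ) (j : ℕ) : ∃ C : ℝ≥0, ∀ a b s : ℝ, |s| ≤ σm →
    |hermiteH (j + 1) a s - hermiteH (j + 1) b s| ≤ |a - b| * |C * (1 + |a| + |b|) ^ j| := by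
  obtain ⟨C, hC, h⟩ := hermiteH_lipschitz σm j
  lift C to ℝ≥0 using hC
  refine ⟨C, fun a b s hs => (h a b s hs).trans (le_of_eq ?_)⟩
  rw [abs_of_nonneg (by positivity : 0 ≤ (C : ℝ) * (1 + |a| + |b|) ^ j), mul_comm]

theorem integrable_hermiteH_of_tnorm {j : ℕ} (s : ℝ) {f : Torus → ℝ}
    (hj : 1 ≤ j) (hf : AEStronglyMeasurable f torusMeasure) (hfin : tnorm (2 * j) f ≠ ∞) :
    Integrable (fun x => hermiteH (j + 1) (f x) s) torusMeasure := by
  obtain ⟨C, hC⟩ := tnorm_hermiteH_le |s| (j + 1)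
  refine memLp_one_iff_integrable.mp ⟨aestronglyMeasurable_hermiteH _ s hf, ?_⟩
  have h := hC 1 le_rfl f s hf le_rfl
  rw [tnorm, Nat.cast_one] at h
  refine h.trans_lt (ENNReal.mul_lt_top (by simp) (ENNReal.pow_lt_top (ENNReal.add_lt_top.mpr
    ⟨by simp, lt_of_le_of_lt (tnorm_mono (by omega) hf) hfin.lt_top⟩)))

/-- The contraction estimate in `H^{-1/2}` for the difference of two nonlinear terms. -/
theorem exists_sum_coeff_hermiteH_sub_le (σm : ℝ) {j : ℕ} (hj : 1 ≤ j) : ∃ C : ℝ≥0,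
    ∀ (s : ℝ) (U U' : Lp ℝ 2 torusMeasure), |s| ≤ σm → tnorm (2 * j) U ≠ ∞ →
      tnorm (2 * j) U' ≠ ∞ → tnorm 4 (U' - U : Lp ℝ 2 torusMeasure) ≠ ∞ → ∀ S : Finset Freq,
      ∑ n ∈ S, ‖((bracket n ^ (-(1 / 2 : ℝ)) : ℝ) : ℂ) *
        (coeff (fun x => hermiteH (j + 1) (U' x) s) n -
          coeff (fun x => hermiteH (j + 1) (U x) s) n)‖ ^ 2 ≤
        (C * (tnorm 4 (U' - U : Lp ℝ 2 torusMeasure)).toReal *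
          (1 + (tnorm (2 * j) U).toReal + (tnorm (2 * j) U').toReal) ^ j) ^ 2 := by
  obtain ⟨C, hC⟩ := exists_sum_coeff_sq_le
  obtain ⟨B, hB⟩ := hermiteH_sub_abs_le σm j
  refine ⟨C * B, fun s U U' hs hU hU' hd S => ?_⟩
  have mU := aestronglyMeasurable_lp U
  have mU' := aestronglyMeasurable_lp U'
  have i1 := integrable_hermiteH_of_tnorm s hj mU hU
  have i2 := integrable_hermiteH_of_tnorm s hj mU' hU'
  have hcoeff : ∀ n, coeff (fun x => hermiteH (j + 1) (U' x) s) n -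
      coeff (fun x => hermiteH (j + 1) (U x) s) n =
      coeff (fun x => hermiteH (j + 1) (U' x) s - hermiteH (j + 1) (U x) s) n := fun n => by
    have hb : ∀ f : Torus → ℝ, Integrable f torusMeasure →
        Integrable (fun x => UnitAddTorus.mFourier (-n) x * (f x : ℂ)) torusMeasure := fun f hf => by
      refine hf.ofReal.bdd_mul (c := 1) (UnitAddTorus.mFourier (-n)).continuous.aestronglyMeasurable
        (Eventually.of_forall fun x => ?_)
      rw [norm_mFourier_apply]
    refine (integral_sub (hb _ i2) (hb _ i1)).symm.trans ?_
    refine integral_congr_ae (Eventually.of_forall fun x => ?_)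
    simp only [smul_eq_mul]
    push_cast
    ring
  simp only [hcoeff]
  set Q : Torus → ℝ := fun x => B * (1 + |U' x| + |U x|) ^ j with hQ
  have mw : AEStronglyMeasurable (fun x => (1 + |U' x| + |U x|) ^ j) torusMeasure :=
    ((aestronglyMeasurable_const.add mU'.norm).add mU.norm).pow j
  have mQ : AEStronglyMeasurable Q torusMeasure := aestronglyMeasurable_const.mul mw
  have hQ2 : tnorm 2 Q ≤ B * (1 + tnorm (2 * j) U' + tnorm (2 * j) U) ^ j := by
    rw [hQ, tnorm_const_mul B (fun x => (1 + |U' x| + |U x|) ^ j)]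
    exact mul_le_mul_right (tnorm_weight_le (by norm_num) j mU' mU) _
  have hWfin : B * (1 + tnorm (2 * j) U' + tnorm (2 * j) U) ^ j ≠ ∞ :=
    ENNReal.mul_ne_top (by simp) (ENNReal.pow_ne_top (ENNReal.add_ne_top.mpr
      ⟨ENNReal.add_ne_top.mpr ⟨by simp, hU'⟩, hU⟩))
  have hQfin : tnorm 2 Q ≠ ∞ := ne_top_of_le_ne_top hWfin hQ2
  have h := hC (fun x => hermiteH (j + 1) (U' x) s - hermiteH (j + 1) (U x) s)
    (U' - U : Lp ℝ 2 torusMeasure) Q (aestronglyMeasurable_lp _) mQ (i2.sub i1) ?_ hd hQfin S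
  · refine h.trans (pow_le_pow_left₀ (by positivity) ?_ 2)
    rw [NNReal.coe_mul, mul_assoc, mul_assoc]
    refine mul_le_mul_of_nonneg_left ?_ C.coe_nonneg
    rw [ENNReal.toReal_mul, mul_left_comm]
    refine mul_le_mul_of_nonneg_left ?_ ENNReal.toReal_nonneg
    refine (ENNReal.toReal_mono hWfin hQ2).trans (le_of_eq ?_)
    rw [ENNReal.toReal_mul, ENNReal.toReal_pow, ENNReal.toReal_add
      (ENNReal.add_ne_top.mpr ⟨by simp, hU'⟩) hU, ENNReal.toReal_add (by simp) hU',
      ENNReal.coe_toReal, ENNReal.toReal_one]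
    ring
  · filter_upwards [Lp.coeFn_sub U' U] with x hx
    rw [hx, Pi.sub_apply]
    exact hB _ _ s hs

open Classical in
/-- The family `⟨n⟩^{-1/2}D(n)`, if it is square-summable. -/
def halfDist (D : Dist) : Ell2 :=
  if h : Memℓp (fun n => ((bracket n ^ (-(1 / 2 : ℝ)) : ℝ) : ℂ) * D n) 2 then ⟨_, h⟩ else 0

theorem halfDist_of_sum_le {D : Dist} {B : ℝ} (hB : 0 ≤ B)
    (h : ∀ S : Finset Freq, ∑ n ∈ S, ‖((bracket n ^ (-(1 / 2 : ℝ)) : ℝ) : ℂ) * D n‖ ^ 2 ≤ B ^ 2) :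
    ‖halfDist D‖ ≤ B ∧ ∀ n, halfDist D n = ((bracket n ^ (-(1 / 2 : ℝ)) : ℝ) : ℂ) * D n := by
  have hs := summable_of_sum_le (fun n => by positivity) h
  have hm := memℓp_two_iff.mpr hs
  have e : halfDist D = ⟨_, hm⟩ := dif_pos hm
  have hn : ∀ n, halfDist D n = ((bracket n ^ (-(1 / 2 : ℝ)) : ℝ) : ℂ) * D n := fun n => by
    rw [e]
  refine ⟨?_, hn⟩
  refine le_of_sq_le_sq ?_ hB
  rw [norm_sq_eq_tsum]
  simp only [hn]
  exact hs.tsum_le_of_sum_le h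

/-- The coordinates p, q of the difference are known only mode by mode. Multiplied by ⟨n⟩^{-1/2}
they become the coordinates of a path Y in ℓ² × ℓ², since the difference of the forces lies in
H^{-1/2}. The position is then in H^{1/2} ⊂ L⁴, so the L⁴ norm driving the estimate is bounded by
‖Y‖, and Grönwall with the integrable kernel W^j gives Y = 0. -/
theorem eq_zero_of_duhamel {j : ℕ} (hj : 2 ≤ j) {σ : ℝ → ℝ} (hσ : Continuous σ)
    (hσb : ∃ σm, ∀ t, |σ t| ≤ σm) {U U' : ℝ → Lp ℝ 2 torusMeasure}
    (hU : AEStronglyMeasurable U) (hU' : AEStronglyMeasurable U')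
    (hfin : ∀ T : ℝ, ∫⁻ t in Set.Icc (-T) T,
      (1 + tnorm (2 * j) (U t) + tnorm (2 * j) (U' t)) ^ (j + 1) < ∞)
    {a : ℝ → Ell2} (ha : ∀ t, U' t - U t = synth (a t)) {p q : Freq → ℝ → ℂ}
    (hp : ∀ n, IsPrimitive (p n) fun t => Real.sin (t * bracket n) *
      (coeff (fun x => hermiteH (j + 1) (U' t x) (σ t)) n -
        coeff (fun x => hermiteH (j + 1) (U t x) (σ t)) n))
    (hq : ∀ n, IsPrimitive (q n) fun t => -(Real.cos (t * bracket n) *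
      (coeff (fun x => hermiteH (j + 1) (U' t x) (σ t)) n -
        coeff (fun x => hermiteH (j + 1) (U t x) (σ t)) n)))
    (hp0 : ∀ n, p n 0 = 0) (hq0 : ∀ n, q n 0 = 0)
    (hpq : ∀ t n, (bracket n : ℂ) * a t n =
      Real.cos (t * bracket n) * p n t + Real.sin (t * bracket n) * q n t) (t : ℝ) : a t = 0 := by
  obtain ⟨σm, hσm⟩ := hσb
  obtain ⟨C, hC⟩ := exists_sum_coeff_hermiteH_sub_le σm (j := j) (by omega)
  obtain ⟨B, hB⟩ := tnorm_synth_halfOp_le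
  have h2j : 2 * j ≠ 0 := by omega
  have mW : AEMeasurable fun t => 1 + tnorm (2 * j) (U t) + tnorm (2 * j) (U' t) :=
    (aemeasurable_const.add (aemeasurable_tnorm h2j hU)).add (aemeasurable_tnorm h2j hU')
  obtain ⟨hW1, hWfin⟩ := locallyIntegrable_toReal (mW.pow_const (j + 1)) hfin
  obtain ⟨hW0, -⟩ := locallyIntegrable_toReal (mW.pow_const j) fun T =>
    lt_of_le_of_lt (lintegral_mono fun t => pow_le_pow_right₀
      (by rw [add_assoc]; exact le_self_add) (Nat.le_succ j)) (hfin T)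
  simp only [ENNReal.toReal_pow] at hW1 hW0
  set W : ℝ → ℝ := fun t => (1 + tnorm (2 * j) (U t) + tnorm (2 * j) (U' t)).toReal with hW
  have hWpos : ∀ t, 0 ≤ W t := fun t => ENNReal.toReal_nonneg
  have hUfin : ∀ᵐ t, tnorm (2 * j) (U t) ≠ ∞ ∧ tnorm (2 * j) (U' t) ≠ ∞ := by
    filter_upwards [hWfin] with t ht
    constructor <;> · intro h; apply ht; simp [h]
  set D : ℝ → Dist := fun t n => coeff (fun x => hermiteH (j + 1) (U' t x) (σ t)) n -
    coeff (fun x => hermiteH (j + 1) (U t x) (σ t)) n with hD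
  set d : ℝ → ℝ := fun t => (tnorm 4 (U' t - U t : Lp ℝ 2 torusMeasure)).toReal with hd
  have hdle : ∀ t, tnorm 4 (U' t - U t : Lp ℝ 2 torusMeasure) ≤
      tnorm (2 * j) (U' t) + tnorm (2 * j) (U t) := fun t => by
    have e : tnorm 4 (U' t - U t : Lp ℝ 2 torusMeasure) =
        tnorm 4 (fun x => U' t x + -U t x) := by
      refine tnorm_congr ?_
      filter_upwards [Lp.coeFn_sub (U' t) (U t)] with x hx
      rw [hx, Pi.sub_apply, sub_eq_add_neg]
    rw [e]
    refine (tnorm_add_le (by norm_num) (aestronglyMeasurable_lp _)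
      (aestronglyMeasurable_lp _).neg).trans (add_le_add
      (tnorm_mono (by omega) (aestronglyMeasurable_lp _)) (le_trans (le_of_eq ?_)
      (tnorm_mono (p := 4) (by omega) (aestronglyMeasurable_lp _))))
    exact eLpNorm_neg _ _ _
  have hE : ∀ᵐ t, ‖halfDist (D t)‖ ≤ C * d t * W t ^ j ∧ d t ≤ W t ∧
      ∀ n, halfDist (D t) n = ((bracket n ^ (-(1 / 2 : ℝ)) : ℝ) : ℂ) * D t n := by
    filter_upwards [hUfin] with t ht
    have hsum : tnorm (2 * j) (U' t) + tnorm (2 * j) (U t) ≠ ∞ := ENNReal.add_ne_top.mpr ⟨ht.2, ht.1⟩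
    have hWt : W t = 1 + (tnorm (2 * j) (U t)).toReal + (tnorm (2 * j) (U' t)).toReal := by
      simp only [hW]
      rw [ENNReal.toReal_add (ENNReal.add_ne_top.mpr ⟨by simp, ht.1⟩) ht.2,
        ENNReal.toReal_add (by simp) ht.1, ENNReal.toReal_one]
    have h1 := halfDist_of_sum_le (D := D t) (B := C * d t * W t ^ j)
      (mul_nonneg (mul_nonneg C.coe_nonneg ENNReal.toReal_nonneg) (pow_nonneg (hWpos t) j))
      (by
        rw [hWt]
        exact hC (σ t) (U t) (U' t) (hσm t) ht.1 ht.2 (ne_top_of_le_ne_top hsum (hdle t)))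
    refine ⟨h1.1, ?_, h1.2⟩
    have h2 := ENNReal.toReal_mono hsum (hdle t)
    rw [ENNReal.toReal_add ht.2 ht.1] at h2
    rw [hWt]
    exact h2.trans (by linarith)
  have mD : ∀ n, AEStronglyMeasurable fun t => D t n := fun n =>
    (aestronglyMeasurable_coeff_hermiteH (j + 1) hU' hσ.aestronglyMeasurable (by
      filter_upwards [hUfin] with t ht using integrable_hermiteH_of_tnorm _ (by omega)
        (aestronglyMeasurable_lp _) ht.2) n).sub
    (aestronglyMeasurable_coeff_hermiteH (j + 1) hU hσ.aestronglyMeasurable (by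
      filter_upwards [hUfin] with t ht using integrable_hermiteH_of_tnorm _ (by omega)
        (aestronglyMeasurable_lp _) ht.1) n)
  have mE : AEStronglyMeasurable fun t => halfDist (D t) := aestronglyMeasurable_ell2 fun n => by
    refine ((mD n).const_mul ((bracket n ^ (-(1 / 2 : ℝ)) : ℝ) : ℂ)).congr ?_
    filter_upwards [hE] with t ht using (ht.2.2 n).symm
  -- The crude bound d ≤ W suffices for integrability and costs one more power of W; the bound of d
  -- by ‖Y‖ is available only once Y has been constructed.
  have hkick : LocallyIntegrable fun t => kick t (halfDist (D t)) := by
    have mk := aestronglyMeasurable_kick mE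
    rw [locallyIntegrable_iff] at hW1 ⊢
    intro K hK
    refine ((hW1 K hK).const_mul C).mono' mk.restrict (ae_restrict_of_ae ?_)
    filter_upwards [hE] with t ht
    refine (norm_kick_le _ _).trans (ht.1.trans ?_)
    rw [mul_assoc, pow_succ']
    exact mul_le_mul_of_nonneg_left (mul_le_mul_of_nonneg_right ht.2.1 (pow_nonneg (hWpos t) j))
      C.coe_nonneg
  have hY := isPrimitive_integral hkick 0
  simp only [zero_add] at hY
  set Y : ℝ → State := fun t => ∫ τ in (0 : ℝ)..t, kick τ (halfDist (D τ)) with hYdef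
  have hY0 : Y 0 = 0 := by simp [hYdef]
  have hY1 : ∀ t n, (Y t).1 n = ((bracket n ^ (-(1 / 2 : ℝ)) : ℝ) : ℂ) * p n t := fun t n => by
    have h1 := hY.clm (((lp.evalCLM ℂ (fun _ : Freq => ℂ) 2 n).restrictScalars ℝ).comp
      (ContinuousLinearMap.fst ℝ Ell2 Ell2))
    refine (h1.eq_integral t).trans ?_
    rw [(hp n).eq_integral t, hp0, hY0, map_zero, zero_add, zero_add,
      ← intervalIntegral.integral_const_mul]
    refine intervalIntegral.integral_congr_ae ?_
    filter_upwards [hE] with τ hτ _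
    refine (kick_fst_apply τ _ n).trans ?_
    rw [hτ.2.2 n]
    ring
  have hY2 : ∀ t n, (Y t).2 n = ((bracket n ^ (-(1 / 2 : ℝ)) : ℝ) : ℂ) * q n t := fun t n => by
    have h1 := hY.clm (((lp.evalCLM ℂ (fun _ : Freq => ℂ) 2 n).restrictScalars ℝ).comp
      (ContinuousLinearMap.snd ℝ Ell2 Ell2))
    refine (h1.eq_integral t).trans ?_
    rw [(hq n).eq_integral t, hq0, hY0, map_zero, zero_add, zero_add,
      ← intervalIntegral.integral_const_mul]
    refine intervalIntegral.integral_congr_ae ?_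
    filter_upwards [hE] with τ hτ _
    refine (kick_snd_apply τ _ n).trans ?_
    rw [hτ.2.2 n]
    ring
  -- The smoothing ⟨n⟩⁻¹ of Duhamel's formula is split evenly: one half places the force in ℓ², the
  -- other is left for the embedding into L⁴.
  have hrot : ∀ t, a t = halfOp (rot t (Y t)) := fun t => by
    ext n
    rw [halfOp_apply, rot_apply, hY1, hY2]
    have h1 : ((bracket n ^ (-(1 / 2 : ℝ)) : ℝ) : ℂ) * ((bracket n ^ (-(1 / 2 : ℝ)) : ℝ) : ℂ) *
        (bracket n : ℂ) = 1 := by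
      rw [← Complex.ofReal_mul, ← Complex.ofReal_mul, ← Real.rpow_add (bracket_pos n)]
      norm_num
      rw [Real.rpow_neg_one, ← Complex.ofReal_mul, inv_mul_cancel₀ (bracket_pos n).ne',
        Complex.ofReal_one]
    linear_combination (-(a t n)) * h1 + ((bracket n ^ (-(1 / 2 : ℝ)) : ℝ) : ℂ) *
      ((bracket n ^ (-(1 / 2 : ℝ)) : ℝ) : ℂ) * hpq t n
  have hdY : ∀ t, d t ≤ B * (2 * ‖Y t‖) := fun t => by
    have h1 : tnorm 4 (U' t - U t : Lp ℝ 2 torusMeasure) ≤ B * ‖rot t (Y t)‖ₑ := by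
      rw [ha, hrot]; exact hB _
    have h2 := ENNReal.toReal_mono (ENNReal.mul_ne_top ENNReal.coe_ne_top enorm_ne_top) h1
    rw [ENNReal.toReal_mul, ENNReal.coe_toReal, toReal_enorm] at h2
    exact h2.trans (mul_le_mul_of_nonneg_left (norm_rot_le _ _) B.coe_nonneg)
  have hl : LocallyIntegrable fun t => (C * (B * 2)) * W t ^ j := by
    rw [locallyIntegrable_iff] at hW0 ⊢
    exact fun K hK => (hW0 K hK).const_mul _
  have hlpos : ∀ t, 0 ≤ (C * (B * 2)) * W t ^ j := fun t =>
    mul_nonneg (by positivity) (pow_nonneg (hWpos t) j)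
  have hg := gronwall (f := fun t => ‖Y t‖) (a := 0) (T := t) hY.continuous.norm
    (fun t => norm_nonneg _) hl (Eventually.of_forall hlpos) fun r _ => by
      have h1 := hY.norm_sub_le 0 r
      rw [hY0, sub_zero] at h1
      rw [zero_add]
      refine h1.trans ?_
      rw [← abs_of_nonneg (abs_nonneg (∫ τ in (0 : ℝ)..r, ‖kick τ (halfDist (D τ))‖)), abs_abs]
      refine intervalIntegral.norm_integral_le_abs_of_norm_le
        (f := fun τ => ‖kick τ (halfDist (D τ))‖) ?_ (intervalIntegrable_of_locallyIntegrable ?_ _ _)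
      · refine ae_restrict_of_ae ?_
        filter_upwards [hE] with τ hτ
        rw [norm_norm]
        refine (norm_kick_le _ _).trans (hτ.1.trans ?_)
        have h3 := mul_le_mul_of_nonneg_left (hdY τ)
          (mul_nonneg C.coe_nonneg (pow_nonneg (hWpos τ) j))
        linarith
      · exact locallyIntegrable_bilin (ContinuousLinearMap.mul ℝ ℝ).flip hY.continuous.norm hl
  rw [zero_mul] at hg
  have hYt : Y t = 0 := norm_le_zero_iff.mp hg
  rw [hrot, hYt, map_zero, map_zero]

end Uniqueness

end

end RenormNLW

namespace RenormNLW

noncomputable section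

/-! ### The equation with deterministic data -/

section Deterministic

/-- Bridges Sobolev continuity of coefficient families and continuity of genuine ℓ²-valued paths; an
exponent r ≤ s is allowed, so the same path can be viewed in weaker spaces. -/
theorem exists_continuous_weighted {s r : ℝ} (hrs : r ≤ s) {v : ℝ → Dist}
    (hv : ContinuousInSobolev s v) : ∃ A : ℝ → Ell2, Continuous A ∧
      ∀ t n, A t n = ((bracket n ^ r : ℝ) : ℂ) * v t n := by
  have hterm : ∀ (a : Dist) n, ‖((bracket n ^ r : ℝ) : ℂ) * a n‖ ^ 2 ≤
      bracket n ^ (2 * s) * ‖a n‖ ^ 2 := fun a n => by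
    rw [norm_mul, Complex.norm_real, mul_pow, Real.norm_eq_abs, sq_abs, ← Real.rpow_natCast,
      ← Real.rpow_mul (bracket_pos n).le]
    refine mul_le_mul_of_nonneg_right (Real.rpow_le_rpow_of_exponent_le (one_le_bracket n) ?_)
      (by positivity)
    push_cast
    linarith
  have hmem : ∀ t, Memℓp (fun n => ((bracket n ^ r : ℝ) : ℂ) * v t n) 2 := fun t =>
    memℓp_two_iff.mpr (Summable.of_nonneg_of_le (fun n => by positivity) (hterm (v t)) (hv.1 t).2)
  refine ⟨fun t => ⟨_, hmem t⟩, ?_, fun t n => rfl⟩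
  rw [continuous_iff_continuousAt]
  intro t₀
  refine tendsto_iff_norm_sub_tendsto_zero.mpr ?_
  refine squeeze_zero (fun t => norm_nonneg _) (fun t => ?_) (hv.2 t₀)
  refine Real.le_sqrt_of_sq_le ?_
  have hsum : Summable fun n => bracket n ^ (2 * s) * ‖(v t - v t₀) n‖ ^ 2 := by
    refine Summable.of_nonneg_of_le (fun n => mul_nonneg (Real.rpow_nonneg (bracket_pos n).le _)
      (by positivity)) (fun n => ?_) (((hv.1 t).2.add (hv.1 t₀).2).mul_left 2)
    have h1 : ‖(v t - v t₀) n‖ ^ 2 ≤ 2 * (‖v t n‖ ^ 2 + ‖v t₀ n‖ ^ 2) := by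
      have h2 := norm_sub_le (v t n) (v t₀ n)
      have h3 : ‖(v t - v t₀) n‖ ^ 2 ≤ (‖v t n‖ + ‖v t₀ n‖) ^ 2 :=
        pow_le_pow_left₀ (norm_nonneg _) h2 2
      nlinarith [sq_nonneg (‖v t n‖ - ‖v t₀ n‖)]
    have h4 := mul_le_mul_of_nonneg_left h1 (Real.rpow_nonneg (bracket_pos n).le (2 * s))
    linarith
  rw [norm_sq_eq_tsum]
  refine Summable.tsum_le_tsum (fun n => ?_) (memℓp_two_iff.mp (lp.memℓp _)) hsum
  refine le_trans (le_of_eq ?_) (hterm (v t - v t₀) n)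
  change ‖((bracket n ^ r : ℝ) : ℂ) * v t n - ((bracket n ^ r : ℝ) : ℂ) * v t₀ n‖ ^ 2 = _
  rw [← mul_sub]
  rfl

theorem memℓp_of_continuousInSobolev {s : ℝ} (hs : 0 ≤ s) {v : ℝ → Dist}
    (hv : ContinuousInSobolev s v) (t : ℝ) : Memℓp (v t) 2 := by
  obtain ⟨A, -, hA⟩ := exists_continuous_weighted hs hv
  have : v t = A t := funext fun n => by rw [hA]; simp
  rw [this]
  exact lp.memℓp _

theorem continuous_of_continuousInSobolev {s : ℝ} (hs : 0 ≤ s) {v : ℝ → Dist}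
    (hv : ContinuousInSobolev s v) :
    Continuous fun t => (⟨v t, memℓp_of_continuousInSobolev hs hv t⟩ : Ell2) := by
  obtain ⟨A, hAc, hA⟩ := exists_continuous_weighted hs hv
  have : (fun t => (⟨v t, memℓp_of_continuousInSobolev hs hv t⟩ : Ell2)) = A := by
    funext t
    ext n
    rw [hA]
    simp
  rw [this]
  exact hAc

theorem lintegral_pow_lt_top_of_le {f : ℝ → ℝ≥0∞} {g : ℝ → ℝ} {C : ℝ≥0} (k : ℕ)
    (hg : Continuous g) (h : ∀ t, f t ≤ C * ENNReal.ofReal (g t)) (T : ℝ) :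
    ∫⁻ t in Set.Icc (-T) T, f t ^ k < ∞ := by
  obtain ⟨M, hM⟩ := (isCompact_Icc (a := -T) (b := T)).exists_bound_of_continuousOn hg.continuousOn
  calc _ ≤ ∫⁻ t in Set.Icc (-T) T, (C * ENNReal.ofReal M) ^ k := by
        refine setLIntegral_mono' measurableSet_Icc fun t ht => pow_le_pow_left' ((h t).trans ?_) k
        gcongr
        exact (le_abs_self _).trans (hM t ht)
    _ < ∞ := by
        rw [setLIntegral_const]
        exact ENNReal.mul_lt_top (ENNReal.pow_lt_top (ENNReal.mul_lt_top (by simp) (by simp)))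
          (by simp)

theorem lintegral_tnorm_lt_top_of_half {s : ℝ} (hs : 1 / 2 ≤ s) {v : ℝ → Dist}
    (hv : ContinuousInSobolev s v) (k : ℕ) (T : ℝ) :
    ∫⁻ t in Set.Icc (-T) T, tnorm 4 (toFun (v t)) ^ k < ∞ := by
  obtain ⟨A, hAc, hA⟩ := exists_continuous_weighted hs hv
  obtain ⟨C, hC⟩ := tnorm_synth_halfOp_le
  refine lintegral_pow_lt_top_of_le (C := C) (g := fun t => ‖A t‖) k hAc.norm (fun t => ?_) T
  have e : (⟨v t, memℓp_of_continuousInSobolev (by linarith) hv t⟩ : Ell2) = halfOp (A t) := by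
    ext n
    rw [halfOp_apply, hA, ← mul_assoc, ← Complex.ofReal_mul, ← Real.rpow_add (bracket_pos n)]
    norm_num
  rw [tnorm_congr (toFun_ae (memℓp_of_continuousInSobolev (by linarith) hv t)), e, ofReal_norm]
  exact hC _

theorem lintegral_tnorm_lt_top_of_one {s : ℝ} (hs : 1 ≤ s) {v : ℝ → Dist}
    (hv : ContinuousInSobolev s v) (q k : ℕ) (T : ℝ) :
    ∫⁻ t in Set.Icc (-T) T, tnorm q (toFun (v t)) ^ k < ∞ := by
  obtain ⟨A, hAc, hA⟩ := exists_continuous_weighted hs hv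
  obtain ⟨C, hC⟩ := tnorm_synth_invOp_le q
  refine lintegral_pow_lt_top_of_le (C := C) (g := fun t => ‖A t‖) k hAc.norm (fun t => ?_) T
  have e : (⟨v t, memℓp_of_continuousInSobolev (by linarith) hv t⟩ : Ell2) = invOp (A t) := by
    ext n
    change v t n = (((bracket n)⁻¹ : ℝ) : ℂ) * A t n
    have hb : (bracket n : ℂ) ≠ 0 := by exact_mod_cast (bracket_pos n).ne'
    rw [hA, Real.rpow_one, Complex.ofReal_inv, inv_mul_cancel_left₀ hb]
  rw [tnorm_congr (toFun_ae (memℓp_of_continuousInSobolev (by linarith) hv t)), e, ofReal_norm]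
  exact hC _

namespace IsGlobalSolution

variable {s₀ : ℝ} {F : ℝ → Dist → Torus → ℝ} {v w : ℝ → Dist}

theorem isPrimitive_coord (h : IsGlobalSolution s₀ F v w) (n : Freq) :
    IsPrimitive (fun t => v t n) (fun t => w t n) ∧
      IsPrimitive (fun t => w t n) fun t =>
        -((bracket n : ℂ) ^ 2 * v t n + coeff (F t (v t)) n) := by
  have hvc : Continuous fun t => v t n :=
    continuous_iff_continuousAt.mpr fun t => (h.hasDerivAt n t).continuousAt
  have hl : LocallyIntegrable fun t => (bracket n : ℂ) ^ 2 * v t n + coeff (F t (v t)) n :=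
    (continuous_const.mul hvc).locallyIntegrable.add (h.locallyIntegrable n)
  have h2 : IsPrimitive (fun t => w t n) fun t =>
      -((bracket n : ℂ) ^ 2 * v t n + coeff (F t (v t)) n) := by
    refine ⟨hl.neg, fun t => ?_⟩
    rw [h.equation n t, h.init_snd, intervalIntegral.integral_neg, Pi.zero_apply, zero_add]
  exact ⟨isPrimitive_of_hasDerivAt (h.hasDerivAt n) h2.continuous, h2⟩

/-- Rotating (⟨n⟩v, ∂ₜv) back by the free flow removes the linear part. For an arbitrary solution
this can be done only coefficient by coefficient, as no ℓ² bound on its force is known. -/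
theorem isPrimitive_interaction (h : IsGlobalSolution s₀ F v w) (n : Freq) :
    IsPrimitive (fun t => (Real.cos (t * bracket n) : ℂ) * (bracket n * v t n) -
      Real.sin (t * bracket n) * w t n) (fun t => Real.sin (t * bracket n) * coeff (F t (v t)) n) ∧
    IsPrimitive (fun t => (Real.sin (t * bracket n) : ℂ) * (bracket n * v t n) +
      Real.cos (t * bracket n) * w t n)
      (fun t => -(Real.cos (t * bracket n) * coeff (F t (v t)) n)) := by
  obtain ⟨h1, h2⟩ := h.isPrimitive_coord n
  have hb := h1.clm ((bracket n) • ContinuousLinearMap.id ℝ ℂ)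
  have hm := h2.clm (-ContinuousLinearMap.id ℝ ℂ)
  constructor
  · have e := ((isPrimitive_cos (bracket n)).smul hb).add ((isPrimitive_sin (bracket n)).smul hm)
    have e1 : (fun t => (Real.cos (t * bracket n) : ℂ) * (bracket n * v t n) -
      Real.sin (t * bracket n) * w t n) = fun t => Real.cos (t * bracket n) •
        (bracket n • ContinuousLinearMap.id ℝ ℂ) (v t n) + Real.sin (t * bracket n) •
          (-ContinuousLinearMap.id ℝ ℂ) (w t n) := by
      funext t
      simp
      ring
    rw [e1]
    refine e.congr (funext fun t => ?_)
    simp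
    ring
  · have e := ((isPrimitive_sin (bracket n)).smul hb).add ((isPrimitive_cos (bracket n)).smul h2)
    have e1 : (fun t => (Real.sin (t * bracket n) : ℂ) * (bracket n * v t n) +
      Real.cos (t * bracket n) * w t n) = fun t => Real.sin (t * bracket n) •
        (bracket n • ContinuousLinearMap.id ℝ ℂ) (v t n) + Real.cos (t * bracket n) • w t n := by
      funext t
      simp
    rw [e1]
    refine e.congr (funext fun t => ?_)
    simp
    ring

end IsGlobalSolution

theorem analysis_neg (f : Lp ℝ 2 torusMeasure) (n : Freq) :
    analysis f (-n) = conj (analysis f n) := by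
  have h : ∀ m, analysis f m = coeff f m := fun m => by
    rw [coeff_eq (Lp.memLp f), Lp.toLp_coeFn]
  rw [h, h, coeff_neg]

/-- The force is a real function, so its coefficients have conjugate symmetry; from zero data the
symmetry is inherited. This makes the constructed solution real. -/
theorem state_neg {X : ℝ → State} {f : ℝ → Lp ℝ 2 torusMeasure}
    (hX : IsPrimitive X fun t => kick t (analysis (f t))) (hX0 : X 0 = 0) (t : ℝ) (n : Freq) :
    (X t).1 (-n) = conj ((X t).1 n) ∧ (X t).2 (-n) = conj ((X t).2 n) := by
  obtain ⟨h1, h2⟩ := isPrimitive_coord hX n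
  obtain ⟨h3, h4⟩ := isPrimitive_coord hX (-n)
  have h1' := (h1.clm (Complex.conjCLE : ℂ →L[ℝ] ℂ)).eq_integral t
  have h2' := (h2.clm (Complex.conjCLE : ℂ →L[ℝ] ℂ)).eq_integral t
  constructor
  · refine (h3.eq_integral t).trans (Eq.trans ?_ h1'.symm)
    simp [hX0, bracket_neg, analysis_neg, ← Complex.ofReal_sin, -Complex.ofReal_mul, -Complex.ofReal_sin]
  · refine (h4.eq_integral t).trans (Eq.trans ?_ h2'.symm)
    simp [hX0, bracket_neg, analysis_neg, ← Complex.ofReal_cos, -Complex.ofReal_mul, -Complex.ofReal_cos]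

theorem sobolev_of_ell2 {s : ℝ} {a : Dist} {A : Ell2} (hs : ∀ n, a (-n) = conj (a n))
    (h : ∀ n, bracket n ^ (2 * s) * ‖a n‖ ^ 2 ≤ ‖A n‖ ^ 2) :
    MemSobolev s a ∧ sobolevNorm s a ≤ ‖A‖ := by
  have hsum := memℓp_two_iff.mp (lp.memℓp A)
  have hsum' : Summable fun n => bracket n ^ (2 * s) * ‖a n‖ ^ 2 :=
    Summable.of_nonneg_of_le (fun n => mul_nonneg (Real.rpow_nonneg (bracket_pos n).le _)
      (by positivity)) h hsum
  refine ⟨⟨hs, hsum'⟩, ?_⟩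
  rw [sobolevNorm, Real.sqrt_le_left (norm_nonneg _), norm_sq_eq_tsum]
  exact hsum'.tsum_le_tsum h hsum

theorem continuousInSobolev_of_ell2 {s : ℝ} {a : ℝ → Dist} {A : ℝ → Ell2} (hA : Continuous A)
    (hs : ∀ t n, a t (-n) = conj (a t n)) {c : Freq → ℂ} (hc : ∀ n, bracket n ^ (2 * s) ≤ ‖c n‖ ^ 2)
    (h : ∀ t n, A t n = c n * a t n) : ContinuousInSobolev s a := by
  have key : ∀ (b : Dist) n, bracket n ^ (2 * s) * ‖b n‖ ^ 2 ≤ ‖c n * b n‖ ^ 2 := fun b n => by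
    rw [norm_mul, mul_pow]
    exact mul_le_mul_of_nonneg_right (hc n) (by positivity)
  refine ⟨fun t => (sobolev_of_ell2 (A := A t) (hs t) fun n => by rw [h]; exact key _ n).1,
    fun t₀ => ?_⟩
  have h0 : Tendsto (fun t => ‖A t - A t₀‖) (𝓝 t₀) (𝓝 0) :=
    tendsto_iff_norm_sub_tendsto_zero.mp (hA.tendsto t₀)
  refine squeeze_zero (fun t => Real.sqrt_nonneg _) (fun t => ?_) h0
  refine (sobolev_of_ell2 (A := A t - A t₀) (fun n => ?_) fun n => ?_).2
  · simp [hs]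
  · have e : (A t - A t₀) n = c n * (a t - a t₀) n := by
      rw [lp.coeFn_sub, Pi.sub_apply, h, h, Pi.sub_apply, mul_sub]
    rw [e]
    exact key _ n

end Deterministic

end

end RenormNLW

namespace RenormNLW

noncomputable section

/-! ### Existence and uniqueness for the wave equation with a deterministic forcing -/

section DeterministicTheorem

theorem ennreal_add_pow_le (a b : ℝ≥0∞) (k : ℕ) : (a + b) ^ k ≤ 2 ^ k * (a ^ k + b ^ k) := by
  rcases le_total a b with h | h
  · calc (a + b) ^ k ≤ (2 * b) ^ k := by
          refine pow_le_pow_left' ?_ k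
          rw [two_mul]; gcongr
      _ = 2 ^ k * b ^ k := mul_pow _ _ _
      _ ≤ _ := mul_le_mul_right le_add_self _
  · calc (a + b) ^ k ≤ (2 * a) ^ k := by
          refine pow_le_pow_left' ?_ k
          rw [two_mul]; gcongr
      _ = 2 ^ k * a ^ k := mul_pow _ _ _
      _ ≤ _ := mul_le_mul_right le_self_add _

theorem setLIntegral_add_pow_lt_top {f g : ℝ → ℝ≥0∞} {s : Set ℝ} (hf : AEMeasurable f) {k : ℕ}
    (h1 : ∫⁻ t in s, f t ^ k < ∞) (h2 : ∫⁻ t in s, g t ^ k < ∞) :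
    ∫⁻ t in s, (f t + g t) ^ k < ∞ := by
  calc _ ≤ ∫⁻ t in s, 2 ^ k * (f t ^ k + g t ^ k) := lintegral_mono fun t => ennreal_add_pow_le _ _ _
    _ = 2 ^ k * ((∫⁻ t in s, f t ^ k) + ∫⁻ t in s, g t ^ k) := by
        rw [lintegral_const_mul' _ _ (by simp), lintegral_add_left' (hf.restrict.pow_const k)]
    _ < ∞ := ENNReal.mul_lt_top (by simp) (ENNReal.add_lt_top.mpr ⟨h1, h2⟩)

/-- The nonlinearity `H_k(L + v; σ)`. -/
def shiftedForce (k : ℕ) (L : ℝ → Torus → ℝ) (σ : ℝ → ℝ) (t : ℝ) (v : Dist) : Torus → ℝ := fun x =>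
  hermiteH k (L t x + toFun v x) (σ t)

variable {j : ℕ} {z : ℝ → Lp ℝ 2 torusMeasure} {σ : ℝ → ℝ} {Y₀ : State} {L : ℝ → Torus → ℝ}

theorem shiftedForce_ae (hL : ∀ t, L t =ᵐ[torusMeasure] (z t + synth (pos t Y₀) : Lp ℝ 2 torusMeasure))
    (k : ℕ) (t : ℝ) {a : Dist} (ha : Memℓp a 2) :
    shiftedForce k L σ t a =ᵐ[torusMeasure] fun x => hermiteH k
      ((z t + synth (pos t Y₀) + synth ⟨a, ha⟩ : Lp ℝ 2 torusMeasure) x) (σ t) := by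
  filter_upwards [hL t, toFun_ae ha, Lp.coeFn_add (z t + synth (pos t Y₀)) (synth ⟨a, ha⟩)]
    with x h1 h2 h3
  rw [shiftedForce, h1, h2, h3, Pi.add_apply]

/-- Subtracting Y₀ subtracts the free evolution of the initial state, which belongs to L. What
remains starts from zero and lies in H¹, hence in H^{s₀} for s₀ ≤ 1. -/
theorem IsForcing.exists_isGlobalSolution (h : IsForcing (j + 1) z σ) {Y : ℝ → State} (hY0 : Y 0 = Y₀)
    (hY : IsPrimitive Y fun τ => vfield (j + 1) (σ τ) (z τ) τ (Y τ))
    (hL : ∀ t, L t =ᵐ[torusMeasure] (z t + synth (pos t Y₀) : Lp ℝ 2 torusMeasure))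
    {s₀ : ℝ} (hs₁ : s₀ ≤ 1) :
    IsGlobalSolution s₀ (shiftedForce (j + 1) L σ) (fun t n => pos t (Y t - Y₀) n)
      fun t n => vel t (Y t - Y₀) n := by
  set f : ℝ → Lp ℝ 2 torusMeasure :=
    fun t => force (j + 1) (σ t) (z t + synth (pos t (Y t))) with hf
  have hYf : IsPrimitive Y fun t => kick t (analysis (f t)) := hY
  have hX : IsPrimitive (fun t => Y t - Y₀) fun t => kick t (analysis (f t)) := by
    refine ⟨hYf.locallyIntegrable, fun t => ?_⟩
    rw [hYf.eq_integral t, hY0, sub_self]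
    abel
  have hX0 : (fun t => Y t - Y₀) 0 = 0 := by simp [hY0]
  have hXc := hX.continuous
  have hsymm := state_neg hX hX0
  have hmem : ∀ t, Memℓp (fun n => pos t (Y t - Y₀) n) 2 := fun t => lp.memℓp _
  have hFae : ∀ t, shiftedForce (j + 1) L σ t (fun n => pos t (Y t - Y₀) n) =ᵐ[torusMeasure]
      fun x => hermiteH (j + 1) ((z t + synth (pos t (Y t)) : Lp ℝ 2 torusMeasure) x) (σ t) := by
    intro t
    have h1 := shiftedForce_ae (σ := σ) hL (j + 1) t (hmem t)
    have e : (z t + synth (pos t Y₀) + synth ⟨fun n => pos t (Y t - Y₀) n, hmem t⟩ :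
        Lp ℝ 2 torusMeasure) = z t + synth (pos t (Y t)) := by
      change z t + synth (pos t Y₀) + synth (pos t (Y t - Y₀)) = _
      rw [add_assoc, ← map_add, ← map_add, add_sub_cancel]
    rwa [e] at h1
  obtain ⟨B, hB⟩ := tnorm_add_synth_pos_le (4 * (j + 1)) (by omega)
  have hL2 : ∀ᵐ t, MemLp (fun x => hermiteH (j + 1) ((z t + synth (pos t (Y t)) :
      Lp ℝ 2 torusMeasure) x) (σ t)) 2 torusMeasure := by
    filter_upwards [(h.weight (by omega)).2] with t ht
    exact memLp_hermiteH _ (aestronglyMeasurable_lp _) ((hB _ t (Y t)).trans_lt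
      (ENNReal.add_lt_top.mpr ⟨ht.lt_top, ENNReal.mul_lt_top (by simp) (by simp)⟩)).ne
  have hcoeff : ∀ n, ∀ᵐ t, coeff (shiftedForce (j + 1) L σ t (fun n => pos t (Y t - Y₀) n)) n =
      analysis (f t) n := fun n => by
    filter_upwards [hL2] with t ht
    rw [coeff_congr (hFae t), hf, analysis_force_apply ht]
  -- The force coefficient is recovered from the two components of the kick by sin² + cos² = 1.
  have hloc : ∀ n, LocallyIntegrable fun t => analysis (f t) n := fun n => by
    obtain ⟨h1, h2⟩ := isPrimitive_coord hX n
    have e1 := locallyIntegrable_bilin (ContinuousLinearMap.lsmul ℝ ℝ)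
      (f := fun t : ℝ => Real.sin (t * bracket n)) (by fun_prop) h1.locallyIntegrable
    have e2 := locallyIntegrable_bilin (ContinuousLinearMap.lsmul ℝ ℝ)
      (f := fun t : ℝ => Real.cos (t * bracket n)) (by fun_prop) h2.locallyIntegrable
    refine (e1.sub e2).congr (Eventually.of_forall fun t => ?_)
    have hcs : (Real.cos (t * bracket n) : ℂ) ^ 2 + (Real.sin (t * bracket n) : ℂ) ^ 2 = 1 := by
      exact_mod_cast Real.cos_sq_add_sin_sq (t * bracket n)
    simp only [Pi.sub_apply, ContinuousLinearMap.lsmul_apply, Complex.real_smul]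
    linear_combination analysis (f t) n * hcs
  have hb : ∀ n, (bracket n : ℂ) ≠ 0 := fun n => by exact_mod_cast (bracket_pos n).ne'
  refine ⟨?_, ?_, ?_, ?_, fun n t => ?_, ?_, fun n => ?_, fun n t => ?_⟩
  · refine continuousInSobolev_of_ell2 (continuous_rot hXc) (c := fun n => bracket n) (fun t n => ?_)
      (fun n => ?_) fun t n => ?_
    · rw [pos_apply, rot_apply, pos_apply, rot_apply, bracket_neg, (hsymm t n).1, (hsymm t n).2]
      simp only [map_mul, map_add, Complex.conj_ofReal]
    · rw [Complex.norm_real, Real.norm_of_nonneg (bracket_pos n).le, ← Real.rpow_natCast]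
      exact Real.rpow_le_rpow_of_exponent_le (one_le_bracket n) (by push_cast; linarith)
    · rw [pos_apply, Complex.ofReal_inv, mul_inv_cancel_left₀ (hb n)]
  · refine continuousInSobolev_of_ell2 (continuous_vel hXc) (c := fun n => 1) (fun t n => ?_)
      (fun n => ?_) fun t n => ?_
    · rw [vel_apply, vel_apply, bracket_neg, (hsymm t n).1, (hsymm t n).2]
      simp only [map_mul, map_sub, Complex.conj_ofReal]
    · simp only [norm_one, one_pow]
      exact Real.rpow_le_one_of_one_le_of_nonpos (one_le_bracket n) (by linarith)
    · rw [one_mul]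
  · funext n
    simp [hY0]
  · funext n
    simp [hY0]
  · exact (isPrimitive_pos_coord hX n).hasDerivAt (continuous_coord (continuous_vel hXc) n) t
  · filter_upwards [hL2] with t ht
    exact (integrable_congr (hFae t)).mpr (ht.integrable (by norm_num))
  · refine (hloc n).congr ?_
    filter_upwards [hcoeff n] with t ht using ht.symm
  · obtain ⟨h1, h2⟩ := isPrimitive_coord hX n
    have e := (((isPrimitive_cos (bracket n)).smul h2).add ((isPrimitive_sin (bracket n)).smul
      (h1.clm (-ContinuousLinearMap.id ℝ ℂ)))).eq_integral t
    have e0 : vel t (Y t - Y₀) n = Real.cos (t * bracket n) • (Y t - Y₀).2 n +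
        Real.sin (t * bracket n) • (-ContinuousLinearMap.id ℝ ℂ) ((Y t - Y₀).1 n) := by
      rw [vel_apply]
      simp
      ring
    change vel t (Y t - Y₀) n = _
    rw [e0, e, ← intervalIntegral.integral_neg]
    have e1 : (Y 0 - Y₀) = 0 := hX0
    rw [e1]
    simp only [Prod.fst_zero, Prod.snd_zero, lp.coeFn_zero, Pi.zero_apply, map_zero, smul_zero,
      add_zero, zero_add]
    refine intervalIntegral.integral_congr_ae ?_
    filter_upwards [hcoeff n] with τ hτ _
    rw [hτ, pos_apply, rot_apply]
    have hcs : (Real.cos (τ * bracket n) : ℂ) ^ 2 + (Real.sin (τ * bracket n) : ℂ) ^ 2 = 1 := by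
      exact_mod_cast Real.cos_sq_add_sin_sq (τ * bracket n)
    have hbb := mul_inv_cancel₀ (hb n)
    simp only [Complex.real_smul, _root_.neg_apply, ContinuousLinearMap.id_apply]
    push_cast at hcs ⊢
    linear_combination (-(analysis (f τ) n)) * hcs + (bracket n : ℂ) *
      (Complex.cos (τ * bracket n) * (Y τ - Y₀).1 n +
        Complex.sin (τ * bracket n) * (Y τ - Y₀).2 n) * hbb

/-- Both solutions have the same linear part q, so their total fields differ exactly by the
synthesis of v' - v. The L^{2j} integrability of the total fields combines that of q, from the
forcing, with the two hypotheses on v and v'. -/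
theorem IsGlobalSolution.eq_of_forcing (hj : 2 ≤ j) (h : IsForcing (j + 1) z σ)
    (hL : ∀ t, L t =ᵐ[torusMeasure] (z t + synth (pos t Y₀) : Lp ℝ 2 torusMeasure))
    {s₀ : ℝ} (hs₀ : 0 ≤ s₀) {v w v' w' : ℝ → Dist}
    (hv : IsGlobalSolution s₀ (shiftedForce (j + 1) L σ) v w)
    (hv' : IsGlobalSolution s₀ (shiftedForce (j + 1) L σ) v' w')
    (hb : ∀ T : ℝ, ∫⁻ t in Set.Icc (-T) T, tnorm (2 * j) (toFun (v t)) ^ (j + 1) < ∞)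
    (hb' : ∀ T : ℝ, ∫⁻ t in Set.Icc (-T) T, tnorm (2 * j) (toFun (v' t)) ^ (j + 1) < ∞) :
    v' = v ∧ w' = w := by
  have hm := memℓp_of_continuousInSobolev hs₀ hv.continuous_fst
  have hm' := memℓp_of_continuousInSobolev hs₀ hv'.continuous_fst
  have hc := continuous_of_continuousInSobolev hs₀ hv.continuous_fst
  have hc' := continuous_of_continuousInSobolev hs₀ hv'.continuous_fst
  set q : ℝ → Lp ℝ 2 torusMeasure := fun t => z t + synth (pos t Y₀) with hq
  have hqc : Continuous q := h.continuous_field.add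
    (synth.continuous.comp (continuous_pos continuous_const))
  obtain ⟨B, hB⟩ := tnorm_add_synth_pos_le (4 * (j + 1)) (by omega)
  have mz : AEMeasurable fun t => tnorm (4 * (j + 1)) (z t) :=
    aemeasurable_tnorm (by omega) h.continuous_field.aestronglyMeasurable
  have hqle : ∀ t, tnorm (2 * j) (q t) ≤ (1 + tnorm (4 * (j + 1)) (z t)) + B * ‖Y₀‖ₑ := fun t =>
    (tnorm_mono (by omega) (aestronglyMeasurable_lp _)).trans ((hB (z t) t Y₀).trans
      (add_le_add le_add_self le_rfl))
  have hUle : ∀ (t : ℝ) {a : Dist} (ha : Memℓp a 2),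
      tnorm (2 * j) (q t + synth ⟨a, ha⟩ : Lp ℝ 2 torusMeasure) ≤
        (1 + tnorm (4 * (j + 1)) (z t)) + B * ‖Y₀‖ₑ + tnorm (2 * j) (toFun a) := fun t a ha => by
    rw [tnorm_congr (Lp.coeFn_add (q t) (synth ⟨a, ha⟩)), tnorm_congr (toFun_ae ha)]
    exact (tnorm_add_le (by omega) (aestronglyMeasurable_lp _) (aestronglyMeasurable_lp _)).trans
      (add_le_add (hqle t) le_rfl)
  have mtv : AEMeasurable fun t => tnorm (2 * j) (toFun (v t)) := by
    refine (aemeasurable_tnorm (p := 2 * j) (by omega)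
      (synth.continuous.comp hc).aestronglyMeasurable).congr
      (Eventually.of_forall fun t => (tnorm_congr (toFun_ae (hm t))).symm)
  have hfin : ∀ T : ℝ, ∫⁻ t in Set.Icc (-T) T, (1 + tnorm (2 * j) (q t + synth ⟨v t, hm t⟩ :
      Lp ℝ 2 torusMeasure) + tnorm (2 * j) (q t + synth ⟨v' t, hm' t⟩ : Lp ℝ 2 torusMeasure)) ^
        (j + 1) < ∞ := fun T => by
    have m0 : AEMeasurable fun t => (1 + tnorm (4 * (j + 1)) (z t)) := aemeasurable_const.add mz
    have hconst : ∫⁻ t in Set.Icc (-T) T, (1 + (B * ‖Y₀‖ₑ + B * ‖Y₀‖ₑ)) ^ (j + 1) < ∞ := by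
      rw [setLIntegral_const]
      refine ENNReal.mul_lt_top (ENNReal.pow_lt_top (ENNReal.add_lt_top.mpr ⟨by simp,
        ENNReal.add_lt_top.mpr ⟨?_, ?_⟩⟩)) (by simp) <;>
      exact ENNReal.mul_lt_top (by simp) (by simp)
    have h1 := setLIntegral_add_pow_lt_top mtv (hb T) (hb' T)
    have h2 := setLIntegral_add_pow_lt_top (f := fun _ => (1 + (B * ‖Y₀‖ₑ + B * ‖Y₀‖ₑ)))
      aemeasurable_const hconst h1
    have h3 := setLIntegral_add_pow_lt_top m0 (h.lintegral_lt_top T) h2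
    have h4 := setLIntegral_add_pow_lt_top m0 (h.lintegral_lt_top T) h3
    refine lt_of_le_of_lt (lintegral_mono fun t => pow_le_pow_left' ?_ _) h4
    refine (add_le_add (add_le_add le_rfl (hUle t (hm t))) (hUle t (hm' t))).trans (le_of_eq ?_)
    ring
  have hcv : ∀ t, coeff (shiftedForce (j + 1) L σ t (v t)) =
      coeff fun x => hermiteH (j + 1) ((q t + synth ⟨v t, hm t⟩ : Lp ℝ 2 torusMeasure) x) (σ t) :=
    fun t => coeff_congr (shiftedForce_ae hL (j + 1) t (hm t))
  have hcv' : ∀ t, coeff (shiftedForce (j + 1) L σ t (v' t)) =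
      coeff fun x => hermiteH (j + 1) ((q t + synth ⟨v' t, hm' t⟩ : Lp ℝ 2 torusMeasure) x) (σ t) :=
    fun t => coeff_congr (shiftedForce_ae hL (j + 1) t (hm' t))
  have hzero := eq_zero_of_duhamel hj h.continuous_variance h.bounded
    (U := fun t => q t + synth ⟨v t, hm t⟩) (U' := fun t => q t + synth ⟨v' t, hm' t⟩)
    (hqc.add (synth.continuous.comp hc)).aestronglyMeasurable
    (hqc.add (synth.continuous.comp hc')).aestronglyMeasurable hfin
    (a := fun t => ⟨v' t, hm' t⟩ - ⟨v t, hm t⟩) (fun t => by rw [map_sub]; abel)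
    (p := fun n t => ((Real.cos (t * bracket n) : ℂ) * (bracket n * v' t n) -
      Real.sin (t * bracket n) * w' t n) + (-ContinuousLinearMap.id ℝ ℂ)
        ((Real.cos (t * bracket n) : ℂ) * (bracket n * v t n) - Real.sin (t * bracket n) * w t n))
    (q := fun n t => ((Real.sin (t * bracket n) : ℂ) * (bracket n * v' t n) +
      Real.cos (t * bracket n) * w' t n) + (-ContinuousLinearMap.id ℝ ℂ)
        ((Real.sin (t * bracket n) : ℂ) * (bracket n * v t n) + Real.cos (t * bracket n) * w t n))
    (fun n => ?_) (fun n => ?_) (fun n => ?_) (fun n => ?_) fun t n => ?_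
  · have hvv : v' = v := by
      funext t n
      have h1 : (⟨v' t, hm' t⟩ : Ell2) = ⟨v t, hm t⟩ := sub_eq_zero.mp (hzero t)
      exact congrFun (congrArg Subtype.val h1) n
    refine ⟨hvv, ?_⟩
    funext t n
    have h1 := hv'.hasDerivAt n t
    rw [hvv] at h1
    exact h1.unique (hv.hasDerivAt n t)
  · refine (((hv'.isPrimitive_interaction n).1).add (((hv.isPrimitive_interaction n).1).clm
      (-ContinuousLinearMap.id ℝ ℂ))).congr (funext fun t => ?_)
    rw [hcv, hcv']
    simp only [_root_.neg_apply, ContinuousLinearMap.id_apply]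
    ring
  · refine (((hv'.isPrimitive_interaction n).2).add (((hv.isPrimitive_interaction n).2).clm
      (-ContinuousLinearMap.id ℝ ℂ))).congr (funext fun t => ?_)
    rw [hcv, hcv']
    simp only [_root_.neg_apply, ContinuousLinearMap.id_apply]
    ring
  · simp [hv.init_fst, hv.init_snd, hv'.init_fst, hv'.init_snd]
  · simp [hv.init_fst, hv.init_snd, hv'.init_fst, hv'.init_snd]
  · have hcs : (Real.cos (t * bracket n) : ℂ) ^ 2 + (Real.sin (t * bracket n) : ℂ) ^ 2 = 1 := by
      exact_mod_cast Real.cos_sq_add_sin_sq (t * bracket n)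
    change (bracket n : ℂ) * (v' t n - v t n) = _
    simp only [_root_.neg_apply, ContinuousLinearMap.id_apply]
    linear_combination (-(bracket n : ℂ) * (v' t n - v t n)) * hcs

theorem lintegral_tnorm_pos_lt_top {X : ℝ → State} (hX : Continuous X) (q k : ℕ) (T : ℝ) :
    ∫⁻ t in Set.Icc (-T) T, tnorm q (toFun fun n => pos t (X t) n) ^ k < ∞ := by
  obtain ⟨C, hC⟩ := tnorm_synth_pos_le q
  refine lintegral_pow_lt_top_of_le (C := C) (g := fun t => ‖X t‖) k hX.norm (fun t => ?_) T
  rw [tnorm_congr (toFun_ae (lp.memℓp (pos t (X t)))), ofReal_norm]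
  exact hC t (X t)

/-- Well-posedness of the equation with a deterministic forcing. -/
theorem IsForcing.exists_unique (hj : 2 ≤ j) (h : IsForcing (j + 1) z σ)
    (hex : ∃ Y : ℝ → State, Y 0 = Y₀ ∧ IsPrimitive Y fun τ => vfield (j + 1) (σ τ) (z τ) τ (Y τ))
    (hL : ∀ t, L t =ᵐ[torusMeasure] (z t + synth (pos t Y₀) : Lp ℝ 2 torusMeasure))
    {s₀ : ℝ} (hs₀ : 0 ≤ s₀) (hs₁ : s₀ ≤ 1) :
    ∃ v w : ℝ → Dist, IsGlobalSolution s₀ (shiftedForce (j + 1) L σ) v w ∧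
      LocallyLebesgue (j + 1) v ∧ ∀ v' w' : ℝ → Dist,
        IsGlobalSolution s₀ (shiftedForce (j + 1) L σ) v' w' →
        (∀ T : ℝ, ∫⁻ t in Set.Icc (-T) T, tnorm (2 * j) (toFun (v' t)) ^ (j + 1) < ∞) →
        v' = v ∧ w' = w := by
  obtain ⟨Y, hY0, hY⟩ := hex
  have hsol := h.exists_isGlobalSolution hY0 hY hL hs₁
  have hX : Continuous fun t => Y t - Y₀ := hY.continuous.sub continuous_const
  refine ⟨_, _, hsol, fun T => ?_, fun v' w' hv' hb' => ?_⟩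
  · have := lintegral_tnorm_pos_lt_top hX (j + 2) (j + 1) T
    simpa [tnorm, add_assoc, one_add_one_eq_two] using this
  · exact hsol.eq_of_forcing hj h hL hs₀ hv' (lintegral_tnorm_pos_lt_top hX _ _) hb'

end DeterministicTheorem

end

end RenormNLW

namespace RenormNLW

noncomputable section

/-! ### Law and variance of the truncated random linear wave -/

section Probability

variable {Ω : Type*} [MeasurableSpace Ω] {P : Measure Ω}

theorem hasLaw_gaussianReal_sum [IsProbabilityMeasure P] {ι : Type*} {X : ι → Ω → ℝ}
    (hX : ∀ i, Measurable (X i)) (hind : iIndepFun X P) {v : ι → ℝ≥0}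
    (hlaw : ∀ i, HasLaw (X i) (gaussianReal 0 (v i)) P) (S : Finset ι) :
    HasLaw (∑ i ∈ S, X i) (gaussianReal 0 (∑ i ∈ S, v i)) P := by
  classical
  induction S using Finset.induction_on with
  | empty =>
    rw [Finset.sum_empty, Finset.sum_empty, gaussianReal_zero_var]
    exact hasLaw_dirac_of_ae_eq (ae_of_all _ fun _ => rfl)
  | insert i S hi ih =>
    rw [Finset.sum_insert hi, Finset.sum_insert hi]
    refine ⟨(hlaw i).aemeasurable.add ih.aemeasurable, ?_⟩
    have h := gaussianReal_add_gaussianReal_of_indepFun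
      (hind.indepFun_finsetSum_of_notMem hX hi).symm (hlaw i).map_eq ih.map_eq
    simpa using h

theorem mem_halfLattice {n : Freq} : n ∈ halfLattice ↔ 0 < n 1 ∨ (n 1 = 0 ∧ 0 ≤ n 0) := Iff.rfl

/-- The sum of an even function over a symmetric set of frequencies, folded onto the half lattice. -/
theorem sum_halfLattice {S : Finset Freq} (hS : ∀ n ∈ S, -n ∈ S) {F : Freq → ℝ}
    (hF : ∀ n, F (-n) = F n) [DecidablePred (· ∈ halfLattice)] :
    ∑ n ∈ S, F n = ∑ n ∈ S with n ∈ halfLattice, (if n = 0 then 1 else 2) * F n := by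
  have key : ∑ n ∈ S with n ∉ halfLattice, F n =
      ∑ n ∈ S with n ∈ halfLattice, (if n = 0 then 0 else F n) := by
    rw [← Finset.sum_filter_add_sum_filter_not (S.filter (· ∈ halfLattice)) (· = 0)]
    rw [Finset.sum_congr rfl (g := fun _ => (0 : ℝ)) fun n hn => if_pos (Finset.mem_filter.1 hn).2]
    rw [Finset.sum_const_zero, zero_add]
    refine Finset.sum_nbij' (fun n => -n) (fun n => -n) ?_ ?_ (by simp) (by simp) ?_
    · intro n hn
      simp only [Finset.mem_filter, mem_halfLattice] at hn ⊢
      refine ⟨⟨hS n hn.1, ?_⟩, ?_⟩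
      · simp only [Pi.neg_apply]; omega
      · rintro h
        have : n = 0 := neg_eq_zero.1 h
        subst this
        simp at hn
    · intro n hn
      simp only [Finset.mem_filter, mem_halfLattice] at hn ⊢
      refine ⟨hS n hn.1.1, ?_⟩
      have : ¬ (n 0 = 0 ∧ n 1 = 0) := fun h => hn.2 (by
        funext i; fin_cases i
        · exact h.1
        · exact h.2)
      have h2 := hn.1.2
      simp only [Pi.neg_apply]; omega
    · intro n hn
      simp only [Finset.mem_filter, mem_halfLattice] at hn
      rw [if_neg, hF]
      intro h
      have : n = 0 := neg_eq_zero.1 h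
      subst this
      simp at hn
  rw [← Finset.sum_filter_add_sum_filter_not S (· ∈ halfLattice), key, ← Finset.sum_add_distrib]
  refine Finset.sum_congr rfl fun n _ => ?_
  split_ifs <;> ring

variable {g : Fin 2 → Freq → Ω → ℂ}

/-- Real and imaginary parts have variance ½, so 2 Re(g c) has variance 2|c|², the joint share of n
and -n; at n = 0 the variable is real with variance 1, and c must be real. -/
theorem IsGaussianFamily.hasLaw_mode [IsProbabilityMeasure P] (hg : IsGaussianFamily P g)
    (j : Fin 2) (n : Freq) (c : ℂ) (hc : n = 0 → c.im = 0) :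
    HasLaw (fun ω => (if n = 0 then 1 else 2) * (g j n ω * c).re)
      (gaussianReal 0 ((if n = 0 then 1 else 2) * ‖c‖₊ ^ 2)) P := by
  split_ifs with hn
  · subst hn
    have h := gaussianReal_mul_const (hg.law_zero j) c.re
    have e : (fun ω => 1 * (g j 0 ω * c).re) = fun ω => (g j 0 ω).re * c.re := by
      funext ω; simp [Complex.mul_re, hc rfl]
    rw [e]
    convert h using 2
    · simp
    · ext
      have : (‖c‖ : ℝ) ^ 2 = c.re ^ 2 := by
        rw [← Complex.normSq_eq_norm_sq, Complex.normSq_apply, hc rfl]; ring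
      simp [this]
  · have h1 := gaussianReal_mul_const (hg.law_re j n hn) (2 * c.re)
    have h2 := gaussianReal_mul_const (hg.law_im j n hn) (-(2 * c.im))
    have hi : IndepFun (fun ω => (g j n ω).re * (2 * c.re)) (fun ω => (g j n ω).im * (-(2 * c.im))) P :=
      (hg.indep_re_im j n hn).comp (measurable_id.mul_const _) (measurable_id.mul_const _)
    have h := gaussianReal_add_gaussianReal_of_indepFun hi h1.map_eq h2.map_eq
    refine ⟨?_, ?_⟩
    · exact ((Complex.measurable_re.comp ((hg.measurable j n).mul_const c)).const_mul _).aemeasurable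
    · have e : (fun ω => 2 * (g j n ω * c).re) =
          (fun ω => (g j n ω).re * (2 * c.re)) + fun ω => (g j n ω).im * (-(2 * c.im)) := by
        funext ω; simp [Complex.mul_re]; ring
      rw [e, h]
      congr 1
      · simp
      · ext
        have : (‖c‖ : ℝ) ^ 2 = c.re ^ 2 + c.im ^ 2 := by
          rw [← Complex.normSq_eq_norm_sq, Complex.normSq_apply]; ring
        simp [this]; ring

/-- Folding n with -n leaves independent Gaussian modes indexed by the half lattice, and the doubled
variances unfold back to the full sum. -/
theorem IsGaussianFamily.hasLaw_sum [IsProbabilityMeasure P] (hg : IsGaussianFamily P g)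
    {c : Fin 2 → Freq → ℂ} (hc : ∀ j n, c j (-n) = conj (c j n)) {S : Finset Freq}
    (hS : ∀ n ∈ S, -n ∈ S) :
    HasLaw (fun ω => ∑ j, ∑ n ∈ S, (g j n ω * c j n).re)
      (gaussianReal 0 (∑ j, ∑ n ∈ S, ‖c j n‖₊ ^ 2)) P := by
  classical
  let X : Fin 2 × halfLattice → Ω → ℝ := fun p ω =>
    (if (p.2 : Freq) = 0 then 1 else 2) * (g p.1 p.2 ω * c p.1 p.2).re
  have hm : ∀ p : Fin 2 × halfLattice, Measurable fun z : ℂ =>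
      (if (p.2 : Freq) = 0 then (1 : ℝ) else 2) * (z * c p.1 p.2).re := fun p =>
    (Complex.measurable_re.comp (measurable_id.mul_const _)).const_mul _
  have hX : ∀ p, Measurable (X p) := fun p => (hm p).comp (hg.measurable _ _)
  have hind : iIndepFun X P := hg.indep.comp _ hm
  have hlaw := hasLaw_gaussianReal_sum hX hind (fun p => hg.hasLaw_mode p.1 p.2 (c p.1 p.2) fun h => by
    have := hc p.1 p.2
    rw [h, neg_zero] at this
    rw [h]
    exact Complex.conj_eq_iff_im.1 this.symm) (Finset.univ ×ˢ S.subtype (· ∈ halfLattice))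
  convert hlaw using 1
  · funext ω
    rw [Finset.sum_apply, Finset.sum_product]
    refine Finset.sum_congr rfl fun j _ => ?_
    rw [sum_halfLattice hS]
    · exact (Finset.sum_subtype_eq_sum_filter (f := fun n =>
        (if n = 0 then (1 : ℝ) else 2) * (g j n ω * c j n).re)).symm
    · intro n
      rw [hg.symm, hc, ← map_mul, Complex.conj_re]
  · congr 1
    rw [Finset.sum_product]
    refine Finset.sum_congr rfl fun j _ => ?_
    have h := sum_halfLattice (F := fun n => ‖c j n‖ ^ 2) hS fun n => by simp [hc]
    ext
    have h2 := (Finset.sum_subtype_eq_sum_filter (p := (· ∈ halfLattice)) (s := S) (f := fun n =>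
        (if n = 0 then (1 : ℝ≥0) else 2) * ‖c j n‖₊ ^ 2))
    rw [h2]
    push_cast
    refine h.trans (Finset.sum_congr rfl fun n _ => ?_)
    split_ifs <;> simp

theorem neg_mem_freqBall {N : ℕ} {n : Freq} (h : n ∈ freqBall N) : -n ∈ freqBall N := by
  simp only [freqBall, Finset.mem_filter, Finset.mem_Icc, Pi.le_def, Pi.neg_apply] at h ⊢
  refine ⟨⟨fun i => ?_, fun i => ?_⟩, by simpa using h.2⟩
  · have := h.1.2 i; omega
  · have := h.1.1 i; omega

theorem tendsto_freqBall : Tendsto freqBall atTop atTop := by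
  refine tendsto_atTop_finset_of_monotone (fun M N h n hn => ?_) fun n => ?_
  · simp only [freqBall, Finset.mem_filter, Finset.mem_Icc, Pi.le_def] at hn ⊢
    have hMN : (M : ℤ) ≤ N := by exact_mod_cast h
    refine ⟨⟨fun i => ?_, fun i => ?_⟩, hn.2.trans (by gcongr)⟩
    · have := hn.1.1 i; omega
    · have := hn.1.2 i; omega
  · refine ⟨(n 0).natAbs + (n 1).natAbs, ?_⟩
    simp only [freqBall, Finset.mem_filter, Finset.mem_Icc, Pi.le_def, Fin.forall_fin_two]
    push_cast
    refine ⟨⟨⟨?_, ?_⟩, ?_, ?_⟩, ?_⟩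
    · have := neg_abs_le (n 0); have := abs_nonneg (n 1); omega
    · have := neg_abs_le (n 1); have := abs_nonneg (n 0); omega
    · have := le_abs_self (n 0); have := abs_nonneg (n 1); omega
    · have := le_abs_self (n 1); have := abs_nonneg (n 0); omega
    · have h0 := abs_nonneg (n 0); have h1 := abs_nonneg (n 1)
      nlinarith [sq_abs (n 0), sq_abs (n 1), mul_nonneg h0 h1]

/-- The variance of the frequency `n` component of `S(t)(φ₀^ω, φ₁^ω)`. -/
def modeVariance (φ₀ φ₁ : Dist) (t : ℝ) (n : Freq) : ℝ :=
  Real.cos (t * bracket n) ^ 2 * ‖φ₀ n‖ ^ 2 + (Real.sin (t * bracket n) / bracket n) ^ 2 * ‖φ₁ n‖ ^ 2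

/-- The variance of `S(t)(φ₀^ω, φ₁^ω)`. -/
def fieldVariance (φ₀ φ₁ : Dist) (t : ℝ) : ℝ := ∑' n, modeVariance φ₀ φ₁ t n

theorem modeVariance_nonneg (φ₀ φ₁ : Dist) (t : ℝ) (n : Freq) : 0 ≤ modeVariance φ₀ φ₁ t n := by
  unfold modeVariance; positivity

theorem modeVariance_le (φ₀ φ₁ : Dist) (t : ℝ) (n : Freq) :
    modeVariance φ₀ φ₁ t n ≤ ‖φ₀ n‖ ^ 2 + (bracket n)⁻¹ ^ 2 * ‖φ₁ n‖ ^ 2 := by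
  have h1 := Real.cos_sq_le_one (t * bracket n)
  have h2 := Real.sin_sq_le_one (t * bracket n)
  unfold modeVariance
  refine add_le_add (mul_le_of_le_one_left (by positivity) h1) ?_
  rw [div_eq_mul_inv, mul_pow]
  exact mul_le_mul_of_nonneg_right (mul_le_of_le_one_left (by positivity) h2) (by positivity)

/-- The characters have modulus one, so the variance does not depend on x; the deterministic data r
only shift the mean. -/
theorem IsGaussianFamily.hasLaw_truncEval [IsProbabilityMeasure P] (hg : IsGaussianFamily P g)
    {φ₀ φ₁ : Dist} (h₀ : ∀ n, φ₀ (-n) = conj (φ₀ n)) (h₁ : ∀ n, φ₁ (-n) = conj (φ₁ n))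
    (r₀ r₁ : Dist) (N : ℕ) (t : ℝ) (x : Torus) :
    HasLaw (fun ω => truncEval N (propagator t (randomData (g 0) φ₀ r₀ ω)
        (randomData (g 1) φ₁ r₁ ω)) x)
      (gaussianReal (truncEval N (propagator t r₀ r₁) x)
        (∑ n ∈ freqBall N, modeVariance φ₀ φ₁ t n).toNNReal) P := by
  let c : Fin 2 → Freq → ℂ := ![
    fun n => (Real.cos (t * bracket n) : ℂ) * φ₀ n * UnitAddTorus.mFourier n x,
    fun n => (Real.sin (t * bracket n) / bracket n : ℝ) * φ₁ n * UnitAddTorus.mFourier n x]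
  have hc : ∀ j n, c j (-n) = conj (c j n) := by
    intro j n
    fin_cases j
    · change ((Real.cos (t * bracket (-n)) : ℝ) : ℂ) * φ₀ (-n) *
        UnitAddTorus.mFourier (-n) x = conj (((Real.cos (t * bracket n) : ℝ) : ℂ) * φ₀ n * UnitAddTorus.mFourier n x)
      rw [map_mul, map_mul, Complex.conj_ofReal, bracket_neg, h₀, UnitAddTorus.mFourier_neg]
    · change ((Real.sin (t * bracket (-n)) / bracket (-n) : ℝ) : ℂ) * φ₁ (-n) *
        UnitAddTorus.mFourier (-n) x = conj (((Real.sin (t * bracket n) / bracket n : ℝ) : ℂ) * φ₁ n * UnitAddTorus.mFourier n x)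
      rw [map_mul, map_mul, Complex.conj_ofReal, bracket_neg, h₁, UnitAddTorus.mFourier_neg]
  have h := gaussianReal_add_const (hg.hasLaw_sum hc fun n (hn : n ∈ freqBall N) => neg_mem_freqBall hn)
    (truncEval N (propagator t r₀ r₁) x)
  rw [zero_add] at h
  convert h using 2
  · rename_i ω
    simp only [truncEval, Fin.sum_univ_two, Complex.re_sum, ← Finset.sum_add_distrib]
    refine Finset.sum_congr rfl fun n _ => ?_
    simp only [propagator, randomData, c, Matrix.cons_val_zero, Matrix.cons_val_one, ← Complex.add_re]
    congr 1
    ring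
  · ext
    rw [Real.coe_toNNReal _ (Finset.sum_nonneg fun n _ => modeVariance_nonneg _ _ _ _)]
    push_cast
    rw [Fin.sum_univ_two, ← Finset.sum_add_distrib]
    refine Finset.sum_congr rfl fun n _ => ?_
    simp only [c, modeVariance, Matrix.cons_val_zero, Matrix.cons_val_one, norm_mul,
      norm_mFourier_apply, mul_one, mul_pow, Complex.norm_real, Real.norm_eq_abs, sq_abs]

theorem waveVariance_eq [IsProbabilityMeasure P] (hg : IsGaussianFamily P g)
    {φ₀ φ₁ : Dist} (h₀ : ∀ n, φ₀ (-n) = conj (φ₀ n)) (h₁ : ∀ n, φ₁ (-n) = conj (φ₁ n))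
    (r₀ r₁ : Dist) (t : ℝ) (hs : Summable (modeVariance φ₀ φ₁ t)) (x : Torus) :
    waveVariance P (randomData (g 0) φ₀ r₀) (randomData (g 1) φ₁ r₁) t x =
      fieldVariance φ₀ φ₁ t := by
  have h : (fun N : ℕ => Var[fun ω => truncEval N (propagator t (randomData (g 0) φ₀ r₀ ω)
      (randomData (g 1) φ₁ r₁ ω)) x; P]) = fun N => ∑ n ∈ freqBall N, modeVariance φ₀ φ₁ t n := by
    funext N
    rw [(hg.hasLaw_truncEval h₀ h₁ r₀ r₁ N t x).variance_eq, variance_id_gaussianReal,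
      Real.coe_toNNReal _ (Finset.sum_nonneg fun n _ => modeVariance_nonneg _ _ _ _)]
  rw [waveVariance, h]
  exact (hs.hasSum.comp tendsto_freqBall).limUnder_eq

end Probability

end

end RenormNLW

namespace RenormNLW

noncomputable section

/-! ### Random Fourier series and regularity of the variance -/

section RandomSeries

variable {Ω : Type*} [MeasurableSpace Ω] {P : Measure Ω} {g : Fin 2 → Freq → Ω → ℂ}

theorem MemSobolev.summable_pow {s : ℝ} {a : Dist} (h : MemSobolev s a) {m : ℤ} (hm : (m : ℝ) ≤ s) :
    Summable fun n => (bracket n ^ m) ^ 2 * ‖a n‖ ^ 2 := by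
  refine h.2.of_nonneg_of_le (fun n => by positivity) fun n => ?_
  refine mul_le_mul_of_nonneg_right ?_ (by positivity)
  rw [← Real.rpow_intCast, ← Real.rpow_natCast, ← Real.rpow_mul (bracket_pos n).le]
  exact Real.rpow_le_rpow_of_exponent_le (one_le_bracket n) (by push_cast; linarith)

theorem lintegral_gaussianReal_sq_lt_top (v : ℝ≥0) : ∫⁻ x, ‖x‖ₑ ^ 2 ∂gaussianReal 0 v < ∞ := by
  have h := (memLp_id_gaussianReal (μ := 0) (v := v) 2).eLpNorm_lt_top
  have h2 := lintegral_rpow_enorm_lt_top_of_eLpNorm_lt_top (p := 2) (by simp) (by simp) h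
  simpa using h2

theorem IsGaussianFamily.exists_lintegral_sq_le (hg : IsGaussianFamily P g) :
    ∃ C : ℝ≥0∞, C ≠ ∞ ∧ ∀ j n, ∫⁻ ω, ‖g j n ω‖ₑ ^ 2 ∂P ≤ C := by
  refine ⟨(∫⁻ x, ‖x‖ₑ ^ 2 ∂gaussianReal 0 1) + ((∫⁻ x, ‖x‖ₑ ^ 2 ∂gaussianReal 0 (1 / 2)) +
    ∫⁻ x, ‖x‖ₑ ^ 2 ∂gaussianReal 0 (1 / 2)), ?_, fun j n => ?_⟩
  · exact (ENNReal.add_lt_top.2 ⟨lintegral_gaussianReal_sq_lt_top _, ENNReal.add_lt_top.2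
      ⟨lintegral_gaussianReal_sq_lt_top _, lintegral_gaussianReal_sq_lt_top _⟩⟩).ne
  have hsq : ∀ z : ℂ, ‖z‖ₑ ^ 2 = ‖z.re‖ₑ ^ 2 + ‖z.im‖ₑ ^ 2 := fun z => by
    simp only [← ofReal_norm, ← ENNReal.ofReal_pow (norm_nonneg _)]
    rw [← ENNReal.ofReal_add (by positivity) (by positivity), ← Complex.normSq_eq_norm_sq,
      Complex.normSq_apply]
    simp [sq]
  have hm : Measurable fun x : ℝ => ‖x‖ₑ ^ 2 := measurable_enorm.pow_const 2
  have key : ∀ {X : Ω → ℝ} {v : ℝ≥0}, HasLaw X (gaussianReal 0 v) P →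
      ∫⁻ ω, ‖X ω‖ₑ ^ 2 ∂P = ∫⁻ x, ‖x‖ₑ ^ 2 ∂gaussianReal 0 v := fun h =>
    h.lintegral_comp hm.aemeasurable
  by_cases hn : n = 0
  · subst hn
    have him : ∀ ω, (g j 0 ω).im = 0 := fun ω => by
      have := hg.symm j 0 ω
      rw [neg_zero] at this
      exact Complex.conj_eq_iff_im.1 this.symm
    simp only [hsq, him]
    simp only [enorm_zero, ne_eq, OfNat.ofNat_ne_zero, not_false_eq_true, zero_pow, add_zero]
    rw [key (hg.law_zero j)]
    exact le_self_add
  · simp only [hsq]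
    rw [lintegral_add_left (f := fun ω => ‖(g j n ω).re‖ₑ ^ 2)
      ((hm.comp Complex.measurable_re).comp (hg.measurable j n)),
      key (hg.law_re j n hn), key (hg.law_im j n hn)]
    exact le_add_self

/-- A randomized weighted `ℓ²` sequence almost surely remains in the weighted `ℓ²` space. -/
theorem IsGaussianFamily.ae_summable (hg : IsGaussianFamily P g) (j : Fin 2) {w : Freq → ℝ}
    {φ : Dist} (hφ : Summable fun n => w n ^ 2 * ‖φ n‖ ^ 2) :
    ∀ᵐ ω ∂P, Summable fun n => w n ^ 2 * ‖g j n ω * φ n‖ ^ 2 := by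
  obtain ⟨C, hC, hle⟩ := hg.exists_lintegral_sq_le
  have hmeas : ∀ n, Measurable fun ω => ENNReal.ofReal (w n ^ 2 * ‖g j n ω * φ n‖ ^ 2) := fun n =>
    ENNReal.measurable_ofReal.comp ((((hg.measurable j n).mul_const _).norm.pow_const 2).const_mul _)
  have hE : ∀ n, ∫⁻ ω, ENNReal.ofReal (w n ^ 2 * ‖g j n ω * φ n‖ ^ 2) ∂P ≤
      ENNReal.ofReal (w n ^ 2 * ‖φ n‖ ^ 2) * C := fun n => by
    have e : ∀ ω, ENNReal.ofReal (w n ^ 2 * ‖g j n ω * φ n‖ ^ 2) =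
        ENNReal.ofReal (w n ^ 2 * ‖φ n‖ ^ 2) * ‖g j n ω‖ₑ ^ 2 := fun ω => by
      rw [← ofReal_norm, ← ENNReal.ofReal_pow (norm_nonneg _),
        ← ENNReal.ofReal_mul (by positivity), norm_mul]
      ring_nf
    simp only [e]
    rw [lintegral_const_mul _ ((hg.measurable j n).enorm.pow_const 2)]
    exact mul_le_mul' le_rfl (hle j n)
  -- The weighted square norm has finite expectation because the second moments are uniformly
  -- bounded; independence plays no role.
  have hfin : ∫⁻ ω, ∑' n, ENNReal.ofReal (w n ^ 2 * ‖g j n ω * φ n‖ ^ 2) ∂P < ∞ := by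
    rw [lintegral_tsum fun n => (hmeas n).aemeasurable]
    refine (ENNReal.tsum_le_tsum hE).trans_lt ?_
    rw [ENNReal.tsum_mul_right]
    exact ENNReal.mul_lt_top hφ.tsum_ofReal_lt_top hC.lt_top
  filter_upwards [ae_lt_top (Measurable.tsum hmeas) hfin.ne] with ω hω
  have := ENNReal.summable_toReal hω.ne
  refine this.congr fun n => ?_
  rw [ENNReal.toReal_ofReal (by positivity)]

theorem memℓp_of_summable_weight {w : Freq → ℝ} {a : Dist}
    (h : Summable fun n => w n ^ 2 * ‖a n‖ ^ 2) : Memℓp (fun n => (w n : ℂ) * a n) 2 := by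
  rw [memℓp_two_iff]
  simpa [mul_pow] using h

variable {φ₀ φ₁ : Dist}

theorem summable_modeVariance (h₀ : Summable fun n => ‖φ₀ n‖ ^ 2)
    (h₁ : Summable fun n => (bracket n)⁻¹ ^ 2 * ‖φ₁ n‖ ^ 2) (t : ℝ) :
    Summable (modeVariance φ₀ φ₁ t) :=
  (h₀.add h₁).of_nonneg_of_le (modeVariance_nonneg φ₀ φ₁ t) (modeVariance_le φ₀ φ₁ t)

theorem fieldVariance_nonneg (φ₀ φ₁ : Dist) (t : ℝ) : 0 ≤ fieldVariance φ₀ φ₁ t :=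
  tsum_nonneg (modeVariance_nonneg φ₀ φ₁ t)

theorem fieldVariance_le (h₀ : Summable fun n => ‖φ₀ n‖ ^ 2)
    (h₁ : Summable fun n => (bracket n)⁻¹ ^ 2 * ‖φ₁ n‖ ^ 2) (t : ℝ) :
    fieldVariance φ₀ φ₁ t ≤ ∑' n, (‖φ₀ n‖ ^ 2 + (bracket n)⁻¹ ^ 2 * ‖φ₁ n‖ ^ 2) :=
  (summable_modeVariance h₀ h₁ t).tsum_le_tsum (modeVariance_le φ₀ φ₁ t) (h₀.add h₁)

theorem continuous_fieldVariance (h₀ : Summable fun n => ‖φ₀ n‖ ^ 2)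
    (h₁ : Summable fun n => (bracket n)⁻¹ ^ 2 * ‖φ₁ n‖ ^ 2) : Continuous (fieldVariance φ₀ φ₁) := by
  refine continuous_tsum (fun n => ?_) (h₀.add h₁) fun n t => ?_
  · unfold modeVariance; fun_prop
  · rw [Real.norm_of_nonneg (modeVariance_nonneg φ₀ φ₁ t n)]
    exact modeVariance_le φ₀ φ₁ t n

/-- Differentiating cos² and sin² costs one factor ⟨n⟩, and the differentiated series still
converges uniformly when the deterministic profile is in H¹ × L². This is where s ≥ 1 serves the
energy method. -/
theorem exists_hasDerivAt_fieldVariance (h₀ : Summable fun n => bracket n ^ 2 * ‖φ₀ n‖ ^ 2)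
    (h₁ : Summable fun n => ‖φ₁ n‖ ^ 2) :
    ∃ σ' : ℝ → ℝ, (∀ t, HasDerivAt (fieldVariance φ₀ φ₁) (σ' t) t) ∧ Continuous σ' := by
  let d : Freq → ℝ → ℝ := fun n t =>
    2 * (Real.sin (t * bracket n) * Real.cos (t * bracket n)) *
      ((bracket n)⁻¹ * ‖φ₁ n‖ ^ 2 - bracket n * ‖φ₀ n‖ ^ 2)
  have hd : ∀ n t, HasDerivAt (fun t => modeVariance φ₀ φ₁ t n) (d n t) t := fun n t => by
    have hb := (bracket_pos n).ne'
    have hl : HasDerivAt (fun t : ℝ => t * bracket n) (bracket n) t := by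
      simpa using (hasDerivAt_id t).mul_const (bracket n)
    have h := ((hl.cos.pow 2).mul_const (‖φ₀ n‖ ^ 2)).add
      (((hl.sin.div_const (bracket n)).pow 2).mul_const (‖φ₁ n‖ ^ 2))
    refine h.congr_deriv ?_
    simp only [d]
    generalize bracket n = b at hb ⊢
    push_cast
    field_simp
    ring
  have hbd : ∀ n t, ‖d n t‖ ≤ 2 * (‖φ₁ n‖ ^ 2 + bracket n ^ 2 * ‖φ₀ n‖ ^ 2) := fun n t => by
    have hb := one_le_bracket n
    have hs := abs_sin_bracket_le t n
    have hc := abs_cos_bracket_le t n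
    have h1 : |(bracket n)⁻¹ * ‖φ₁ n‖ ^ 2 - bracket n * ‖φ₀ n‖ ^ 2| ≤
        ‖φ₁ n‖ ^ 2 + bracket n ^ 2 * ‖φ₀ n‖ ^ 2 := by
      refine (abs_sub _ _).trans (add_le_add ?_ ?_)
      · rw [abs_mul, abs_of_nonneg (sq_nonneg ‖φ₁ n‖)]
        exact mul_le_of_le_one_left (by positivity) (abs_bracket_inv_le n)
      · rw [abs_of_nonneg (by positivity)]
        exact mul_le_mul_of_nonneg_right (by nlinarith) (by positivity)
    have h2 : |Real.sin (t * bracket n) * Real.cos (t * bracket n)| ≤ 1 := by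
      rw [abs_mul]; exact mul_le_one₀ hs (abs_nonneg _) hc
    simp only [d]
    rw [Real.norm_eq_abs, abs_mul, abs_mul, abs_two, mul_assoc]
    exact mul_le_mul_of_nonneg_left ((mul_le_of_le_one_left (abs_nonneg _) h2).trans h1) zero_le_two
  have hu : Summable fun n => 2 * (‖φ₁ n‖ ^ 2 + bracket n ^ 2 * ‖φ₀ n‖ ^ 2) :=
    (h₁.add h₀).mul_left 2
  refine ⟨fun t => ∑' n, d n t, fun t => ?_, continuous_tsum (fun n => ?_) hu hbd⟩
  · refine hasDerivAt_tsum hu hd hbd (y₀ := 0) (summable_modeVariance ?_ ?_ 0) t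
    · refine h₀.of_nonneg_of_le (fun n => by positivity) fun n => ?_
      exact le_mul_of_one_le_left (by positivity) (one_le_pow₀ (one_le_bracket n))
    · refine h₁.of_nonneg_of_le (fun n => by positivity) fun n => ?_
      refine mul_le_of_le_one_left (by positivity) (pow_le_one₀ ?_ (inv_le_one_of_one_le₀ (one_le_bracket n)))
      exact (inv_pos.2 (bracket_pos n)).le
  · simp only [d]; fun_prop

/-- e^{c|x|} ≤ e^{cx} + e^{-cx}, and both terms have the same explicit moment. -/
theorem lintegral_exp_abs_gaussianReal_le {X : Ω → ℝ} {v : ℝ≥0} (hX : HasLaw X (gaussianReal 0 v) P)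
    (c : ℝ) : ∫⁻ ω, ENNReal.ofReal (Real.exp (c * |X ω|)) ∂P ≤
      2 * ENNReal.ofReal (Real.exp (v * c ^ 2 / 2)) := by
  have key : ∀ d : ℝ, ∫⁻ x, ENNReal.ofReal (Real.exp (d * x)) ∂gaussianReal 0 v =
      ENNReal.ofReal (Real.exp (v * d ^ 2 / 2)) := fun d => by
    rw [← ofReal_integral_eq_lintegral_ofReal (integrable_exp_mul_gaussianReal d)
      (ae_of_all _ fun x => (Real.exp_pos _).le)]
    have := congrFun (mgf_id_gaussianReal (μ := 0) (v := v)) d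
    rw [mgf] at this
    simp only [id] at this
    rw [this]; simp
  have hm : ∀ d : ℝ, Measurable fun x : ℝ => ENNReal.ofReal (Real.exp (d * x)) := fun d => by
    fun_prop
  rw [hX.lintegral_comp (f := fun x => ENNReal.ofReal (Real.exp (c * |x|))) (by fun_prop), two_mul]
  calc ∫⁻ x, ENNReal.ofReal (Real.exp (c * |x|)) ∂gaussianReal 0 v
      ≤ ∫⁻ x, (ENNReal.ofReal (Real.exp (c * x)) + ENNReal.ofReal (Real.exp (-c * x)))
          ∂gaussianReal 0 v := lintegral_mono fun x => by
        rcases abs_choice x with h | h <;> rw [h]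
        · exact le_self_add
        · rw [show c * -x = -c * x by ring]; exact le_add_self
    _ = _ := by rw [lintegral_add_left (hm c), key, key, neg_sq]

end RandomSeries

end

end RenormNLW

namespace RenormNLW

noncomputable section

/-! ### Exponential moments of the random linear wave -/

section RandomField

variable {Ω : Type*} [MeasurableSpace Ω] {P : Measure Ω} {g : Fin 2 → Freq → Ω → ℂ}

/-- The restriction of a square summable sequence to the frequencies `|n| ≤ N`. -/
def truncate (N : ℕ) (a : Ell2) : Ell2 := ∑ n ∈ freqBall N, lp.single 2 n (a n)

theorem truncate_apply (N : ℕ) (a : Ell2) (n : Freq) :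
    truncate N a n = if n ∈ freqBall N then a n else 0 := by
  rw [truncate, lp.coeFn_sum, Finset.sum_apply]
  simp only [lp.single_apply, Pi.single_apply, Finset.sum_ite_eq]

theorem tendsto_truncate (a : Ell2) : Tendsto (fun N => truncate N a) atTop (𝓝 a) :=
  (lp.hasSum_single (by simp) a).comp tendsto_freqBall

theorem propagator_eq_rot {t : ℝ} {a b : Dist} {y : State} (ha : ∀ n, y.1 n = a n)
    (hb : ∀ n, y.2 n = ((bracket n)⁻¹ : ℝ) * b n) (n : Freq) : propagator t a b n = rot t y n := by
  rw [rot_apply, ha, hb, propagator, div_eq_mul_inv]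
  push_cast
  ring

theorem synth_rot_truncate_ae {t : ℝ} {a b : Dist} {y : State} (ha : ∀ n, y.1 n = a n)
    (hb : ∀ n, y.2 n = ((bracket n)⁻¹ : ℝ) * b n) (N : ℕ) :
    synth (rot t (truncate N y.1, truncate N y.2)) =ᵐ[torusMeasure]
      truncEval N (propagator t a b) := by
  have h : ∀ n, rot t (truncate N y.1, truncate N y.2) n =
      if n ∈ freqBall N then propagator t a b n else 0 := fun n => by
    rw [rot_apply, truncate_apply, truncate_apply, propagator_eq_rot ha hb, rot_apply]
    split_ifs <;> simp
  refine (synth_ae _).trans ?_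
  filter_upwards [synthC_ae_sum (a := rot t (truncate N y.1, truncate N y.2)) (S := freqBall N)
    fun n hn => by rw [h, if_neg hn]] with x hx
  rw [hx, truncEval]
  refine congrArg Complex.re (Finset.sum_congr rfl fun n hn => ?_)
  rw [h, if_pos hn]

/-- The truncated fields are defined at every point and jointly measurable, so Tonelli applies to
them; lower semicontinuity in L² passes their bounds to the full field. -/
theorem expMoment_le_liminf (c : ℝ) {t : ℝ} {a b : Dist} {y : State} (ha : ∀ n, y.1 n = a n)
    (hb : ∀ n, y.2 n = ((bracket n)⁻¹ : ℝ) * b n) :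
    expMoment c (synth (rot t y)) ≤ liminf (fun N : ℕ => ∫⁻ x,
      ENNReal.ofReal (Real.exp (c * |truncEval N (propagator t a b) x|)) ∂torusMeasure) atTop := by
  have hlim : Tendsto (fun N => (synth (rot t (truncate N y.1, truncate N y.2)), (0 : ℝ))) atTop
      (𝓝 (synth (rot t y), 0)) :=
    ((synth.continuous.comp (rot t).continuous).tendsto y |>.comp
      ((tendsto_truncate y.1).prodMk_nhds (tendsto_truncate y.2))).prodMk_nhds tendsto_const_nhds
  have hlsc := lowerSemicontinuous_lintegral (μ := torusMeasure)
    (θ := fun _ u _ => ENNReal.ofReal (Real.exp (c * |u|)))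
    (fun x => by
      refine ENNReal.continuous_ofReal.comp (f := fun p : ℝ × ℝ => Real.exp (c * |p.2|)) ?_
      fun_prop) (by fun_prop)
  have h := (lowerSemicontinuous_iff_le_liminf.1 hlsc (synth (rot t y), 0)).trans
    (liminf_le_liminf_of_le hlim)
  refine h.trans_eq ?_
  rw [← Filter.liminf_comp]
  congr 1
  funext N
  refine lintegral_congr_ae ?_
  filter_upwards [synth_rot_truncate_ae ha hb N] with x hx
  exact congrArg (fun u => ENNReal.ofReal (Real.exp (c * |u|))) hx

theorem measurable_truncEval_randomData (hg : IsGaussianFamily P g) (φ₀ φ₁ : Dist) (N : ℕ) :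
    Measurable fun p : (Ω × ℝ) × Torus => truncEval N (propagator p.1.2
      (randomData (g 0) φ₀ 0 p.1.1) (randomData (g 1) φ₁ 0 p.1.1)) p.2 := by
  unfold truncEval propagator randomData
  refine Complex.measurable_re.comp (Finset.measurable_sum _ fun n _ => ?_)
  have h0 : Measurable fun p : (Ω × ℝ) × Torus => g 0 n p.1.1 :=
    (hg.measurable 0 n).comp (measurable_fst.comp measurable_fst)
  have h1 : Measurable fun p : (Ω × ℝ) × Torus => g 1 n p.1.1 :=
    (hg.measurable 1 n).comp (measurable_fst.comp measurable_fst)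
  have h2 : Measurable fun p : (Ω × ℝ) × Torus => UnitAddTorus.mFourier n p.2 :=
    (UnitAddTorus.mFourier n).continuous.measurable.comp measurable_snd
  refine Measurable.mul ?_ h2
  refine Measurable.add (Measurable.mul ?_ ((h0.mul_const _).add_const _))
    (Measurable.mul ?_ ((h1.mul_const _).add_const _))
  · exact Complex.measurable_ofReal.comp (by fun_prop)
  · exact Complex.measurable_ofReal.comp (by fun_prop)

/-- The exponential moments in space of the random linear solution are almost surely locally
integrable in time. -/
theorem IsGaussianFamily.ae_lintegral_expMoment_lt_top [IsProbabilityMeasure P]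
    (hg : IsGaussianFamily P g) {φ₀ φ₁ : Dist}
    (hs₀ : ∀ n, φ₀ (-n) = conj (φ₀ n)) (hs₁ : ∀ n, φ₁ (-n) = conj (φ₁ n))
    (h₀ : Summable fun n => ‖φ₀ n‖ ^ 2) (h₁ : Summable fun n => (bracket n)⁻¹ ^ 2 * ‖φ₁ n‖ ^ 2)
    (c T : ℝ) :
    ∀ᵐ ω ∂P, ∀ y : State, (∀ n, y.1 n = g 0 n ω * φ₀ n) →
      (∀ n, y.2 n = ((bracket n)⁻¹ : ℝ) * (g 1 n ω * φ₁ n)) →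
      ∫⁻ t in Set.Icc (-T) T, expMoment c (synth (rot t y)) < ∞ := by
  set Z : ℕ → Ω × ℝ → Torus → ℝ := fun N p x => truncEval N (propagator p.2
      (randomData (g 0) φ₀ 0 p.1) (randomData (g 1) φ₁ 0 p.1)) x with hZ
  have hF : ∀ N, Measurable fun p : (Ω × ℝ) × Torus =>
      ENNReal.ofReal (Real.exp (c * |Z N p.1 p.2|)) := fun N => by
    have := measurable_truncEval_randomData hg φ₀ φ₁ N
    exact ENNReal.measurable_ofReal.comp (Real.measurable_exp.comp
      ((_root_.continuous_abs.measurable.comp this).const_mul c))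
  set M : ℕ → Ω × ℝ → ℝ≥0∞ := fun N p =>
    ∫⁻ x, ENNReal.ofReal (Real.exp (c * |Z N p x|)) ∂torusMeasure with hM
  have hMm : ∀ N, Measurable (M N) := fun N => (hF N).lintegral_prod_right'
  have hLm : Measurable fun p => liminf (fun N => M N p) atTop := Measurable.liminf hMm
  set B : ℝ≥0∞ := 2 * ENNReal.ofReal (Real.exp
    ((∑' n, (‖φ₀ n‖ ^ 2 + (bracket n)⁻¹ ^ 2 * ‖φ₁ n‖ ^ 2)) * c ^ 2 / 2)) with hB
  -- After exchanging the integrals, at fixed (t, x) the field is a centred Gaussian whose variance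
  -- is bounded uniformly in N, t and x.
  have hMB : ∀ N t, ∫⁻ ω, M N (ω, t) ∂P ≤ B := fun N t => by
    have hsw : ∫⁻ ω, M N (ω, t) ∂P =
        ∫⁻ x, ∫⁻ ω, ENNReal.ofReal (Real.exp (c * |Z N (ω, t) x|)) ∂P ∂torusMeasure :=
      lintegral_lintegral_swap (((hF N).comp (f := fun q : Ω × Torus => ((q.1, t), q.2))
        (by fun_prop)).aemeasurable)
    rw [hsw]
    have hx : ∀ x, ∫⁻ ω, ENNReal.ofReal (Real.exp (c * |Z N (ω, t) x|)) ∂P ≤ B := fun x => by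
      have hlaw := hg.hasLaw_truncEval hs₀ hs₁ 0 0 N t x
      have h0 : truncEval N (propagator t 0 0) x = 0 := by simp [truncEval, propagator]
      rw [h0] at hlaw
      refine (lintegral_exp_abs_gaussianReal_le hlaw c).trans ?_
      rw [hB, Real.coe_toNNReal _ (Finset.sum_nonneg fun n _ => modeVariance_nonneg _ _ _ _)]
      refine mul_le_mul' le_rfl (ENNReal.ofReal_le_ofReal (Real.exp_le_exp.2 ?_))
      have : ∑ n ∈ freqBall N, modeVariance φ₀ φ₁ t n ≤
          ∑' n, (‖φ₀ n‖ ^ 2 + (bracket n)⁻¹ ^ 2 * ‖φ₁ n‖ ^ 2) :=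
        ((summable_modeVariance h₀ h₁ t).sum_le_tsum _ fun n _ => modeVariance_nonneg _ _ _ _).trans
          (fieldVariance_le h₀ h₁ t)
      gcongr
    refine (lintegral_mono hx).trans_eq ?_
    simp
  have hfin : ∫⁻ ω, (∫⁻ t in Set.Icc (-T) T, liminf (fun N => M N (ω, t)) atTop) ∂P < ∞ := by
    rw [lintegral_lintegral_swap hLm.aemeasurable]
    calc ∫⁻ t in Set.Icc (-T) T, ∫⁻ ω, liminf (fun N => M N (ω, t)) atTop ∂P
        ≤ ∫⁻ _ in Set.Icc (-T) T, B := by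
          refine lintegral_mono fun t => ?_
          refine (lintegral_liminf_le fun N => (hMm N).comp (by fun_prop)).trans ?_
          refine (liminf_le_liminf (Eventually.of_forall fun N => hMB N t)).trans_eq ?_
          exact liminf_const B
      _ < ∞ := by
          rw [setLIntegral_const]
          exact ENNReal.mul_lt_top (ENNReal.mul_lt_top (by simp) ENNReal.ofReal_lt_top)
            (by simp)
  have hmeas : Measurable fun ω => ∫⁻ t in Set.Icc (-T) T, liminf (fun N => M N (ω, t)) atTop :=
    hLm.lintegral_prod_right'
  -- The exceptional set is fixed before y: the state y exists only for those ω whose random series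
  -- is square-summable.
  filter_upwards [ae_lt_top hmeas hfin.ne] with ω hω y hy1 hy2
  refine (lintegral_mono fun t => ?_).trans_lt hω
  exact expMoment_le_liminf c (fun n => by simp [hy1, randomData])
    (fun n => by simp [hy2, randomData])

theorem IsGaussianFamily.ae_forall_lintegral_expMoment_lt_top [IsProbabilityMeasure P]
    (hg : IsGaussianFamily P g) {φ₀ φ₁ : Dist}
    (hs₀ : ∀ n, φ₀ (-n) = conj (φ₀ n)) (hs₁ : ∀ n, φ₁ (-n) = conj (φ₁ n))
    (h₀ : Summable fun n => ‖φ₀ n‖ ^ 2) (h₁ : Summable fun n => (bracket n)⁻¹ ^ 2 * ‖φ₁ n‖ ^ 2) :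
    ∀ᵐ ω ∂P, ∀ y : State, (∀ n, y.1 n = g 0 n ω * φ₀ n) →
      (∀ n, y.2 n = ((bracket n)⁻¹ : ℝ) * (g 1 n ω * φ₁ n)) →
      ∀ c T : ℝ, ∫⁻ t in Set.Icc (-T) T, expMoment c (synth (rot t y)) < ∞ := by
  have h : ∀ᵐ ω ∂P, ∀ m : ℕ, ∀ y : State, (∀ n, y.1 n = g 0 n ω * φ₀ n) →
      (∀ n, y.2 n = ((bracket n)⁻¹ : ℝ) * (g 1 n ω * φ₁ n)) →
      ∫⁻ t in Set.Icc (-(m : ℝ)) m, expMoment m (synth (rot t y)) < ∞ :=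
    -- Monotonicity in c and T reduces all pairs to countably many, with a common null set.
    ae_all_iff.2 fun m => hg.ae_lintegral_expMoment_lt_top hs₀ hs₁ h₀ h₁ m m
  filter_upwards [h] with ω hω y hy1 hy2 c T
  obtain ⟨m, hm⟩ := exists_nat_ge (max c T)
  refine ((lintegral_mono fun t => ?_).trans (lintegral_mono_set ?_)).trans_lt (hω m y hy1 hy2)
  · refine lintegral_mono fun x => ENNReal.ofReal_le_ofReal (Real.exp_le_exp.2 ?_)
    exact mul_le_mul_of_nonneg_right ((le_max_left _ _).trans hm) (abs_nonneg _)
  · have := (le_max_right c T).trans hm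
    exact Set.Icc_subset_Icc (neg_le_neg this) this

end RandomField

end

end RenormNLW

namespace RenormNLW

noncomputable section

/-! ### Almost sure well-posedness for the random data -/

section RandomData

variable {Ω : Type*} [MeasurableSpace Ω] {P : Measure Ω} {g : Fin 2 → Freq → Ω → ℂ}
  {φ₀ φ₁ r₀ r₁ : Dist}

/-- Well-posedness for a given force. -/
def HasUniqueSolution (s₀ : ℝ) (k : ℕ) (F : ℝ → Dist → Torus → ℝ) : Prop :=
  ∃ v w : ℝ → Dist, IsGlobalSolution s₀ F v w ∧ LocallyLebesgue k v ∧
    ∀ v' w' : ℝ → Dist, IsGlobalSolution s₀ F v' w' →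
      (∀ T : ℝ, ∫⁻ t in Set.Icc (-T) T, tnorm (2 * (k - 1)) (toFun (v' t)) ^ k < ∞) →
      v' = v ∧ w' = w

theorem nonlinearity_eq_shiftedForce [IsProbabilityMeasure P] (hg : IsGaussianFamily P g)
    (hs₀ : ∀ n, φ₀ (-n) = conj (φ₀ n)) (hs₁ : ∀ n, φ₁ (-n) = conj (φ₁ n))
    (h₀ : Summable fun n => ‖φ₀ n‖ ^ 2) (h₁ : Summable fun n => (bracket n)⁻¹ ^ 2 * ‖φ₁ n‖ ^ 2)
    (k : ℕ) (ω : Ω) :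
    nonlinearity P k (randomData (g 0) φ₀ r₀) (randomData (g 1) φ₁ r₁) ω =
      shiftedForce k (fun t => toFun (propagator t (randomData (g 0) φ₀ r₀ ω)
        (randomData (g 1) φ₁ r₁ ω))) (fieldVariance φ₀ φ₁) := by
  funext t v x
  rw [nonlinearity, shiftedForce,
    waveVariance_eq hg hs₀ hs₁ _ _ t (summable_modeVariance h₀ h₁ t)]

theorem exists_abs_fieldVariance_le (h₀ : Summable fun n => ‖φ₀ n‖ ^ 2)
    (h₁ : Summable fun n => (bracket n)⁻¹ ^ 2 * ‖φ₁ n‖ ^ 2) :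
    ∃ σm, ∀ t, |fieldVariance φ₀ φ₁ t| ≤ σm :=
  ⟨_, fun t => (abs_of_nonneg (fieldVariance_nonneg φ₀ φ₁ t)).trans_le (fieldVariance_le h₀ h₁ t)⟩

theorem toFun_propagator_ae {t : ℝ} {a b : Dist} {e : Ell2} (h : ∀ n, propagator t a b n = e n) :
    toFun (propagator t a b) =ᵐ[torusMeasure] synth e := by
  have : propagator t a b = e := funext h
  rw [this]
  exact toFun_ae (lp.memℓp e)

/-- The data are split: the rough random part evolves freely as z, with exponential moments in place
of smoothness, while the smoother r gives an initial state Y₀ in the energy space. -/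
theorem IsGaussianFamily.ae_hasUniqueSolution_three [IsProbabilityMeasure P]
    (hg : IsGaussianFamily P g) {s : ℝ} (hs : 0 ≤ s)
    (hφ₀ : MemSobolev s φ₀) (hφ₁ : MemSobolev (s - 1) φ₁)
    (hr₀ : MemSobolev (s + 1) r₀) (hr₁ : MemSobolev s r₁) :
    ∀ᵐ ω ∂P, HasUniqueSolution (min s 1) 3
      (nonlinearity P 3 (randomData (g 0) φ₀ r₀) (randomData (g 1) φ₁ r₁) ω) := by
  have h₀ : Summable fun n => ‖φ₀ n‖ ^ 2 := by
    simpa using hφ₀.summable_pow (m := 0) (by simpa using hs)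
  have h₁ : Summable fun n => (bracket n)⁻¹ ^ 2 * ‖φ₁ n‖ ^ 2 := by
    simpa using hφ₁.summable_pow (m := -1) (by push_cast; linarith)
  have hr₀' := memℓp_of_summable_weight (hr₀.summable_pow (m := 1) (by push_cast; linarith))
  have hr₁' : Memℓp r₁ 2 := memℓp_two_iff.2 (by
    simpa using hr₁.summable_pow (m := 0) (by simpa using hs))
  have hA := hg.ae_summable 0 (w := fun _ => 1) (by simpa using h₀)
  have hB := hg.ae_summable 1 (w := fun n => (bracket n)⁻¹) h₁
  filter_upwards [hA, hB, hg.ae_forall_lintegral_expMoment_lt_top hφ₀.1 hφ₁.1 h₀ h₁]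
    with ω hAω hBω hω
  rw [nonlinearity_eq_shiftedForce hg hφ₀.1 hφ₁.1 h₀ h₁]
  -- y is placed one derivative lower than Y₀: z is `synth (rot t y)`, without the smoothing ⟨∇⟩⁻¹
  -- contained in `pos`.
  let y : State := (⟨_, memℓp_of_summable_weight hAω⟩, ⟨_, memℓp_of_summable_weight hBω⟩)
  let Y₀ : State := (⟨_, hr₀'⟩, ⟨r₁, hr₁'⟩)
  have hy1 : ∀ n, y.1 n = g 0 n ω * φ₀ n := fun n => by simp [y]
  have hy2 : ∀ n, y.2 n = ((bracket n)⁻¹ : ℝ) * (g 1 n ω * φ₁ n) := fun n => rfl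
  have hexp := hω y hy1 hy2
  have hz : Continuous fun t => synth (rot t y) :=
    synth.continuous.comp (continuous_rot continuous_const)
  have hσ := continuous_fieldVariance h₀ h₁
  have hb := exists_abs_fieldVariance_le h₀ h₁
  refine (isForcing_of_expMoment (by norm_num) hz hσ hb (hexp 1)).exists_unique (j := 2) (Y₀ := Y₀)
    le_rfl (exists_global_of_expMoment hz hσ hb hexp Y₀) (fun t => ?_) (le_min hs zero_le_one)
    (min_le_right _ _)
  rw [← map_add]
  refine toFun_propagator_ae fun n => ?_
  have hbn : (bracket n : ℂ) ≠ 0 := by exact_mod_cast (bracket_pos n).ne'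
  have e1 : Y₀.1 n = (bracket n : ℂ) * r₀ n := by simp [Y₀]
  have e2 : Y₀.2 n = r₁ n := rfl
  rw [lp.coeFn_add, Pi.add_apply, rot_apply, pos_apply, rot_apply, hy1, hy2, e1, e2, propagator,
    randomData, randomData]
  push_cast
  field_simp
  ring

/-- For s ≥ 1 the randomized data are almost surely in H¹ × L², so they all go into the initial
state, the rough field is zero, and randomness survives only in the differentiable variance. -/
theorem IsGaussianFamily.ae_hasUniqueSolution_of_one_le [IsProbabilityMeasure P]
    (hg : IsGaussianFamily P g) {s : ℝ} (hs : 1 ≤ s) {j : ℕ} (hj : 1 ≤ j) (hj' : Even (j + 3))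
    (hφ₀ : MemSobolev s φ₀) (hφ₁ : MemSobolev (s - 1) φ₁)
    (hr₀ : MemSobolev (s + 1) r₀) (hr₁ : MemSobolev s r₁) :
    ∀ᵐ ω ∂P, HasUniqueSolution (min s 1) (j + 2)
      (nonlinearity P (j + 2) (randomData (g 0) φ₀ r₀) (randomData (g 1) φ₁ r₁) ω) := by
  have h₀ : Summable fun n => ‖φ₀ n‖ ^ 2 := by
    simpa using hφ₀.summable_pow (m := 0) (by push_cast; linarith)
  have h₁ : Summable fun n => (bracket n)⁻¹ ^ 2 * ‖φ₁ n‖ ^ 2 := by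
    simpa using hφ₁.summable_pow (m := -1) (by push_cast; linarith)
  have h₀' : Summable fun n => bracket n ^ 2 * ‖φ₀ n‖ ^ 2 := by
    simpa using hφ₀.summable_pow (m := 1) (by push_cast; linarith)
  have h₁' : Summable fun n => ‖φ₁ n‖ ^ 2 := by
    simpa using hφ₁.summable_pow (m := 0) (by push_cast; linarith)
  have hr₀' := memℓp_of_summable_weight (hr₀.summable_pow (m := 1) (by push_cast; linarith))
  have hr₁' : Memℓp r₁ 2 := memℓp_two_iff.2 (by
    simpa using hr₁.summable_pow (m := 0) (by push_cast; linarith))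
  have hA := hg.ae_summable 0 (w := fun n => bracket n) h₀'
  have hB := hg.ae_summable 1 (w := fun _ => 1) (by simpa using h₁')
  obtain ⟨σ', hσ', hσc⟩ := exists_hasDerivAt_fieldVariance h₀' h₁'
  filter_upwards [hA, hB] with ω hAω hBω
  rw [nonlinearity_eq_shiftedForce hg hφ₀.1 hφ₁.1 h₀ h₁]
  let Y₀ : State := (⟨_, (memℓp_of_summable_weight hAω).add hr₀'⟩,
    ⟨_, (memℓp_of_summable_weight hBω).add hr₁'⟩)
  have h : IsForcing (j + 2) (fun _ => 0) (fieldVariance φ₀ φ₁) := by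
    refine ⟨continuous_const, continuous_fieldVariance h₀ h₁, exists_abs_fieldVariance_le h₀ h₁,
      fun T => ?_⟩
    have : tnorm (4 * (j + 2)) (0 : Lp ℝ 2 torusMeasure) = 0 := by
      rw [tnorm_congr (Lp.coeFn_zero ℝ 2 torusMeasure)]
      exact eLpNorm_zero
    simp only [this, add_zero, one_pow, lintegral_const, one_mul]
    simp
  refine h.exists_unique (j := j + 1) (Y₀ := Y₀) (by omega)
    (exists_global_of_smooth_variance hj' h hσ' hσc Y₀) (fun t => ?_)
    (le_min (zero_le_one.trans hs) zero_le_one) (min_le_right _ _)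
  rw [zero_add]
  refine toFun_propagator_ae fun n => ?_
  have hbn : (bracket n : ℂ) ≠ 0 := by exact_mod_cast (bracket_pos n).ne'
  have e1 : Y₀.1 n = (bracket n : ℂ) * (g 0 n ω * φ₀ n) + (bracket n : ℂ) * r₀ n := by simp [Y₀]
  have e2 : Y₀.2 n = g 1 n ω * φ₁ n + r₁ n := by simp [Y₀]
  rw [pos_apply, rot_apply, e1, e2, propagator, randomData, randomData]
  push_cast
  field_simp

end RandomData

end

end RenormNLW

/-! ### The main theorem -/

open MeasureTheory ProbabilityTheory Filter Topology
open scoped ENNReal NNReal ComplexConjugate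

theorem mainTheorem6 {Ω : Type*} [MeasurableSpace Ω] (P : Measure Ω) [IsProbabilityMeasure P]
    (g : Fin 2 → RenormNLW.Freq → Ω → ℂ) (hg : RenormNLW.IsGaussianFamily P g)
    (k : ℕ) (hk : 3 ≤ k) (hk_odd : Odd k)
    (s : ℝ) (hs_three : k = 3 → 0 < s) (hs_five : 5 ≤ k → 1 ≤ s)
    (φ₀ φ₁ r₀ r₁ : RenormNLW.Dist)
    (hφ₀ : RenormNLW.MemSobolev s φ₀) (hφ₁ : RenormNLW.MemSobolev (s - 1) φ₁)
    (hr₀ : RenormNLW.MemSobolev (s + 1) r₀) (hr₁ : RenormNLW.MemSobolev s r₁) :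
    ∀ᵐ ω ∂P, ∃ v w : ℝ → RenormNLW.Dist,
      RenormNLW.IsGlobalSolution (min s 1)
        (RenormNLW.nonlinearity P k (RenormNLW.randomData (g 0) φ₀ r₀)
          (RenormNLW.randomData (g 1) φ₁ r₁) ω) v w ∧
      RenormNLW.LocallyLebesgue k v ∧
      ∀ v' w' : ℝ → RenormNLW.Dist,
        RenormNLW.IsGlobalSolution (min s 1)
          (RenormNLW.nonlinearity P k (RenormNLW.randomData (g 0) φ₀ r₀)
            (RenormNLW.randomData (g 1) φ₁ r₁) ω) v' w' →
        (s < 1 / 2 → RenormNLW.LocallyLebesgue k v') →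
        v' = v ∧ w' = w := by
  rcases eq_or_lt_of_le hk with rfl | hk
  · filter_upwards [hg.ae_hasUniqueSolution_three (hs_three rfl).le hφ₀ hφ₁ hr₀ hr₁]
      with ω ⟨v, w, hvw, hv, huniq⟩
    refine ⟨v, w, hvw, hv, fun v' w' hv' hL => huniq v' w' hv' fun T => ?_⟩
    -- For k = 3 the uniqueness class is L³ in time with values in L⁴, as 2(k - 1) = k + 1 = 4. It
    -- is assumed below regularity ½ and follows from H^{1/2} ⊂ L⁴ above.
    rcases lt_or_ge s (1 / 2) with h | h
    · have := hL h T
      norm_num at this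
      simpa [RenormNLW.tnorm] using this
    · exact RenormNLW.lintegral_tnorm_lt_top_of_half (le_min h (by norm_num)) hv'.continuous_fst 3 T
  · obtain ⟨j, rfl⟩ : ∃ j, k = j + 2 := ⟨k - 2, by omega⟩
    -- An odd k above 3 is at least 5.
    have hs : 1 ≤ s := hs_five (by
      rcases hk_odd with ⟨m, hm⟩
      omega)
    have hj : Even (j + 3) := hk_odd.add_odd odd_one
    filter_upwards [hg.ae_hasUniqueSolution_of_one_le hs (by omega) hj hφ₀ hφ₁ hr₀ hr₁]
      with ω ⟨v, w, hvw, hv, huniq⟩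
    refine ⟨v, w, hvw, hv, fun v' w' hv' _ => huniq v' w' hv' fun T => ?_⟩
    -- Here min s 1 = 1, and H¹ embeds in L^{2(k-1)}, so every solution is in the uniqueness class.
    exact RenormNLW.lintegral_tnorm_lt_top_of_one (le_min hs le_rfl) hv'.continuous_fst _ _ T
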